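/- Let $\mathbb{K}$ be $\mathbb{R}$ or $\mathbb{C}$, let $G$ be a finite-dimensional Lie group over $\mathbb{K}$ with Lie algebra $\mathfrak{g}$, and let $R \ge 1$. Write $\mathrm{Sym}^\bullet(\mathfrak{g}) = \bigoplus_n \mathrm{Sym}^n(\mathfrak{g})$ for the symmetric tensors; its elements are polynomial functions on $\mathfrak{g}^*$ via $\delta_\varphi(\xi_1\cdots\xi_n) = \varphi(\xi_1)\cdots\varphi(\xi_n)$. Let $\mathrm{Sym}_R^\bullet(\mathfrak{g})$ be this space with the locally convex topology given by the seminorms $p_R = \sum_n n!^R\, p^{\otimes n}$, where $p$ is a continuous seminorm on $\mathfrak{g}$ and $p^{\otimes n}$ its projective tensor power. Let $\mathfrak{q}\colon \mathrm{Sym}^\bullet(\mathfrak{g}) \to U(\mathfrak{g})$, $\xi_1\cdots\xi_n \mapsto \frac{1}{n!}\sum_{\sigma\in S_n} \xi_{\sigma(1)}\cdots\xi_{\sigma(n)}$, be the Poincaré–Birkhoff–Witt symmetrization map and $\pi_r$ the projection to degree $r$. For $z\in\mathbb{K}$ the Gutt star product is the bilinear extension of $$x \star_z y = \sum_{n=0}^{k+\ell}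 z^n C_n(x,y), \qquad C_n(x,y) = \pi_{k+\ell-n}\bigl(\mathfrak{q}^{-1}(\mathfrak{q}(x)\,\mathfrak{q}(y))\bigr), \qquad x\in \mathrm{Sym}^k(\mathfrak{g}),\ y\in\mathrm{Sym}^\ell(\mathfrak{g}).$$ Let $\mathcal{O}\subseteq\mathfrak{g}^*$ be a coadjoint orbit to which the Gutt star product is tangential: for all $n$ and all $x,y\in\mathrm{Sym}^\bullet(\mathfrak{g})$ the restriction $C_n(x,y)|_{\mathcal{O}}$ depends only on $x|_{\mathcal{O}}$ and $y|_{\mathcal{O}}$. Let $I(\mathcal{O})\subseteq\mathrm{Sym}_R^\bullet(\mathfrak{g})$ be the subspace of those $x$ with $\delta_\varphi(x)=0$ for all $\varphi\in\mathcal{O}$. Then the Gutt star product restricts to a continuous star product on $\mathcal{O}$, in the following sense. 1. $I(\mathcal{O})$ is closed, and the quotient $A = \mathrm{Sym}_R^\bullet(\mathfrak{g})/I(\mathcal{O})$ (the polynomial functions on $\mathcal{O}$) and its completion $\hat A$ are Hausdorff locally convex spaces. The evaluations $\delta_\varphi$, $\varphi\in\mathcal{O}$, descend to continuous linear functionals on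 $A$, which separate the points of $A$, and extend to continuous linear functionals on $\hat A$. The canonical map $\widehat{\mathrm{Sym}}{}_R^\bullet(\mathfrak{g}) \to \hat A$ is surjective. 2. For all $z\in\mathbb{K}$ and $n\in\mathbb{N}$, the maps $\star_z$ and $C_n$ descend to bilinear maps on $A$, and these extend to bilinear maps on $\hat A$. On $A$ as well as on $\hat A$: every $\star_z$ and every $C_n$ is (jointly) continuous; $\star_z$ is associative with unit $1$; for all $z\in\mathbb{K}$ and all elements $a,b$ one has $a\star_z b = \sum_{n=0}^\infty z^n C_n(a,b)$, with absolute convergence with respect to every continuous seminorm; and $\delta_\varphi(C_0(a,b)) = \delta_\varphi(a)\,\delta_\varphi(b)$ for all $\varphi\in\mathcal{O}$. 3. For $x,y\in\mathrm{Sym}^\bullet(\mathfrak{g})$ and $\varphi\in\mathcal{O}$ one has $\delta_\varphi\bigl(C_1(x,y)-C_1(y,x)\bigr) = \varphi([d_\varphi x, d_\varphi y])$, where $d_\varphi x\in\mathfrak{g}\cong\mathfrak{g}^{**}$ is the differential at $\varphi$ of the polynomial function $x$; that is, the first order commutator is the Kirillov–Kostant–Souriau Poisson bracket on $\mathcal{O}$.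 -/

import Mathlib

open scoped TensorProduct DirectSum

noncomputable section

namespace Gutt

section Algebra

variable (𝕜 : Type*) [RCLike 𝕜] (V : Type*) [AddCommGroup V] [Module 𝕜 V]

/-- The symmetrizer on the `n`-th tensor power, `v₁ ⊗ ⋯ ⊗ vₙ ↦ (1/n!) ∑_σ v_{σ 1} ⊗ ⋯ ⊗ v_{σ n}`. -/
def symmetrizer (n : ℕ) : (⨂[𝕜]^n V) →ₗ[𝕜] (⨂[𝕜]^n V) :=
  ((n.factorial : 𝕜)⁻¹) • ∑ σ : Equiv.Perm (Fin n), (PiTensorProduct.reindex 𝕜 (fun _ => V) σ).toLinearMap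

/-- `Symⁿ(V)`: the symmetric tensors of degree `n`, i.e. the image of the symmetrizer. -/
def SymPow (n : ℕ) : Submodule 𝕜 (⨂[𝕜]^n V) := LinearMap.range (symmetrizer 𝕜 V n)

/-- `Sym^•(V) = ⨁ₙ Symⁿ(V)`. -/
abbrev Sym : Type _ := ⨁ n : ℕ, SymPow 𝕜 V n

variable {V}

/-- The symmetric product `v₁ ⋯ vₙ ∈ Symⁿ(V)` of vectors. -/
def symProd {n : ℕ} (v : Fin n → V) : Sym 𝕜 V :=
  DirectSum.lof 𝕜 ℕ (fun n => SymPow 𝕜 V n) n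
    ⟨symmetrizer 𝕜 V n (PiTensorProduct.tprod 𝕜 v), LinearMap.mem_range_self _ _⟩

variable (V) in
/-- The unit `1 ∈ Sym⁰(V)` (the empty symmetric product). -/
def symOne : Sym 𝕜 V := symProd 𝕜 (Fin.elim0 : Fin 0 → V)

variable {𝕜}

/-- The homogeneous component of degree `n`, again regarded as an element of `Sym^•(V)`. -/
def homPart (n : ℕ) (x : Sym 𝕜 V) : Sym 𝕜 V :=
  DirectSum.lof 𝕜 ℕ (fun n => SymPow 𝕜 V n) n (x n)

/-- For a linear map `f` into an associative unital algebra, the linear map on `Sym^•(V)`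
that is on `Symⁿ(V)` the restriction of `v₁ ⊗ ⋯ ⊗ vₙ ↦ f v₁ * ⋯ * f vₙ`; hence it sends
`v₁ ⋯ vₙ` to `(1/n!) ∑_σ f v_{σ 1} * ⋯ * f v_{σ n}`. -/
def symLift {A : Type*} [Ring A] [Algebra 𝕜 A] (f : V →ₗ[𝕜] A) : Sym 𝕜 V →ₗ[𝕜] A :=
  DirectSum.toModule 𝕜 ℕ A fun n =>
    (PiTensorProduct.lift
      ((MultilinearMap.mkPiAlgebraFin 𝕜 n A).compLinearMap fun _ => f)).comp (SymPow 𝕜 V n).subtype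

/-- The value at the point `φ ∈ V*` of an element of `Sym^•(V)`, regarded as a polynomial
function on `V*`: `v₁ ⋯ vₙ ↦ φ v₁ ⋯ φ vₙ`. -/
def eval (φ : Module.Dual 𝕜 V) : Sym 𝕜 V →ₗ[𝕜] 𝕜 := symLift φ

/-- `ξ ∈ V` is the differential at `φ ∈ V*` of the polynomial function `x` on `V*`
(under `V ⊆ V**`): every directional derivative of `x` at `φ` is given by `ξ`. -/
def IsDifferentialAt (x : Sym 𝕜 V) (φ : Module.Dual 𝕜 V) (ξ : V) : Prop :=
  ∀ ψ : Module.Dual 𝕜 V, HasDerivAt (fun t : 𝕜 => eval (φ + t • ψ) x) (ψ ξ) 0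

end Algebra

section Star

variable {𝕜 : Type*} [RCLike 𝕜] {L : Type*} [LieRing L] [LieAlgebra 𝕜 L]

variable (𝕜 L) in
/-- The quantization (symmetrization) map `𝔮 : Sym^•(L) → U(L)`,
`ξ₁ ⋯ ξₙ ↦ (1/n!) ∑_σ ξ_{σ 1} ⊙ ⋯ ⊙ ξ_{σ n}`. -/
def quantize : Sym 𝕜 L →ₗ[𝕜] UniversalEnvelopingAlgebra 𝕜 L :=
  symLift (UniversalEnvelopingAlgebra.ι 𝕜 (L := L) : L →ₗ[𝕜] UniversalEnvelopingAlgebra 𝕜 L)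

variable (𝕜 L) in
/-- The inverse `𝔮⁻¹` (the map `𝔮` is bijective by the Poincaré-Birkhoff-Witt theorem). -/
def dequantize : UniversalEnvelopingAlgebra 𝕜 L → Sym 𝕜 L := Function.invFun (quantize 𝕜 L)

open scoped Classical in
/-- The Gutt star product: `x ⋆_z y = ∑ₙ zⁿ π_{k+ℓ-n} (𝔮⁻¹ (𝔮 x ⊙ 𝔮 y))` for homogeneous `x`, `y`
of degrees `k`, `ℓ`, extended biadditively. The summand `n = k + ℓ` is needed for
`k = ℓ = 0` (so that `1 ⋆_z 1 = 1`) and vanishes otherwise. -/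
def guttStar (z : 𝕜) (x y : Sym 𝕜 L) : Sym 𝕜 L :=
  ∑ k ∈ DFinsupp.support x, ∑ l ∈ DFinsupp.support y, ∑ n ∈ Finset.range (k + l + 1),
    z ^ n • homPart (k + l - n)
      (dequantize 𝕜 L (quantize 𝕜 L (homPart k x) * quantize 𝕜 L (homPart l y)))

open scoped Classical in
/-- The coefficient operators `Cₙ` of the Gutt star product, `x ⋆_z y = ∑ₙ zⁿ Cₙ(x, y)`. -/
def guttC (n : ℕ) (x y : Sym 𝕜 L) : Sym 𝕜 L :=
  ∑ k ∈ DFinsupp.support x, ∑ l ∈ DFinsupp.support y,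
    if n ≤ k + l then homPart (k + l - n)
      (dequantize 𝕜 L (quantize 𝕜 L (homPart k x) * quantize 𝕜 L (homPart l y))) else 0

/-- The Gutt star product is tangential to `O ⊆ L*`: for every `n`, the restriction of
`Cₙ(x, y)` to `O` depends only on the restrictions of `x` and `y` to `O`. -/
def IsTangential (O : Set (Module.Dual 𝕜 L)) : Prop :=
  ∀ (n : ℕ) (x x' y y' : Sym 𝕜 L),
    (∀ φ ∈ O, eval φ x = eval φ x') → (∀ φ ∈ O, eval φ y = eval φ y') →
      ∀ φ ∈ O, eval φ (guttC n x y) = eval φ (guttC n x' y')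

end Star

section Topology

variable {𝕜 : Type*} [RCLike 𝕜] {V : Type*} [AddCommGroup V] [Module 𝕜 V]

/-- The tensor power `pⁿ` of a seminorm `p`: the projective seminorm on `V^{⊗ n}`. -/
def tensorSeminorm (p : Seminorm 𝕜 V) (n : ℕ) : Seminorm 𝕜 (⨂[𝕜]^n V) :=
  letI : SeminormedAddCommGroup V := p.toAddGroupSeminorm.toSeminormedAddCommGroup
  letI : NormedSpace 𝕜 V := ⟨fun a v => (map_smul_eq_mul p a v).le⟩
  PiTensorProduct.projectiveSeminorm (𝕜 := 𝕜) (E := fun _ : Fin n => V)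

theorem summable_symSeminorm (R : ℝ) (p : Seminorm 𝕜 V) (x : Sym 𝕜 V) :
    Summable fun n : ℕ => (n.factorial : ℝ) ^ R * tensorSeminorm p n (x n : ⨂[𝕜]^n V) := by
  classical
  refine summable_of_ne_finset_zero (s := DFinsupp.support x) fun n hn => ?_
  rw [DFinsupp.notMem_support_iff] at hn
  rw [hn]
  simp

/-- The seminorm `p_R = ∑ₙ n!^R pⁿ` on `Sym^•(V)`. -/
def symSeminorm (R : ℝ) (p : Seminorm 𝕜 V) : Seminorm 𝕜 (Sym 𝕜 V) :=
  Seminorm.of (fun x => ∑' n : ℕ, (n.factorial : ℝ) ^ R * tensorSeminorm p n (x n : ⨂[𝕜]^n V))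
    (by
      intro x y
      rw [← (summable_symSeminorm R p x).tsum_add (summable_symSeminorm R p y)]
      refine (summable_symSeminorm R p (x + y)).tsum_le_tsum (fun n => ?_)
        ((summable_symSeminorm R p x).add (summable_symSeminorm R p y))
      rw [← mul_add]
      refine mul_le_mul_of_nonneg_left ?_ (by positivity)
      rw [DirectSum.add_apply, Submodule.coe_add]
      exact map_add_le_add _ _ _)
    (by
      intro a x
      rw [← tsum_mul_left]
      refine tsum_congr fun n => ?_
      rw [DirectSum.smul_apply, Submodule.coe_smul, map_smul_eq_mul]
      ring)

variable (𝕜 V) in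
/-- `Sym_R^•(V)`: the space `Sym^•(V)` equipped with the `Sym_R`-topology. -/
def SymR (_R : ℝ) : Type _ := Sym 𝕜 V

instance (R : ℝ) : AddCommGroup (SymR 𝕜 V R) := inferInstanceAs (AddCommGroup (Sym 𝕜 V))

instance (R : ℝ) : Module 𝕜 (SymR 𝕜 V R) := inferInstanceAs (Module 𝕜 (Sym 𝕜 V))

variable (𝕜 V) in
/-- The identity map from `Sym^•(V)` to `Sym_R^•(V)`. -/
def toSymR (R : ℝ) : Sym 𝕜 V ≃ₗ[𝕜] SymR 𝕜 V R := LinearEquiv.refl 𝕜 (Sym 𝕜 V)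

/-- The seminorm `p_R` on `Sym_R^•(V)`. -/
def seminormR (R : ℝ) (p : Seminorm 𝕜 V) : Seminorm 𝕜 (SymR 𝕜 V R) :=
  (symSeminorm R p).comp (toSymR 𝕜 V R).symm.toLinearMap

variable [TopologicalSpace V]

/-- The `Sym_R`-topology (as a uniform structure): the one generated by the seminorms `p_R`,
where `p` runs through the continuous seminorms on `V`. -/
instance (R : ℝ) : UniformSpace (SymR 𝕜 V R) :=
  ⨅ p : {p : Seminorm 𝕜 V // Continuous p},
    (seminormR R p.1).toAddGroupSeminorm.toSeminormedAddCommGroup.toUniformSpace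

variable (𝕜 V) in
theorem withSeminorms_symR (R : ℝ) :
    WithSeminorms fun p : {p : Seminorm 𝕜 V // Continuous p} => seminormR R p.1 := by
  have : Nonempty {p : Seminorm 𝕜 V // Continuous p} := ⟨⟨0, continuous_const⟩⟩
  have : IsUniformAddGroup (SymR 𝕜 V R) := isUniformAddGroup_iInf fun p =>
    letI := (seminormR R p.1).toAddGroupSeminorm.toSeminormedAddCommGroup
    inferInstance
  exact (SeminormFamily.withSeminorms_iff_uniformSpace_eq_iInf _).2 rfl

instance (R : ℝ) : IsUniformAddGroup (SymR 𝕜 V R) := isUniformAddGroup_iInf fun p =>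
  letI := (seminormR R p.1).toAddGroupSeminorm.toSeminormedAddCommGroup
  inferInstance

instance (R : ℝ) : ContinuousSMul 𝕜 (SymR 𝕜 V R) :=
  have : Nonempty {p : Seminorm 𝕜 V // Continuous p} := ⟨⟨0, continuous_const⟩⟩
  (withSeminorms_symR 𝕜 V R).continuousSMul

instance (R : ℝ) : UniformContinuousConstSMul 𝕜 (SymR 𝕜 V R) :=
  uniformContinuousConstSMul_of_continuousConstSMul 𝕜 _

instance (R : ℝ) (S : Submodule 𝕜 (SymR 𝕜 V R)) : UniformSpace (SymR 𝕜 V R ⧸ S) :=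
  IsTopologicalAddGroup.rightUniformSpace _

instance (R : ℝ) (S : Submodule 𝕜 (SymR 𝕜 V R)) : IsUniformAddGroup (SymR 𝕜 V R ⧸ S) :=
  isUniformAddGroup_of_addCommGroup

instance (R : ℝ) (S : Submodule 𝕜 (SymR 𝕜 V R)) :
    UniformContinuousConstSMul 𝕜 (SymR 𝕜 V R ⧸ S) :=
  uniformContinuousConstSMul_of_continuousConstSMul 𝕜 _

/-- The vanishing ideal of `O ⊆ V*` in `Sym_R^•(V)`: all polynomial functions vanishing on `O`. -/
def vanishingIdeal (R : ℝ) (O : Set (Module.Dual 𝕜 V)) : Submodule 𝕜 (SymR 𝕜 V R) :=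
  ⨅ φ ∈ O, LinearMap.ker ((eval φ).comp (toSymR 𝕜 V R).symm.toLinearMap)

/-- `Sym_R^•(V)` modulo the vanishing ideal of `O`, with the quotient topology:
the polynomial functions on `O`. -/
abbrev PolOn (R : ℝ) (O : Set (Module.Dual 𝕜 V)) : Type _ := SymR 𝕜 V R ⧸ vanishingIdeal R O

/-- The restriction of a polynomial function to `O`, i.e. its class in the quotient. -/
def restrict (R : ℝ) (O : Set (Module.Dual 𝕜 V)) : Sym 𝕜 V →ₗ[𝕜] PolOn R O :=
  (vanishingIdeal R O).mkQ.comp (toSymR 𝕜 V R).toLinearMap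

/-- The completion of `PolOn R O`. -/
abbrev PolOnHat (R : ℝ) (O : Set (Module.Dual 𝕜 V)) : Type _ :=
  UniformSpace.Completion (PolOn R O)

/-- The canonical map of completions induced by the quotient map `Sym_R^•(V) → PolOn R O`. -/
def restrictHat (R : ℝ) (O : Set (Module.Dual 𝕜 V)) :
    UniformSpace.Completion (SymR 𝕜 V R) → PolOnHat R O :=
  UniformSpace.Completion.map (vanishingIdeal R O).mkQ

end Topology

/-- Let `A` be a topological vector space whose elements have values `ev φ a` at the points
`φ : O`, and let `one : A`. The family `star z` (`z : 𝕜`) is a continuous star product on `A`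
with coefficient operators `C n`. -/
structure IsContinuousStarProduct {𝕜 : Type*} [RCLike 𝕜] {A : Type*} [AddCommGroup A] [Module 𝕜 A]
    [TopologicalSpace A] {O : Type*} (ev : O → A →ₗ[𝕜] 𝕜) (one : A)
    (star : 𝕜 → A →ₗ[𝕜] A →ₗ[𝕜] A) (C : ℕ → A →ₗ[𝕜] A →ₗ[𝕜] A) : Prop where
  /-- every `star z` is jointly continuous -/
  continuous_star : ∀ z, Continuous fun ab : A × A => star z ab.1 ab.2
  /-- every `star z` is associative -/
  assoc : ∀ z a b c, star z (star z a b) c = star z a (star z b c)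
  one_star : ∀ z a, star z one a = a
  star_one : ∀ z a, star z a one = a
  /-- every coefficient operator is jointly continuous -/
  continuous_coeff : ∀ n, Continuous fun ab : A × A => C n ab.1 ab.2
  /-- `star z a b` is an entire function of `z` with Taylor coefficients `C n a b` at `0` -/
  hasSum : ∀ (z : 𝕜) (a b : A), HasSum (fun n : ℕ => z ^ n • C n a b) (star z a b)
  /-- the Taylor series converges absolutely -/
  summable : ∀ (z : 𝕜) (a b : A) (p : Seminorm 𝕜 A), Continuous p → Summable fun n : ℕ => p (z ^ n • C n a b)
  /-- in order zero, one has the pointwise product of functions -/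
  ev_coeff_zero : ∀ φ a b, ev φ (C 0 a b) = ev φ a * ev φ b

section LieGroup

open scoped Manifold ContDiff

variable {𝕜 : Type*} [RCLike 𝕜] {E : Type*} [NormedAddCommGroup E] [NormedSpace 𝕜 E]
  {H : Type*} [TopologicalSpace H] (I : ModelWithCorners 𝕜 E H)
  {G : Type*} [TopologicalSpace G] [ChartedSpace H G] [Group G]

/-- The adjoint action `Ad_g : 𝔤 → 𝔤`: the derivative at `1` of the conjugation `h ↦ g h g⁻¹`. -/
def Ad (g : G) : GroupLieAlgebra I G →L[𝕜] GroupLieAlgebra I G :=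
  mfderiv I I (fun h : G => g * h * g⁻¹) 1

/-- The coadjoint orbit of `μ ∈ 𝔤*`, where `Ad*_g μ = μ ∘ Ad_{g⁻¹}`. -/
def coadjointOrbit (μ : Module.Dual 𝕜 (GroupLieAlgebra I G)) :
    Set (Module.Dual 𝕜 (GroupLieAlgebra I G)) :=
  Set.range fun g : G => μ.comp (Ad I g⁻¹).toLinearMap

end LieGroup

end Gutt

end

/-! All algebra and all estimates are carried out on `Sym^•(𝔤)`; tangentiality then moves them to
the quotient, and density moves them to the completion.

Write β(w) = w/(e^w - 1) = ∑ (Bⱼ/j!) wʲ. Under symmetrization, left multiplication in U(𝔤) is ξ · ηᵏ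
= ∑ⱼ Bⱼ (k choose j) (ad_ηʲ ξ) η^{k-j}, where the j-th summand is a symmetric product of degree
k+1-j (`mul_symLift_symProd_const`). Hence the image of 𝔮 is a left ideal containing 1, and 𝔮 is
surjective. For injectivity (`quantize_injective`), the vector fields η ↦ β(ad_η) ξ on 𝔤 commute
like -[ξ, ζ] (`adSeries_lie`), so their negatives give a representation of U(𝔤) on formal power
series. The constant terms of 𝔮(x) applied to monomials recover the coefficients of x.

The same formula gives continuity. One has |Bⱼ/j!| ≤ 1, the seminorm q can be rescaled so that
q([x,y]) ≤ q(x)q(y)/2, and the weight n!^R with R ≥ 1 absorbs k!/(k-j)!. Thus multiplication by ξ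
costs at most 2(m+1)^R q(ξ) in degrees ≤ m. By iteration and (k+l)! ≤ 2^{k+l} k! l!, the product in
degrees k, l costs (2^{R+1})^{k+l} (`symSeminorm_pbwMul_le`), which is absorbed by replacing q by a
multiple. A larger multiple gives an extra factor aⁿ for Cₙ (`symSeminorm_guttCLin_le`), hence
absolute convergence for every z.

Evaluations are continuous, so the vanishing ideal is closed, and tangentiality makes it an ideal
for every Cₙ. The property passed on to quotient and completion is that the remainders ∑_{n ∈ s} zⁿ
Cₙ - ⋆_z are bounded uniformly in the finite set s (`boundedFamily_starRemainder`): it contains all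
continuity statements and, with density, the convergence on the completion. The completed
restriction map is onto because `Sym_R` is first countable (`surjective_completion_map`). The terms
j = 0 and j = 1, with B₁ = -1/2, give the pointwise product and the Poisson bracket. -/

open scoped TensorProduct DirectSum

noncomputable section

namespace Gutt

/-! ### Identities and bounds for the coefficients of w/(exp w - 1). -/

section Bernoulli

open Finset PowerSeries

variable (R : Type*) [CommRing R] [Algebra ℚ R]

/-- The coefficients `Bⱼ / j!` of the power series `w / (exp w - 1)`, in a `ℚ`-algebra. -/
def bernoulliCoeff (j : ℕ) : R := algebraMap ℚ R (bernoulli j / j.factorial)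

variable {R}

theorem coeff_rescale_bernoulliPowerSeries (a : R) (j : ℕ) :
    coeff j (rescale a (bernoulliPowerSeries R)) = bernoulliCoeff R j * a ^ j := by
  rw [coeff_rescale, bernoulliPowerSeries, coeff_mk, bernoulliCoeff, mul_comm]

theorem coeff_rescale_exp (a : R) (j : ℕ) :
    coeff j (rescale a (exp R)) = algebraMap ℚ R (j.factorial : ℚ)⁻¹ * a ^ j := by
  rw [coeff_rescale, coeff_exp, mul_comm, one_div]

theorem rescale_bernoulliPowerSeries_mul (a : R) :
    rescale a (bernoulliPowerSeries R) * (rescale a (exp R) - 1) = C a * X := by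
  have h := congrArg (rescale a) (bernoulliPowerSeries_mul_exp_sub_one R)
  rwa [map_mul, map_sub, map_one, rescale_X] at h

/-- Compare coefficients of X^{k+1} in β((a-b)X)(e^{aX} - e^{bX}) = (a-b)X e^{bX} and cancel a - b.
It will be applied with a and b the left and right multiplications by one element, so that a - b is
its commutator. -/
theorem sum_bernoulliCoeff_mul_geom_sum [IsDomain R] {a b : R} (hab : a ≠ b) (k : ℕ) :
    ∑ x ∈ antidiagonal k, bernoulliCoeff R x.1 * algebraMap ℚ R ((x.2 + 1).factorial : ℚ)⁻¹ *
      ((∑ p ∈ range (x.2 + 1), a ^ p * b ^ (x.2 - p)) * (a - b) ^ x.1) =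
      algebraMap ℚ R (k.factorial : ℚ)⁻¹ * b ^ k := by
  have hab' : a - b ≠ 0 := sub_ne_zero.2 hab
  have key : rescale (a - b) (bernoulliPowerSeries R) * (rescale a (exp R) - rescale b (exp R)) =
      C (a - b) * (rescale b (exp R) * X) := by
    have h1 := rescale_bernoulliPowerSeries_mul (a - b)
    have h2 := exp_mul_exp_eq_exp_add (a - b) b
    rw [sub_add_cancel] at h2
    linear_combination rescale b (exp R) * h1 - rescale (a - b) (bernoulliPowerSeries R) * h2
  have h := congrArg (coeff (k + 1)) key
  rw [coeff_C_mul, coeff_succ_mul_X, coeff_mul, Nat.sum_antidiagonal_succ', coeff_rescale_exp] at h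
  simp only [map_sub, coeff_rescale_bernoulliPowerSeries, coeff_rescale_exp, pow_zero, sub_self,
    mul_zero, zero_add] at h
  refine mul_left_cancel₀ hab' ?_
  rw [← h, mul_sum]
  refine sum_congr rfl fun x _ => ?_
  have := (Commute.all a b).geom_sum₂_mul (x.2 + 1)
  rw [Nat.add_sub_cancel] at this
  rw [← mul_sub, ← this]
  ring

/-- With w(a) = 1/(e^{aX} - 1), the addition theorem of exp reads w(s)w(t) = w(s+t)(1 + w(s) +
w(t)). Rewritten through β this is `key`; its coefficients, divided by st, are the claim. It is what
makes the vector fields η ↦ β(ad_η) ξ close under commutators. -/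
theorem sum_bernoulliCoeff_mul_bernoulliCoeff [IsDomain R] {s t : R} (hs : s ≠ 0) (ht : t ≠ 0)
    (hst : s + t ≠ 0) (m : ℕ) :
    ∑ x ∈ antidiagonal (m + 1), bernoulliCoeff R x.1 * bernoulliCoeff R x.2 *
      ∑ p ∈ range x.2, (s + t) ^ p * (s ^ x.1 * t ^ (x.2 - 1 - p) + t ^ x.1 * s ^ (x.2 - 1 - p)) =
      - (bernoulliCoeff R m * (s + t) ^ m) := by
  have hne : ∀ a : R, a ≠ 0 → rescale a (exp R) - 1 ≠ 0 := by
    intro a ha h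
    have := congrArg (coeff 1) h
    rw [map_sub, coeff_rescale_exp, coeff_one] at this
    simp at this
    exact ha this
  have key : rescale s (bernoulliPowerSeries R) * (rescale (s + t) (bernoulliPowerSeries R) -
        rescale t (bernoulliPowerSeries R)) * C t +
      rescale t (bernoulliPowerSeries R) * (rescale (s + t) (bernoulliPowerSeries R) -
        rescale s (bernoulliPowerSeries R)) * C s =
      - (rescale (s + t) (bernoulliPowerSeries R) * C (s * t) * X) := by
    have h1 := rescale_bernoulliPowerSeries_mul s
    have h2 := rescale_bernoulliPowerSeries_mul t
    have h3 := rescale_bernoulliPowerSeries_mul (s + t)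
    have h4 := exp_mul_exp_eq_exp_add s t
    -- After multiplication by the nonzero series e^{sX} - 1, e^{tX} - 1 and e^{(s+t)X} - 1, the
    -- identity is a polynomial consequence of the defining relations of β.
    refine mul_right_cancel₀ (mul_ne_zero (mul_ne_zero (hne s hs) (hne t ht)) (hne _ hst)) ?_
    rw [← h4] at h3 ⊢
    simp only [map_add, map_mul] at h1 h2 h3 ⊢
    generalize rescale s (bernoulliPowerSeries R) = A at *
    generalize rescale t (bernoulliPowerSeries R) = B at *
    generalize rescale (s + t) (bernoulliPowerSeries R) = D at *
    generalize rescale s (exp R) = e at *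
    generalize rescale t (exp R) = f at *
    generalize (C s : R⟦X⟧) = s' at *
    generalize (C t : R⟦X⟧) = t' at *
    linear_combination (t' * D * (e * f - 1) * (f - 1) - (t' + s') * B * (f - 1) * (e * f - 1)) * h1
      + (s' * D * (e - 1) * (e * f - 1) - (t' + s') * s' * X * (e * f - 1)) * h2
      + (s' * X * t' * (f - 1) + s' * t' * X * (e - 1) + s' * t' * X * (e - 1) * (f - 1)) * h3
  have h := congrArg (coeff (m + 1)) key
  rw [map_neg, coeff_succ_mul_X, mul_comm _ (C (s * t)), coeff_C_mul, map_add, coeff_mul_C,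
    coeff_mul_C, coeff_mul, coeff_mul] at h
  simp only [map_sub, coeff_rescale_bernoulliPowerSeries] at h
  refine mul_left_cancel₀ (mul_ne_zero hs ht) ?_
  rw [mul_neg, ← h, sum_mul, sum_mul, mul_sum, ← sum_add_distrib]
  refine sum_congr rfl fun x _ => ?_
  have e1 := (Commute.all (s + t) t).geom_sum₂_mul x.2
  have e2 := (Commute.all (s + t) s).geom_sum₂_mul x.2
  rw [add_sub_cancel_right] at e1
  rw [add_sub_cancel_left] at e2
  rw [← mul_sub, ← mul_sub, ← e1, ← e2]
  simp only [mul_add, sum_add_distrib, mul_sum, sum_mul]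
  congr 1 <;> refine sum_congr rfl fun p _ => by ring

theorem bernoulliCoeff_zero : bernoulliCoeff R 0 = 1 := by
  simp [bernoulliCoeff]

theorem bernoulliCoeff_one : bernoulliCoeff R 1 = algebraMap ℚ R (-1 / 2) := by
  simp [bernoulliCoeff, bernoulli_one]

theorem sum_inv_factorial_le (n : ℕ) :
    ∑ j ∈ range n, ((n + 1 - j).factorial : ℚ)⁻¹ ≤ 1 := by
  -- A finite form of ∑_{i ≥ 2} 1/i! = e - 2 < 1; the subtracted term lets the induction close.
  have h : ∀ n : ℕ, ∑ j ∈ range n, ((j + 2).factorial : ℚ)⁻¹ ≤ 1 - 1 / (n + 1).factorial := by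
    intro n
    induction n with
    | zero => simp
    | succ n ih =>
      rw [sum_range_succ]
      have h1 : (0 : ℚ) < (n + 1).factorial := by positivity
      have h2 : ((n + 2).factorial : ℚ) = (n + 2) * (n + 1).factorial := by
        rw [Nat.factorial_succ (n + 1)]; push_cast; ring
      have h3 : ((n + 2).factorial : ℚ)⁻¹ + 1 / (n + 2).factorial ≤ 1 / (n + 1).factorial := by
        rw [h2]
        have : (0 : ℚ) < n + 2 := by positivity
        rw [← one_div, ← add_div, div_le_div_iff₀ (by positivity) h1]
        nlinarith [mul_nonneg (Nat.cast_nonneg (α := ℚ) n) h1.le]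
      have : n + 1 + 1 = n + 2 := rfl
      rw [this]
      linarith
  rw [← sum_range_reflect]
  refine le_trans (le_of_eq ?_) ((h n).trans (sub_le_self _ (by positivity)))
  refine sum_congr rfl fun j hj => ?_
  have := mem_range.1 hj
  congr 3
  omega

/-- Induction along the recursion Bₙ/n! = -∑_{j<n} (Bⱼ/j!)/(n+1-j)!, whose weights add up to at most
1. No decay in j is needed, since the bracket estimate supplies a geometric factor. -/
theorem abs_bernoulli_div_factorial_le (j : ℕ) : |bernoulli j / (j.factorial : ℚ)| ≤ 1 := by
  induction j using Nat.strong_induction_on with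
  | _ n ih =>
  rcases Nat.eq_zero_or_pos n with rfl | hn
  · simp
  have h := congrArg (coeff (n + 1)) (bernoulliPowerSeries_mul_exp_sub_one ℚ)
  rw [coeff_mul, Nat.sum_antidiagonal_succ', coeff_X, if_neg (by omega)] at h
  simp only [map_sub, coeff_exp, coeff_one, bernoulliPowerSeries, coeff_mk, Algebra.algebraMap_self,
    RingHom.id_apply, Nat.factorial_zero, Nat.cast_one, if_true, div_one, sub_self, mul_zero,
    zero_add, Nat.add_eq_zero_iff, one_ne_zero, and_false, if_false, sub_zero] at h
  rw [Nat.sum_antidiagonal_eq_sum_range_succ_mk, sum_range_succ] at h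
  simp only [Nat.sub_self, zero_add, Nat.factorial_one, Nat.cast_one, div_one, mul_one] at h
  rw [eq_neg_of_add_eq_zero_right h, abs_neg]
  refine (abs_sum_le_sum_abs _ _).trans (le_trans (sum_le_sum fun j hj => ?_)
    (sum_inv_factorial_le n))
  have hj' := mem_range.1 hj
  rw [abs_mul, abs_of_nonneg (a := 1 / ((n - j + 1).factorial : ℚ)) (by positivity),
    show n - j + 1 = n + 1 - j by omega, one_div]
  exact mul_le_of_le_one_left (by positivity) (ih j hj')

theorem norm_bernoulliCoeff_le (𝕜 : Type*) [RCLike 𝕜] (j : ℕ) : ‖bernoulliCoeff 𝕜 j‖ ≤ 1 := by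
  have h := abs_bernoulli_div_factorial_le j
  have : bernoulliCoeff 𝕜 j = ((bernoulli j / (j.factorial : ℚ) : ℚ) : ℝ) := by
    rw [bernoulliCoeff, eq_ratCast]
    push_cast
    rfl
  rw [this, RCLike.norm_ofReal]
  exact_mod_cast h

end Bernoulli

/-! ### Transfer of polynomial identities to commuting endomorphisms. -/

section CommutingEndomorphisms

variable {𝕜 : Type*} [Field 𝕜] {W : Type*} [AddCommGroup W] [Module 𝕜 W]

/-- The subalgebra generated by `a` and `b` is commutative, so polynomials can be evaluated in it.
Identities whose proof needs cancellation are proved in the domain 𝕜[X₀, X₁] and pushed along `Θ`.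
-/
theorem exists_algHom_of_commute {a b : Module.End 𝕜 W} (h : Commute a b) :
    ∃ Θ : MvPolynomial (Fin 2) 𝕜 →ₐ[𝕜] Module.End 𝕜 W,
      Θ (MvPolynomial.X 0) = a ∧ Θ (MvPolynomial.X 1) = b := by
  let S := Algebra.adjoin 𝕜 ({a, b} : Set (Module.End 𝕜 W))
  have hS : IsMulCommutative S := Algebra.isMulCommutative_adjoin 𝕜 (by
    rintro x (rfl | rfl) y (rfl | rfl)
    exacts [rfl, h, h.symm, rfl])
  let _ : CommRing S := { (inferInstance : Ring S) with mul_comm := hS.is_comm.comm }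
  have ha : a ∈ S := Algebra.subset_adjoin (by simp)
  have hb : b ∈ S := Algebra.subset_adjoin (by simp)
  refine ⟨S.val.comp (MvPolynomial.aeval ![⟨a, ha⟩, ⟨b, hb⟩]), ?_, ?_⟩ <;> simp

end CommutingEndomorphisms

/-! ### Symmetric tensors, polarization and lifts to algebras. -/

section SymmetricTensors

variable {𝕜 : Type*} [RCLike 𝕜] {V : Type*} [AddCommGroup V] [Module 𝕜 V]

open Finset in
/-- The polarization identity for multilinear maps. -/
theorem sum_perm_eq_sum_finset {W : Type*} [AddCommGroup W] [Module 𝕜 W] {n : ℕ}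
    (f : MultilinearMap 𝕜 (fun _ : Fin n => V) W) (v : Fin n → V) :
    ∑ σ : Equiv.Perm (Fin n), f (fun i => v (σ i)) =
      ∑ T : Finset (Fin n), (-1 : ℤ) ^ #T • f (fun _ => ∑ j ∈ Tᶜ, v j) := by
  classical
  -- By multilinearity the term of `T` is a sum over the maps `r` whose image avoids `T`.
  have h1 : ∀ T : Finset (Fin n), (-1 : ℤ) ^ #T • f (fun _ => ∑ j ∈ Tᶜ, v j) =
      ∑ r : Fin n → Fin n, if T ∈ (univ.image r)ᶜ.powerset then
        (-1 : ℤ) ^ #T • f (fun i => v (r i)) else 0 := by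
    intro T
    rw [f.map_sum_finset (fun _ j => v j) (fun _ => Tᶜ), smul_sum, ← sum_filter]
    refine sum_congr ?_ fun _ _ => rfl
    ext r
    simp only [Fintype.mem_piFinset, mem_compl, mem_filter, mem_univ, true_and, mem_powerset,
      subset_iff, mem_image, not_exists]
    exact ⟨fun h x hx i hi => h i (hi ▸ hx), fun h i hi => h hi i rfl⟩
  rw [sum_congr rfl fun T _ => h1 T, sum_comm]
  -- The alternating sum over the subsets of the complement of the image of `r` vanishes unless that
  -- complement is empty, so only permutations survive.
  have h2 : ∀ r : Fin n → Fin n, (∑ T : Finset (Fin n), if T ∈ (univ.image r)ᶜ.powerset then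
      (-1 : ℤ) ^ #T • f (fun i => v (r i)) else 0) =
      if Function.Bijective r then f (fun i => v (r i)) else 0 := by
    intro r
    rw [← sum_filter, filter_mem_eq_inter, univ_inter, ← sum_smul, sum_powerset_neg_one_pow_card]
    have : (univ.image r)ᶜ = ∅ ↔ Function.Bijective r := by
      rw [← Finite.surjective_iff_bijective, compl_eq_empty_iff, eq_univ_iff_forall]
      simp [Function.Surjective]
    by_cases h : Function.Bijective r
    · rw [if_pos h, if_pos (this.2 h), one_smul]
    · rw [if_neg h, if_neg (mt this.1 h), zero_smul]
  rw [sum_congr rfl fun r _ => h2 r, ← sum_filter]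
  refine sum_bij (fun σ _ => ⇑σ) (fun σ _ => mem_filter.2 ⟨mem_univ _, σ.bijective⟩)
    (fun σ _ τ _ h => DFunLike.coe_injective h)
    (fun r hr => ⟨Equiv.ofBijective r (mem_filter.1 hr).2, mem_univ _, rfl⟩) fun _ _ => rfl

theorem symmetrizer_tprod {n : ℕ} (v : Fin n → V) :
    symmetrizer 𝕜 V n (PiTensorProduct.tprod 𝕜 v) =
      (n.factorial : 𝕜)⁻¹ • ∑ σ : Equiv.Perm (Fin n), PiTensorProduct.tprod 𝕜 (fun i => v (σ i)) := by
  rw [symmetrizer, LinearMap.smul_apply, LinearMap.sum_apply]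
  congr 1
  simp only [LinearEquiv.coe_coe, PiTensorProduct.reindex_tprod]
  exact Fintype.sum_equiv (Equiv.inv _) _ _ fun σ => rfl

theorem symmetrizer_tprod_const (n : ℕ) (v : V) :
    symmetrizer 𝕜 V n (PiTensorProduct.tprod 𝕜 fun _ => v) = PiTensorProduct.tprod 𝕜 fun _ => v := by
  rw [symmetrizer_tprod, Finset.sum_const, Finset.card_univ, Fintype.card_perm, Fintype.card_fin,
    ← Nat.cast_smul_eq_nsmul 𝕜, smul_smul, inv_mul_cancel₀, one_smul]
  exact_mod_cast n.factorial_ne_zero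

theorem symmetrizer_mem {n : ℕ} (t : ⨂[𝕜]^n V) : symmetrizer 𝕜 V n t ∈ SymPow 𝕜 V n :=
  LinearMap.mem_range_self _ t

/-- Polarization writes a symmetrized tensor as a combination of powers, and powers are fixed by the
symmetrizer. All later identities of linear maps on `Sym^•` are therefore checked on powers only. -/
theorem symPow_eq_span (n : ℕ) :
    SymPow 𝕜 V n = Submodule.span 𝕜 (Set.range fun v : V => PiTensorProduct.tprod 𝕜 fun _ => v) := by
  refine le_antisymm ?_ (Submodule.span_le.2 ?_)
  · rintro _ ⟨t, rfl⟩
    induction t using PiTensorProduct.induction_on with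
    | smul_tprod r v =>
      rw [map_smul, symmetrizer_tprod, sum_perm_eq_sum_finset (PiTensorProduct.tprod 𝕜)]
      refine Submodule.smul_mem _ _ (Submodule.smul_mem _ _ (Submodule.sum_mem _ fun T _ => ?_))
      rw [← Int.cast_smul_eq_zsmul 𝕜]
      exact Submodule.smul_mem _ _ (Submodule.subset_span (Set.mem_range_self _))
    | add x y hx hy => rw [map_add]; exact add_mem hx hy
  · rintro _ ⟨v, rfl⟩
    exact (LinearMap.mem_range.2 ⟨_, symmetrizer_tprod_const n v⟩ :
      _ ∈ LinearMap.range (symmetrizer 𝕜 V n))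

theorem symmetrizer_eq_self {n : ℕ} {x : ⨂[𝕜]^n V} (h : x ∈ SymPow 𝕜 V n) :
    symmetrizer 𝕜 V n x = x := by
  rw [symPow_eq_span] at h
  induction h using Submodule.span_induction with
  | mem x hx => obtain ⟨v, rfl⟩ := hx; exact symmetrizer_tprod_const n v
  | zero => simp
  | add x y _ _ hx hy => rw [map_add, hx, hy]
  | smul a x _ hx => rw [map_smul, hx]

variable (𝕜) in
/-- The inclusion of the symmetric tensors of degree `n`. -/
abbrev symOf (n : ℕ) : SymPow 𝕜 V n →ₗ[𝕜] Sym 𝕜 V := DirectSum.lof 𝕜 ℕ (fun n => SymPow 𝕜 V n) n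

variable (𝕜 V) in
/-- The projection of `Tⁿ(V)` to the symmetric tensors, as a map to `Sym^•(V)`. -/
def symMk (n : ℕ) : (⨂[𝕜]^n V) →ₗ[𝕜] Sym 𝕜 V :=
  (symOf 𝕜 n).comp ((symmetrizer 𝕜 V n).codRestrict (SymPow 𝕜 V n) symmetrizer_mem)

theorem symMk_tprod {n : ℕ} (v : Fin n → V) :
    symMk 𝕜 V n (PiTensorProduct.tprod 𝕜 v) = symProd 𝕜 v := rfl

theorem symMk_coe {n : ℕ} (x : SymPow 𝕜 V n) : symMk 𝕜 V n x = symOf 𝕜 n x := by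
  rw [symMk, LinearMap.comp_apply]
  congr 1
  exact Subtype.ext (symmetrizer_eq_self x.2)

/-- The symmetric product as a multilinear map. -/
def symProdMulti (n : ℕ) : MultilinearMap 𝕜 (fun _ : Fin n => V) (Sym 𝕜 V) :=
  (symMk 𝕜 V n).compMultilinearMap (PiTensorProduct.tprod 𝕜)

theorem span_symProd_const :
    Submodule.span 𝕜 (Set.range fun p : ℕ × V => symProd 𝕜 fun _ : Fin p.1 => p.2) = ⊤ := by
  refine top_le_iff.1 fun x _ => ?_
  induction x using DirectSum.induction_on with
  | zero => exact zero_mem _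
  | add x y hx hy => exact add_mem (hx trivial) (hy trivial)
  | of n x =>
    have : DirectSum.of (fun n => SymPow 𝕜 V n) n x = symMk 𝕜 V n x := by rw [symMk_coe]; rfl
    rw [this]
    have h : (x : ⨂[𝕜]^n V) ∈ Submodule.span 𝕜 (Set.range fun v : V => PiTensorProduct.tprod 𝕜 fun _ => v) := by
      rw [← symPow_eq_span]; exact x.2
    refine Submodule.span_induction (p := fun x _ => symMk 𝕜 V n x ∈ _) ?_ ?_ ?_ ?_ h
    · rintro _ ⟨v, rfl⟩
      exact Submodule.subset_span ⟨(n, v), rfl⟩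
    · simp
    · intro x y _ _ hx hy; rw [map_add]; exact add_mem hx hy
    · intro a x _ hx; rw [map_smul]; exact Submodule.smul_mem _ _ hx

/-- Linear maps on `Sym^•(V)` are determined by their values on powers of vectors. -/
theorem sym_linearMap_ext {W : Type*} [AddCommGroup W] [Module 𝕜 W] {f g : Sym 𝕜 V →ₗ[𝕜] W}
    (h : ∀ (n : ℕ) (v : V), f (symProd 𝕜 fun _ : Fin n => v) = g (symProd 𝕜 fun _ : Fin n => v)) :
    f = g :=
  LinearMap.ext_on_range span_symProd_const fun p => h p.1 p.2

theorem symLift_lof {A : Type*} [Ring A] [Algebra 𝕜 A] (f : V →ₗ[𝕜] A) {n : ℕ} (x : SymPow 𝕜 V n) :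
    symLift f (symOf 𝕜 n x) = PiTensorProduct.lift
      ((MultilinearMap.mkPiAlgebraFin 𝕜 n A).compLinearMap fun _ => f) (x : ⨂[𝕜]^n V) := by
  rw [symLift, symOf, DirectSum.toModule_lof]
  rfl

theorem symLift_symProd {A : Type*} [Ring A] [Algebra 𝕜 A] (f : V →ₗ[𝕜] A) {n : ℕ} (v : Fin n → V) :
    symLift f (symProd 𝕜 v) =
      (n.factorial : 𝕜)⁻¹ • ∑ σ : Equiv.Perm (Fin n), (List.ofFn fun i => f (v (σ i))).prod := by
  rw [symProd, symLift_lof]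
  simp [symmetrizer_tprod]

theorem symLift_symProd_const {A : Type*} [Ring A] [Algebra 𝕜 A] (f : V →ₗ[𝕜] A) (n : ℕ) (v : V) :
    symLift f (symProd 𝕜 fun _ : Fin n => v) = f v ^ n := by
  rw [symProd, symLift_lof]
  simp [symmetrizer_tprod_const]

theorem symLift_symOne {A : Type*} [Ring A] [Algebra 𝕜 A] (f : V →ₗ[𝕜] A) :
    symLift f (symOne 𝕜 V) = 1 := by
  have : (Fin.elim0 : Fin 0 → V) = fun _ => 0 := Subsingleton.elim _ _
  rw [symOne, this, symLift_symProd_const, pow_zero]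

theorem prod_ofFn_update {A : Type*} [Monoid A] (x z : A) {n : ℕ} (i : Fin (n + 1)) :
    (List.ofFn (Function.update (fun _ : Fin (n + 1) => x) i z)).prod =
      x ^ (i : ℕ) * z * x ^ (n - i) := by
  induction n with
  | zero => obtain rfl : i = 0 := Fin.fin_one_eq_zero i; simp
  | succ n ih =>
    rw [List.ofFn_succ, List.prod_cons]
    refine Fin.cases ?_ (fun i => ?_) i
    · simp [pow_succ']
    · have : (fun j : Fin (n + 1) => Function.update (fun _ : Fin (n + 2) => x) i.succ z j.succ) =
          Function.update (fun _ : Fin (n + 1) => x) i z := by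
        funext j
        simp [Function.update_apply]
      rw [this, ih, Function.update_of_ne (Fin.succ_ne_zero i).symm]
      simp [pow_succ', mul_assoc]

theorem symLift_symProd_cons {A : Type*} [Ring A] [Algebra 𝕜 A] (f : V →ₗ[𝕜] A) (n : ℕ) (u v : V) :
    symLift f (symProd 𝕜 (Fin.cons u fun _ : Fin n => v)) =
      ((n + 1 : ℕ) : 𝕜)⁻¹ • ∑ p ∈ Finset.range (n + 1), f v ^ p * f u * f v ^ (n - p) := by
  -- Permutations are sorted by the image `p` of 0. Through the inverse permutation, `p` is the
  -- position at which `f u` appears, and each position occurs n! times.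
  have h : ∀ (p : Fin (n + 1)) (e : Equiv.Perm (Fin n)),
      (List.ofFn fun i => f ((Fin.cons u fun _ : Fin n => v : Fin (n + 1) → V)
        ((Equiv.Perm.decomposeFin.symm (p, e))⁻¹ i))).prod = f v ^ (p : ℕ) * f u * f v ^ (n - p) := by
    intro p e
    rw [← prod_ofFn_update]
    congr 2
    funext i
    rw [Function.update_apply]
    split_ifs with hi
    · have : (Equiv.Perm.decomposeFin.symm (p, e))⁻¹ i = 0 := by
        rw [Equiv.Perm.inv_eq_iff_eq, hi, Equiv.Perm.decomposeFin_symm_apply_zero]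
      rw [this, Fin.cons_zero]
    · obtain ⟨j, hj⟩ := Fin.exists_succ_eq.2
        (show (Equiv.Perm.decomposeFin.symm (p, e))⁻¹ i ≠ 0 by
          rwa [Ne, Equiv.Perm.inv_eq_iff_eq, Equiv.Perm.decomposeFin_symm_apply_zero])
      rw [← hj, Fin.cons_succ]
  rw [symLift_symProd, ← Equiv.sum_comp (Equiv.inv (Equiv.Perm (Fin (n + 1)))),
    ← Equiv.sum_comp Equiv.Perm.decomposeFin.symm, Fintype.sum_prod_type]
  simp only [Equiv.inv_apply, h, Finset.sum_const, Finset.card_univ, Fintype.card_perm,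
    Fintype.card_fin, ← Nat.cast_smul_eq_nsmul 𝕜, ← Finset.smul_sum, smul_smul]
  rw [Fin.sum_univ_eq_sum_range (fun p => f v ^ p * f u * f v ^ (n - p)) (n + 1)]
  congr 1
  rw [Nat.factorial_succ, Nat.cast_mul, mul_inv, mul_assoc, inv_mul_cancel₀, mul_one]
  exact_mod_cast n.factorial_ne_zero

theorem homPart_symOf {n : ℕ} (x : SymPow 𝕜 V n) (m : ℕ) :
    homPart m (symOf 𝕜 n x) = if m = n then symOf 𝕜 n x else 0 := by
  rw [homPart]
  split_ifs with h
  · subst h; rw [DirectSum.lof_apply]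
  · rw [symOf, DirectSum.lof_eq_of 𝕜 ℕ _ n, DirectSum.of_eq_of_ne _ _ _ h, map_zero]

end SymmetricTensors

/-! ### Left multiplication by a Lie algebra element in terms of symmetric products; surjectivity of
𝔮. -/

section LeftMultiplication

open Finset

theorem symPow_linearMap_ext {𝕜 : Type*} [RCLike 𝕜] {V : Type*} [AddCommGroup V] [Module 𝕜 V]
    {W : Type*} [AddCommGroup W] [Module 𝕜 W] {n : ℕ} {f g : (⨂[𝕜]^n V) →ₗ[𝕜] W}
    (h : ∀ v : V, f (PiTensorProduct.tprod 𝕜 fun _ => v) = g (PiTensorProduct.tprod 𝕜 fun _ => v))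
    (x : SymPow 𝕜 V n) : f x = g x := by
  obtain ⟨x, hx⟩ := x
  rw [symPow_eq_span] at hx
  refine LinearMap.eqOn_span (s := Set.range _) ?_ hx
  rintro _ ⟨v, rfl⟩
  exact h v

variable {𝕜 : Type*} [RCLike 𝕜]

/-- `sum_bernoulliCoeff_mul_geom_sum` evaluated at the commuting operators of left and right
multiplication by `x`, applied to `z`. It expresses z xᵏ through averages over the positions of an
iterated commutator among powers of `x`. -/
theorem sum_bernoulliCoeff_smul_commutator {A : Type*} [Ring A] [Algebra 𝕜 A] (x z : A) (k : ℕ) :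
    ∑ i ∈ antidiagonal k, (bernoulliCoeff 𝕜 i.1 * ((i.2 + 1).factorial : 𝕜)⁻¹) •
      ∑ p ∈ range (i.2 + 1), x ^ p *
        ((LinearMap.mulLeft 𝕜 x - LinearMap.mulRight 𝕜 x) ^ i.1) z * x ^ (i.2 - p) =
      (k.factorial : 𝕜)⁻¹ • (z * x ^ k) := by
  obtain ⟨Θ, h0, h1⟩ := exists_algHom_of_commute (LinearMap.commute_mulLeft_right (R := 𝕜) x x)
  have hne : (MvPolynomial.X 0 : MvPolynomial (Fin 2) 𝕜) ≠ MvPolynomial.X 1 := by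
    simp [MvPolynomial.X_injective.eq_iff]
  have h := congrArg (fun p => Θ p z) (sum_bernoulliCoeff_mul_geom_sum hne k)
  have hc : ∀ q : ℚ, algebraMap ℚ (MvPolynomial (Fin 2) 𝕜) q =
      algebraMap 𝕜 (MvPolynomial (Fin 2) 𝕜) (algebraMap ℚ 𝕜 q) := fun q =>
    IsScalarTower.algebraMap_apply _ _ _ _
  simp only [bernoulliCoeff, hc, map_sum, map_mul, map_pow, map_sub, h0, h1, AlgHom.commutes,
    LinearMap.sum_apply, Module.End.mul_apply, Module.algebraMap_end_apply,
    LinearMap.pow_mulLeft, LinearMap.pow_mulRight, LinearMap.mulLeft_apply,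
    LinearMap.mulRight_apply] at h
  simp only [map_inv₀, map_natCast] at h
  rw [← h]
  refine sum_congr rfl fun i _ => ?_
  simp only [bernoulliCoeff, mul_smul, smul_sum, mul_assoc]

variable {L : Type*} [LieRing L] [LieAlgebra 𝕜 L]

variable (𝕜 L) in
/-- The multilinear map `(v₁, …, vⱼ) ↦ ad v₁ ⋯ ad vⱼ`. -/
def adProd (j : ℕ) : MultilinearMap 𝕜 (fun _ : Fin j => L) (Module.End 𝕜 L) :=
  (MultilinearMap.mkPiAlgebraFin 𝕜 j (Module.End 𝕜 L)).compLinearMap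
    fun _ => (LieAlgebra.ad 𝕜 L : L →ₗ[𝕜] Module.End 𝕜 L)

/-- The multilinear map `(v₁, …, vⱼ, w₁, …, wₘ) ↦ (ad v₁ ⋯ ad vⱼ ξ) w₁ ⋯ wₘ`. -/
def adInsert (ξ : L) {j m k : ℕ} (h : j + m = k) : MultilinearMap 𝕜 (fun _ : Fin k => L) (Sym 𝕜 L) :=
  (((symProdMulti (𝕜 := 𝕜) (V := L) (m + 1)).curryLeft.compMultilinearMap
    ((LinearMap.applyₗ (R := 𝕜) ξ).compMultilinearMap (adProd 𝕜 L j))).uncurrySum).domDomCongr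
      (finSumFinEquiv.trans (finCongr h))

theorem adInsert_apply (ξ : L) {j m k : ℕ} (h : j + m = k) (v : Fin k → L) :
    adInsert (𝕜 := 𝕜) ξ h v = symProd 𝕜 (Fin.cons
      (adProd 𝕜 L j (fun i => v (finCongr h (Fin.castAdd m i))) ξ)
      (fun i => v (finCongr h (Fin.natAdd j i))) : Fin (m + 1) → L) := rfl

theorem adInsert_const (ξ η : L) {j m k : ℕ} (h : j + m = k) :
    adInsert (𝕜 := 𝕜) ξ h (fun _ => η) =
      symProd 𝕜 (Fin.cons ((LieAlgebra.ad 𝕜 L η ^ j) ξ) (fun _ => η) : Fin (m + 1) → L) := by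
  rw [adInsert_apply]
  simp [adProd]

/-- The part of the left multiplication with `ξ` on `Sym^•(L)` which maps `Symᵏ(L)` to
`Sym^{k+1-j}(L)`; it maps `ηᵏ` to `Bⱼ (k choose j) (ad_ηʲ ξ) η^{k-j}`. -/
def leftMulPart (ξ : L) (j : ℕ) : Sym 𝕜 L →ₗ[𝕜] Sym 𝕜 L :=
  DirectSum.toModule 𝕜 ℕ _ fun k =>
    if h : j ≤ k then
      (bernoulliCoeff 𝕜 j * (k.descFactorial j : 𝕜)) •
        (PiTensorProduct.lift (adInsert (𝕜 := 𝕜) ξ (Nat.add_sub_cancel' h))).comp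
          (SymPow 𝕜 L k).subtype
    else 0

theorem leftMulPart_symOf (ξ : L) {j k : ℕ} (h : j ≤ k) (x : SymPow 𝕜 L k) :
    leftMulPart ξ j (symOf 𝕜 k x) = (bernoulliCoeff 𝕜 j * (k.descFactorial j : 𝕜)) •
      PiTensorProduct.lift (adInsert (𝕜 := 𝕜) ξ (Nat.add_sub_cancel' h)) (x : ⨂[𝕜]^k L) := by
  rw [leftMulPart, symOf, DirectSum.toModule_lof, dif_pos h]
  rfl

theorem leftMulPart_symOf_of_lt (ξ : L) {j k : ℕ} (h : k < j) (x : SymPow 𝕜 L k) :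
    leftMulPart ξ j (symOf 𝕜 k x) = 0 := by
  rw [leftMulPart, symOf, DirectSum.toModule_lof, dif_neg (by omega)]
  rfl

theorem leftMulPart_symProd_const (ξ η : L) {j k : ℕ} (h : j ≤ k) :
    leftMulPart ξ j (symProd 𝕜 fun _ : Fin k => η) =
      (bernoulliCoeff 𝕜 j * (k.descFactorial j : 𝕜)) •
        symProd 𝕜 (Fin.cons ((LieAlgebra.ad 𝕜 L η ^ j) ξ) (fun _ => η) : Fin (k - j + 1) → L) := by
  rw [← symMk_tprod, ← adInsert_const ξ η (Nat.add_sub_cancel' h), symMk, LinearMap.comp_apply,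
    leftMulPart_symOf ξ h, LinearMap.codRestrict_apply, symmetrizer_tprod_const,
    PiTensorProduct.lift.tprod]

/-- `sum_bernoulliCoeff_smul_commutator` for the images of η and ξ, multiplied by k!: since `f`
respects brackets, iterated commutators are images of ad_ηʲ ξ, and the average over positions is the
lift of the symmetric product (ad_ηʲ ξ) η^{k-j}. -/
theorem mul_symLift_symProd_const {A : Type*} [Ring A] [Algebra 𝕜 A] (f : L →ₗ[𝕜] A)
    (hf : ∀ x y, f ⁅x, y⁆ = f x * f y - f y * f x) (ξ η : L) (k : ℕ) :
    f ξ * symLift f (symProd 𝕜 fun _ : Fin k => η) =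
      ∑ j ∈ range (k + 1), symLift f (leftMulPart ξ j (symProd 𝕜 fun _ : Fin k => η)) := by
  have had : ∀ j, ((LinearMap.mulLeft 𝕜 (f η) - LinearMap.mulRight 𝕜 (f η)) ^ j) (f ξ) =
      f ((LieAlgebra.ad 𝕜 L η ^ j) ξ) := by
    intro j
    induction j with
    | zero => simp
    | succ j ih => rw [pow_succ', pow_succ', Module.End.mul_apply, ih]; simp [hf]
  have h := sum_bernoulliCoeff_smul_commutator (𝕜 := 𝕜) (f η) (f ξ) k
  rw [eq_inv_smul_iff₀ (by exact_mod_cast k.factorial_ne_zero)] at h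
  rw [symLift_symProd_const, ← h, Nat.sum_antidiagonal_eq_sum_range_succ_mk, smul_sum]
  refine sum_congr rfl fun j hj => ?_
  have hj' : j ≤ k := Nat.lt_succ_iff.1 (mem_range.1 hj)
  rw [leftMulPart_symProd_const ξ η hj', map_smul, symLift_symProd_cons, smul_smul, smul_smul, had]
  congr 1
  have h1 : (((k - j + 1).factorial : ℕ) : 𝕜) ≠ 0 := by exact_mod_cast (k - j + 1).factorial_ne_zero
  have h2 : ((k - j + 1 : ℕ) : 𝕜) ≠ 0 := by exact_mod_cast Nat.succ_ne_zero (k - j)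
  have h3 : (((k - j).factorial : ℕ) : 𝕜) * (k.descFactorial j : ℕ) = (k.factorial : ℕ) := by
    exact_mod_cast Nat.factorial_mul_descFactorial hj'
  rw [← h3, Nat.factorial_succ, Nat.cast_mul, mul_inv]
  have h4 : (((k - j).factorial : ℕ) : 𝕜) ≠ 0 := by exact_mod_cast (k - j).factorial_ne_zero
  field_simp

theorem mul_symLift_symOf {A : Type*} [Ring A] [Algebra 𝕜 A] (f : L →ₗ[𝕜] A)
    (hf : ∀ x y, f ⁅x, y⁆ = f x * f y - f y * f x) (ξ : L) {k : ℕ} (x : SymPow 𝕜 L k) :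
    f ξ * symLift f (symOf 𝕜 k x) =
      ∑ j ∈ range (k + 1), symLift f (leftMulPart ξ j (symOf 𝕜 k x)) := by
  rw [← symMk_coe]
  have := symPow_linearMap_ext (n := k)
    (f := (LinearMap.mulLeft 𝕜 (f ξ)).comp ((symLift f).comp (symMk 𝕜 L k)))
    (g := ∑ j ∈ range (k + 1), (symLift f).comp ((leftMulPart ξ j).comp (symMk 𝕜 L k)))
    (fun v => by
      simpa [LinearMap.sum_apply, symMk_tprod] using mul_symLift_symProd_const f hf ξ v k) x
  simpa [LinearMap.sum_apply] using this

theorem ι_lie (x y : L) : UniversalEnvelopingAlgebra.ι 𝕜 ⁅x, y⁆ =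
    UniversalEnvelopingAlgebra.ι 𝕜 x * UniversalEnvelopingAlgebra.ι 𝕜 y -
      UniversalEnvelopingAlgebra.ι 𝕜 y * UniversalEnvelopingAlgebra.ι 𝕜 x := by
  let _ : LieRing (UniversalEnvelopingAlgebra 𝕜 L) := LieRing.ofAssociativeRing
  rw [LieHom.map_lie, LieRing.of_associative_ring_bracket]

variable (𝕜 L) in
/-- The inclusion of a Lie algebra into its universal enveloping algebra, as a linear map. -/
def ιLin : L →ₗ[𝕜] UniversalEnvelopingAlgebra 𝕜 L := UniversalEnvelopingAlgebra.ι 𝕜 (L := L)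

theorem quantize_eq : quantize 𝕜 L = symLift (ιLin 𝕜 L) := rfl

theorem ιLin_mul_quantize_symOf (ξ : L) {k : ℕ} (x : SymPow 𝕜 L k) :
    ιLin 𝕜 L ξ * quantize 𝕜 L (symOf 𝕜 k x) =
      quantize 𝕜 L (∑ j ∈ range (k + 1), leftMulPart ξ j (symOf 𝕜 k x)) := by
  rw [map_sum, quantize_eq]
  exact mul_symLift_symOf (ιLin 𝕜 L) ι_lie ξ x

/-- Left ideals of the universal enveloping algebra which contain `1` are everything. -/
theorem universalEnveloping_left_induction {p : UniversalEnvelopingAlgebra 𝕜 L → Prop}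
    (one : p 1) (add : ∀ u v, p u → p v → p (u + v)) (smul : ∀ (a : 𝕜) u, p u → p (a • u))
    (ι_mul : ∀ (ξ : L) u, p u → p (ιLin 𝕜 L ξ * u))
    (u : UniversalEnvelopingAlgebra 𝕜 L) : p u := by
  suffices h : ∀ (t : TensorAlgebra 𝕜 L) (w : UniversalEnvelopingAlgebra 𝕜 L), p w →
      p (UniversalEnvelopingAlgebra.mkAlgHom 𝕜 L t * w) by
    obtain ⟨t, rfl⟩ := Quotient.exists_rep u
    have := h t 1 one
    rwa [mul_one] at this
  intro t
  induction t using TensorAlgebra.induction with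
  | algebraMap r =>
    intro w hw
    rw [AlgHom.commutes, ← Algebra.smul_def]
    exact smul r w hw
  | ι ξ => exact fun w hw => ι_mul ξ w hw
  | mul a b ha hb =>
    intro w hw
    rw [map_mul, mul_assoc]
    exact ha _ (hb _ hw)
  | add a b ha hb =>
    intro w hw
    rw [map_add, add_mul]
    exact add _ _ (ha w hw) (hb w hw)

/-- The range contains 1 and is stable under left multiplication by elements of `L`, because the
product with ξ is again an explicit symmetrized element. -/
theorem quantize_surjective : Function.Surjective (quantize 𝕜 L) := by
  intro u
  induction u using universalEnveloping_left_induction (𝕜 := 𝕜) (L := L) with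
  | one => exact ⟨symOne 𝕜 L, symLift_symOne _⟩
  | add u v hu hv =>
    obtain ⟨x, rfl⟩ := hu
    obtain ⟨y, rfl⟩ := hv
    exact ⟨x + y, map_add _ _ _⟩
  | smul a u hu =>
    obtain ⟨x, rfl⟩ := hu
    exact ⟨a • x, map_smul _ _ _⟩
  | ι_mul ξ u hu =>
    obtain ⟨x, rfl⟩ := hu
    induction x using DirectSum.induction_on with
    | zero => exact ⟨0, by simp⟩
    | of n x => exact ⟨_, (ιLin_mul_quantize_symOf ξ x).symm⟩
    | add x y hx hy =>
      obtain ⟨a, ha⟩ := hx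
      obtain ⟨b, hb⟩ := hy
      exact ⟨a + b, by rw [map_add, map_add, ha, hb, mul_add]⟩

end LeftMultiplication

/-! ### The universal property of U(L) for linear maps respecting commutators. -/

section Enveloping

variable {𝕜 : Type*} [RCLike 𝕜] {L : Type*} [LieRing L] [LieAlgebra 𝕜 L]

theorem exists_algHom_universalEnveloping {A : Type*} [Ring A] [Algebra 𝕜 A] (f : L →ₗ[𝕜] A)
    (hf : ∀ x y, f ⁅x, y⁆ = f x * f y - f y * f x) :
    ∃ F : UniversalEnvelopingAlgebra 𝕜 L →ₐ[𝕜] A, ∀ x, F (ιLin 𝕜 L x) = f x := by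
  let _ : LieRing A := LieRing.ofAssociativeRing
  let f' : L →ₗ⁅𝕜⁆ A := { f with map_lie' := fun {x y} => hf x y }
  exact ⟨UniversalEnvelopingAlgebra.lift 𝕜 f', fun x =>
    UniversalEnvelopingAlgebra.lift_ι_apply 𝕜 f' x⟩

end Enveloping

/-! ### The Bernoulli identity inside a Lie algebra. -/

section LieIdentity

open Finset

variable {𝕜 : Type*} [RCLike 𝕜] {g : Type*} [LieRing g] [LieAlgebra 𝕜 g]

/-- `sum_bernoulliCoeff_mul_bernoulliCoeff` with s and t the operator ad h on the first and second
factor of g ⊗ g, applied to x ⊗ z. The bracket g ⊗ g → g carries s + t to ad h. -/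
theorem sum_bernoulliCoeff_smul_lie (h x z : g) (m : ℕ) :
    ∑ i ∈ antidiagonal (m + 1), (bernoulliCoeff 𝕜 i.1 * bernoulliCoeff 𝕜 i.2) •
      (∑ p ∈ range i.2, (LieAlgebra.ad 𝕜 g h ^ p)
        ⁅(LieAlgebra.ad 𝕜 g h ^ i.1) x, (LieAlgebra.ad 𝕜 g h ^ (i.2 - 1 - p)) z⁆ -
      ∑ p ∈ range i.2, (LieAlgebra.ad 𝕜 g h ^ p)
        ⁅(LieAlgebra.ad 𝕜 g h ^ i.1) z, (LieAlgebra.ad 𝕜 g h ^ (i.2 - 1 - p)) x⁆) =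
      - (bernoulliCoeff 𝕜 m • (LieAlgebra.ad 𝕜 g h ^ m) ⁅x, z⁆) := by
  set D : Module.End 𝕜 g := LieAlgebra.ad 𝕜 g h with hD
  have hcomm : Commute (D.rTensor g : Module.End 𝕜 (g ⊗[𝕜] g)) (D.lTensor g) := by
    refine TensorProduct.ext' fun a b => ?_
    simp
  obtain ⟨Θ, h0, h1⟩ := exists_algHom_of_commute hcomm
  have hX : ∀ i : Fin 2, (MvPolynomial.X i : MvPolynomial (Fin 2) 𝕜) ≠ 0 :=
    fun i => MvPolynomial.X_ne_zero i
  have hXX : (MvPolynomial.X 0 + MvPolynomial.X 1 : MvPolynomial (Fin 2) 𝕜) ≠ 0 := by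
    intro hh
    have := congrArg (MvPolynomial.aeval (fun _ : Fin 2 => (1 : 𝕜))) hh
    norm_num at this
  let B : g ⊗[𝕜] g →ₗ[𝕜] g := TensorProduct.lift (LieModule.toEnd 𝕜 g g : g →ₗ[𝕜] Module.End 𝕜 g)
  have hB : ∀ a b, B (a ⊗ₜ b) = ⁅a, b⁆ := fun a b => rfl
  -- This is the Jacobi identity.
  have hBD : ∀ w, B ((D.rTensor g + D.lTensor g : Module.End 𝕜 (g ⊗[𝕜] g)) w) = D (B w) := by
    intro w
    induction w with
    | zero => simp
    | add u v hu hv => rw [map_add, map_add, hu, hv, map_add, map_add]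
    | tmul a b =>
      rw [LinearMap.add_apply, map_add, LinearMap.rTensor_tmul, LinearMap.lTensor_tmul, hB, hB, hB]
      simp [hD]
  have hBDp : ∀ (p : ℕ) w, B (((D.rTensor g + D.lTensor g : Module.End 𝕜 (g ⊗[𝕜] g)) ^ p) w) =
      (D ^ p) (B w) := by
    intro p
    induction p with
    | zero => intro w; rfl
    | succ p ih =>
      intro w
      rw [pow_succ', pow_succ', Module.End.mul_apply, Module.End.mul_apply, hBD, ih]
  have key := congrArg (fun P => B (Θ P (x ⊗ₜ z)))
    (sum_bernoulliCoeff_mul_bernoulliCoeff (hX 0) (hX 1) hXX m)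
  have hc : ∀ j : ℕ, bernoulliCoeff (MvPolynomial (Fin 2) 𝕜) j =
      algebraMap 𝕜 (MvPolynomial (Fin 2) 𝕜) (bernoulliCoeff 𝕜 j) := fun q =>
    IsScalarTower.algebraMap_apply _ _ _ _
  have hr : ∀ n : ℕ, (D.rTensor g : Module.End 𝕜 (g ⊗[𝕜] g)) ^ n = (D ^ n).rTensor g :=
    fun n => LinearMap.rTensor_pow D n
  have hl : ∀ n : ℕ, (D.lTensor g : Module.End 𝕜 (g ⊗[𝕜] g)) ^ n = (D ^ n).lTensor g :=
    fun n => LinearMap.lTensor_pow D n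
  simp only [hc, map_sum, map_mul, map_pow, map_add, map_neg, h0, h1, AlgHom.commutes,
    LinearMap.sum_apply, Module.End.mul_apply, Module.algebraMap_end_apply, LinearMap.neg_apply,
    map_smul, hBDp, LinearMap.add_apply, hr, hl, LinearMap.rTensor_tmul, LinearMap.lTensor_tmul,
    hB] at key
  rw [← key]
  refine sum_congr rfl fun i _ => ?_
  rw [mul_smul, ← sum_sub_distrib, smul_sum, smul_sum]
  refine sum_congr rfl fun p _ => ?_
  rw [← lie_skew ((D ^ i.1) z), map_neg, sub_neg_eq_add, smul_add, smul_add]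
  simp only [smul_comm (bernoulliCoeff 𝕜 i.1)]

/-- Leibniz rule for the word [h, [h, …, u]] with constant `u`: one summand for each letter `h`
being differentiated. -/
theorem derivation_ad_pow {D : g →ₗ[𝕜] g} (hD : ∀ a b, D ⁅a, b⁆ = ⁅D a, b⁆ + ⁅a, D b⁆) (h u : g)
    (hu : D u = 0) (j : ℕ) :
    D ((LieAlgebra.ad 𝕜 g h ^ j) u) = ∑ p ∈ range j, (LieAlgebra.ad 𝕜 g h ^ p)
      ⁅D h, (LieAlgebra.ad 𝕜 g h ^ (j - 1 - p)) u⁆ := by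
  induction j with
  | zero => simpa using hu
  | succ j ih =>
    rw [pow_succ', Module.End.mul_apply, LieAlgebra.ad_apply, hD, ih, sum_range_succ', add_comm,
      lie_sum]
    congr 1
    refine sum_congr rfl fun p _ => ?_
    rw [pow_succ', Module.End.mul_apply, LieAlgebra.ad_apply,
      show j + 1 - 1 - (p + 1) = j - 1 - p by omega]

end LieIdentity

/-! ### Polynomial vector fields on L and the action of L on formal power series. -/

section VectorFields

open Finset MvPolynomial

variable {𝕜 : Type*} [RCLike 𝕜] {L : Type*} [LieRing L] [LieAlgebra 𝕜 L] {ι : Type*}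

/-- Vector fields on `L` with polynomial coefficients, as maps from `L` to `L`. -/
abbrev PolyField (𝕜 : Type*) [RCLike 𝕜] (L : Type*) [LieRing L] [LieAlgebra 𝕜 L] (ι : Type*) :
    Type _ := MvPolynomial ι 𝕜 ⊗[𝕜] L

/-- The bracket on `PolyField` is the pointwise bracket of `L`-valued polynomials (extension of
scalars), not the commutator of vector fields; the latter appears in `fieldDerivation_comm`. -/
theorem polyField_lie_add (a b c : PolyField 𝕜 L ι) : ⁅a, b + c⁆ = ⁅a, b⁆ + ⁅a, c⁆ := lie_add a b c

theorem polyField_add_lie (a b c : PolyField 𝕜 L ι) : ⁅a + b, c⁆ = ⁅a, c⁆ + ⁅b, c⁆ := add_lie a b c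

theorem polyField_zero_lie (a : PolyField 𝕜 L ι) : ⁅(0 : PolyField 𝕜 L ι), a⁆ = 0 := zero_lie a

theorem polyField_lie_zero (a : PolyField 𝕜 L ι) : ⁅a, (0 : PolyField 𝕜 L ι)⁆ = 0 := lie_zero a

theorem polyField_lie_smul (t : 𝕜) (a b : PolyField 𝕜 L ι) : ⁅a, t • b⁆ = t • ⁅a, b⁆ :=
  lie_smul t a b

theorem polyField_sum_lie (s : Finset ι) (f : ι → PolyField 𝕜 L ι) (a : PolyField 𝕜 L ι) :
    ⁅∑ i ∈ s, f i, a⁆ = ∑ i ∈ s, ⁅f i, a⁆ := sum_lie s f a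

variable (e : Module.Basis ι 𝕜 L)

/-- The coordinates of a polynomial vector field. -/
def fieldCoord (i : ι) : PolyField 𝕜 L ι →ₗ[𝕜] MvPolynomial ι 𝕜 :=
  (TensorProduct.rid 𝕜 (MvPolynomial ι 𝕜)).toLinearMap.comp
    ((e.coord i).lTensor (MvPolynomial ι 𝕜))

theorem fieldCoord_tmul (i : ι) (p : MvPolynomial ι 𝕜) (x : L) :
    fieldCoord e i (p ⊗ₜ x) = e.coord i x • p := by
  simp [fieldCoord]

variable [Fintype ι]

/-- The identity vector field `η ↦ η`. -/
def identityField : PolyField 𝕜 L ι := ∑ i, X i ⊗ₜ e i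

/-- The derivation of the polynomial ring given by a vector field. -/
def fieldDerivation : PolyField 𝕜 L ι →ₗ[𝕜] Derivation 𝕜 (MvPolynomial ι 𝕜) (MvPolynomial ι 𝕜) :=
  (mkDerivationEquiv 𝕜).toLinearMap.comp (LinearMap.pi (fieldCoord e))

theorem fieldDerivation_X (Y : PolyField 𝕜 L ι) (i : ι) :
    fieldDerivation e Y (X i) = fieldCoord e i Y :=
  mkDerivation_X _ _ _

theorem fieldDerivation_eq_sum (Y : PolyField 𝕜 L ι) (f : MvPolynomial ι 𝕜) :
    fieldDerivation e Y f = ∑ i, fieldCoord e i Y * pderiv i f := by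
  classical
  have : fieldDerivation e Y = ∑ i, fieldCoord e i Y • pderiv i := by
    refine derivation_ext fun i => ?_
    rw [fieldDerivation_X, ← Derivation.coeFnAddMonoidHom_apply, map_sum, Finset.sum_apply]
    simp [pderiv_X, Pi.single_apply]
  rw [this, ← Derivation.coeFnAddMonoidHom_apply, map_sum, Finset.sum_apply]
  rfl

/-- The componentwise action of a derivation on vector fields. -/
def fieldMap (D : Derivation 𝕜 (MvPolynomial ι 𝕜) (MvPolynomial ι 𝕜)) :
    PolyField 𝕜 L ι →ₗ[𝕜] PolyField 𝕜 L ι := (D : MvPolynomial ι 𝕜 →ₗ[𝕜] MvPolynomial ι 𝕜).rTensor L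

theorem fieldMap_tmul (D : Derivation 𝕜 (MvPolynomial ι 𝕜) (MvPolynomial ι 𝕜))
    (p : MvPolynomial ι 𝕜) (x : L) : fieldMap D (p ⊗ₜ[𝕜] x) = D p ⊗ₜ x := rfl

theorem fieldMap_lie (D : Derivation 𝕜 (MvPolynomial ι 𝕜) (MvPolynomial ι 𝕜))
    (a b : PolyField 𝕜 L ι) : fieldMap D ⁅a, b⁆ = ⁅fieldMap D a, b⁆ + ⁅a, fieldMap D b⁆ := by
  induction a using TensorProduct.induction_on with
  | zero => simp [polyField_zero_lie]
  | add a a' ha ha' => simp only [polyField_add_lie, map_add, ha, ha']; abel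
  | tmul p x =>
    induction b using TensorProduct.induction_on with
    | zero => simp [polyField_lie_zero]
    | add b b' hb hb' => simp only [polyField_lie_add, map_add, hb, hb']; abel
    | tmul q y =>
      simp only [LieAlgebra.ExtendScalars.bracket_tmul, fieldMap_tmul, Derivation.leibniz,
        smul_eq_mul, TensorProduct.add_tmul]
      rw [add_comm, mul_comm q]

theorem derivation_fieldCoord (D : Derivation 𝕜 (MvPolynomial ι 𝕜) (MvPolynomial ι 𝕜)) (i : ι)
    (Z : PolyField 𝕜 L ι) : D (fieldCoord e i Z) = fieldCoord e i (fieldMap D Z) := by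
  induction Z using TensorProduct.induction_on with
  | zero => simp
  | add a b ha hb => simp only [map_add, ha, hb]
  | tmul p x => rw [fieldMap_tmul, fieldCoord_tmul, fieldCoord_tmul, Derivation.map_smul]

theorem fieldMap_identityField (Y : PolyField 𝕜 L ι) :
    fieldMap (fieldDerivation e Y) (identityField e) = Y := by
  rw [identityField, map_sum]
  simp only [fieldMap_tmul, fieldDerivation_X]
  induction Y using TensorProduct.induction_on with
  | zero => simp
  | add a b ha hb => simp only [map_add, TensorProduct.add_tmul, sum_add_distrib, ha, hb]
  | tmul p x =>
    simp only [fieldCoord_tmul, TensorProduct.smul_tmul, ← TensorProduct.tmul_sum]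
    rw [← e.sum_repr x]
    simp

/-- Both sides are derivations, so it suffices to compare them on the variables, whose images are
the coordinates of the fields. -/
theorem fieldDerivation_comm (Y Z : PolyField 𝕜 L ι) (f : MvPolynomial ι 𝕜) :
    fieldDerivation e Y (fieldDerivation e Z f) - fieldDerivation e Z (fieldDerivation e Y f) =
      fieldDerivation e (fieldMap (fieldDerivation e Y) Z - fieldMap (fieldDerivation e Z) Y) f := by
  have : ⁅fieldDerivation e Y, fieldDerivation e Z⁆ =
      fieldDerivation e (fieldMap (fieldDerivation e Y) Z - fieldMap (fieldDerivation e Z) Y) := by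
    refine derivation_ext fun i => ?_
    rw [Derivation.commutator_apply]
    simp only [fieldDerivation_X, derivation_fieldCoord, map_sub, Derivation.sub_apply]
  rw [← this, Derivation.commutator_apply]

/-- The vector field `η ↦ ad_ηʲ ξ`. -/
def adField (j : ℕ) : L →ₗ[𝕜] PolyField 𝕜 L ι :=
  (LieAlgebra.ad 𝕜 (PolyField 𝕜 L ι) (identityField e) ^ j).comp
    (TensorProduct.mk 𝕜 (MvPolynomial ι 𝕜) L 1)

theorem adField_apply (j : ℕ) (ξ : L) : adField e j ξ =
    (LieAlgebra.ad 𝕜 (PolyField 𝕜 L ι) (identityField e) ^ j) (1 ⊗ₜ ξ) := rfl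

theorem fieldMap_adField (D : Derivation 𝕜 (MvPolynomial ι 𝕜) (MvPolynomial ι 𝕜)) (j : ℕ) (ξ : L) :
    fieldMap D (adField e j ξ) = ∑ p ∈ range j,
      (LieAlgebra.ad 𝕜 (PolyField 𝕜 L ι) (identityField e) ^ p)
        ⁅fieldMap D (identityField e), adField e (j - 1 - p) ξ⁆ :=
  derivation_ad_pow (fieldMap_lie D) _ _ (by
      change fieldMap D (1 ⊗ₜ ξ) = 0
      rw [fieldMap_tmul]; simp) j

/-- The homogeneous components of `η ↦ (ad_η / (exp ad_η - 1)) ξ`, acting as derivations. -/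
def adDerivation (j : ℕ) (ξ : L) : Derivation 𝕜 (MvPolynomial ι 𝕜) (MvPolynomial ι 𝕜) :=
  bernoulliCoeff 𝕜 j • fieldDerivation e (adField e j ξ)

theorem adDerivation_add (j : ℕ) (ξ ζ : L) :
    adDerivation e j (ξ + ζ) = adDerivation e j ξ + adDerivation e j ζ := by
  simp only [adDerivation, map_add, smul_add]

theorem adDerivation_smul (j : ℕ) (a : 𝕜) (ξ : L) :
    adDerivation e j (a • ξ) = a • adDerivation e j ξ := by
  simp only [adDerivation, map_smul, smul_comm a]

/-- A homogeneous component of [V_ξ, V_ζ] = -V_{[ξ,ζ]} for V_ξ(η) = β(ad_η) ξ, the generators of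
left translations in exponential coordinates. The derivative of ad_ηʲ ζ along another field is the
inner sum of `sum_bernoulliCoeff_smul_lie`. -/
theorem sum_adDerivation_comm (ξ ζ : L) (f : MvPolynomial ι 𝕜) (m : ℕ) :
    ∑ i ∈ antidiagonal (m + 1), (adDerivation e i.1 ξ (adDerivation e i.2 ζ f) -
      adDerivation e i.1 ζ (adDerivation e i.2 ξ f)) = - adDerivation e m ⁅ξ, ζ⁆ f := by
  have h1 := sum_bernoulliCoeff_smul_lie (𝕜 := 𝕜) (identityField e) ((1 : MvPolynomial ι 𝕜) ⊗ₜ[𝕜] ξ)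
    ((1 : MvPolynomial ι 𝕜) ⊗ₜ[𝕜] ζ) m
  simp only [← adField_apply, LieAlgebra.ExtendScalars.bracket_tmul, mul_one] at h1
  have h2 := fun i : ℕ × ℕ => fieldMap_adField e (fieldDerivation e (adField e i.1 ξ)) i.2 ζ
  have h3 := fun i : ℕ × ℕ => fieldMap_adField e (fieldDerivation e (adField e i.1 ζ)) i.2 ξ
  simp only [fieldMap_identityField] at h2 h3
  simp only [← h2, ← h3, smul_sub, sum_sub_distrib] at h1
  -- Exchanging the two degrees in the second half makes the summands commutators of the same pair
  -- of derivations.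
  have swap : ∑ i ∈ antidiagonal (m + 1), adDerivation e i.1 ζ (adDerivation e i.2 ξ f) =
      ∑ i ∈ antidiagonal (m + 1), adDerivation e i.2 ζ (adDerivation e i.1 ξ f) :=
    (Nat.sum_antidiagonal_swap (f := fun i : ℕ × ℕ =>
      adDerivation e i.1 ζ (adDerivation e i.2 ξ f))).symm
  rw [sum_sub_distrib, swap, ← sum_sub_distrib]
  have swap2 : ∑ i ∈ antidiagonal (m + 1), (bernoulliCoeff 𝕜 i.1 * bernoulliCoeff 𝕜 i.2) •
        fieldMap (fieldDerivation e (adField e i.1 ζ)) (adField e i.2 ξ) =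
      ∑ i ∈ antidiagonal (m + 1), (bernoulliCoeff 𝕜 i.1 * bernoulliCoeff 𝕜 i.2) •
        fieldMap (fieldDerivation e (adField e i.2 ζ)) (adField e i.1 ξ) := by
    rw [← Nat.sum_antidiagonal_swap]
    simp [mul_comm]
  rw [swap2, ← sum_sub_distrib] at h1
  have h4 := congrArg (fun Y => fieldDerivation e Y f) h1
  simp only [← smul_sub] at h4
  rw [map_neg, map_smul, Derivation.neg_apply] at h4
  rw [adDerivation, ← h4, map_sum, ← Derivation.coeFnAddMonoidHom_apply, map_sum, Finset.sum_apply]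
  refine sum_congr rfl fun i _ => ?_
  rw [Derivation.coeFnAddMonoidHom_apply, map_smul, Derivation.smul_apply, ← fieldDerivation_comm]
  simp only [adDerivation, Derivation.smul_apply, Derivation.map_smul, smul_sub, smul_smul]
  rw [mul_comm (bernoulliCoeff 𝕜 i.2)]

/-- Vector fields with coefficients which are homogeneous of degree `j`. -/
def homogeneousField (𝕜 : Type*) [RCLike 𝕜] (L : Type*) [LieRing L] [LieAlgebra 𝕜 L] (ι : Type*)
    (j : ℕ) : Submodule 𝕜 (PolyField 𝕜 L ι) :=
  Submodule.span 𝕜 {u | ∃ (p : MvPolynomial ι 𝕜) (x : L), p.IsHomogeneous j ∧ u = p ⊗ₜ x}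

theorem lie_identityField_mem {j : ℕ} {u : PolyField 𝕜 L ι} (hu : u ∈ homogeneousField 𝕜 L ι j) :
    ⁅identityField e, u⁆ ∈ homogeneousField 𝕜 L ι (j + 1) := by
  induction hu using Submodule.span_induction with
  | zero => rw [polyField_lie_zero]; exact zero_mem _
  | add a b _ _ ha hb => rw [polyField_lie_add]; exact add_mem ha hb
  | smul a b _ hb => rw [polyField_lie_smul]; exact Submodule.smul_mem _ _ hb
  | mem u hu =>
    obtain ⟨p, x, hp, rfl⟩ := hu
    rw [identityField, polyField_sum_lie]
    refine Submodule.sum_mem _ fun i _ => Submodule.subset_span ⟨X i * p, ⁅e i, x⁆, ?_, rfl⟩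
    rw [add_comm]
    exact (isHomogeneous_X 𝕜 i).mul hp

theorem adField_mem (j : ℕ) (ξ : L) : adField e j ξ ∈ homogeneousField 𝕜 L ι j := by
  induction j with
  | zero => exact Submodule.subset_span ⟨1, ξ, isHomogeneous_one _ _, rfl⟩
  | succ j ih =>
    rw [adField_apply, pow_succ', Module.End.mul_apply]
    exact lie_identityField_mem e ih

theorem fieldCoord_isHomogeneous {j : ℕ} {u : PolyField 𝕜 L ι} (hu : u ∈ homogeneousField 𝕜 L ι j)
    (i : ι) : (fieldCoord e i u).IsHomogeneous j := by
  rw [← mem_homogeneousSubmodule]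
  induction hu using Submodule.span_induction with
  | zero => simp
  | add a b _ _ ha hb => rw [map_add]; exact add_mem ha hb
  | smul a b _ hb => rw [map_smul]; exact Submodule.smul_mem _ _ hb
  | mem u hu =>
    obtain ⟨p, x, hp, rfl⟩ := hu
    rw [fieldCoord_tmul]
    exact Submodule.smul_mem _ _ hp

theorem adDerivation_of_isHomogeneous_zero (j : ℕ) (ξ : L) {f : MvPolynomial ι 𝕜}
    (hf : f.IsHomogeneous 0) : adDerivation e j ξ f = 0 := by
  rw [← totalDegree_zero_iff_isHomogeneous, totalDegree_eq_zero_iff_eq_C] at hf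
  rw [hf, derivation_C]

theorem adDerivation_isHomogeneous {j m n : ℕ} (h : j + m = n + 1) (ξ : L) {f : MvPolynomial ι 𝕜}
    (hf : f.IsHomogeneous m) : (adDerivation e j ξ f).IsHomogeneous n := by
  -- Constants are killed by derivations; for m > 0 the degree is j + (m - 1).
  rcases Nat.eq_zero_or_pos m with rfl | hm
  · rw [adDerivation_of_isHomogeneous_zero e j ξ hf]
    exact isHomogeneous_zero _ _ _
  · rw [adDerivation, Derivation.smul_apply, fieldDerivation_eq_sum, ← mem_homogeneousSubmodule]
    refine Submodule.smul_mem _ _ (Submodule.sum_mem _ fun i _ => ?_)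
    rw [mem_homogeneousSubmodule, show n = j + (m - 1) by omega]
    exact (fieldCoord_isHomogeneous e (adField_mem e j ξ) i).mul hf.pderiv

variable (𝕜 ι) in
/-- Formal power series on `L`, as sequences of homogeneous polynomials. -/
def FormalSeries : Submodule 𝕜 (ℕ → MvPolynomial ι 𝕜) where
  carrier := {f | ∀ n, (f n).IsHomogeneous n}
  zero_mem' n := isHomogeneous_zero _ _ _
  add_mem' hf hg n := (hf n).add (hg n)
  smul_mem' a f hf n := (homogeneousSubmodule ι 𝕜 n).smul_mem a (hf n)

/-- The action of the vector field `η ↦ (ad_η / (exp ad_η - 1)) ξ` on formal power series. -/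
def adSeries : L →ₗ[𝕜] Module.End 𝕜 (FormalSeries 𝕜 ι) :=
  LinearMap.mk₂ 𝕜
    (fun ξ f => ⟨fun n => ∑ i ∈ antidiagonal (n + 1), adDerivation e i.1 ξ (f.1 i.2), fun _ => by
      rw [← mem_homogeneousSubmodule]
      exact Submodule.sum_mem _ fun i hi =>
        adDerivation_isHomogeneous e (mem_antidiagonal.1 hi) ξ (f.2 _)⟩)
    (fun ξ ζ f => Subtype.ext <| funext fun n => by
      simp [adDerivation_add, sum_add_distrib])
    (fun a ξ f => Subtype.ext <| funext fun n => by
      simp [adDerivation_smul, smul_sum])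
    (fun ξ f g => Subtype.ext <| funext fun n => by
      simp [sum_add_distrib])
    (fun a ξ f => Subtype.ext <| funext fun n => by
      simp [smul_sum])

theorem adSeries_apply (ξ : L) (f : FormalSeries 𝕜 ι) (n : ℕ) :
    (adSeries e ξ f).1 n = ∑ i ∈ antidiagonal (n + 1), adDerivation e i.1 ξ (f.1 i.2) := rfl

/-- The double sum is regrouped by the total degree of the two derivations, as required for
`sum_adDerivation_comm`. -/
theorem adSeries_adSeries (ξ ζ : L) (f : FormalSeries 𝕜 ι) (n : ℕ) :
    (adSeries e ξ (adSeries e ζ f)).1 n = ∑ i ∈ antidiagonal (n + 2),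
      ∑ j ∈ antidiagonal i.1, adDerivation e j.1 ξ (adDerivation e j.2 ζ (f.1 i.2)) := by
  have h : ∑ i ∈ antidiagonal (n + 2), ∑ j ∈ antidiagonal i.2,
      adDerivation e i.1 ξ (adDerivation e j.1 ζ (f.1 j.2)) =
      (adSeries e ξ (adSeries e ζ f)).1 n := by
    rw [Nat.sum_antidiagonal_succ']
    simp only [HasAntidiagonal.antidiagonal_zero, sum_singleton, adSeries_apply, map_sum]
    -- The antidiagonal of n + 2 contains one term more than the definition of the composition; it
    -- differentiates the constant `f.1 0` and vanishes.
    rw [adDerivation_of_isHomogeneous_zero e 0 ζ (f.2 0), map_zero, zero_add]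
  rw [← h, sum_sigma', sum_sigma']
  refine sum_nbij' (fun x => ⟨(x.1.1 + x.2.1, x.2.2), (x.1.1, x.2.1)⟩)
    (fun x => ⟨(x.2.1, x.2.2 + x.1.2), (x.2.2, x.1.2)⟩) ?_ ?_ ?_ ?_ ?_ <;>
  · rintro ⟨⟨i, j⟩, ⟨k, l⟩⟩ hx
    simp only [mem_sigma, HasAntidiagonal.mem_antidiagonal, Sigma.mk.injEq, Prod.mk.injEq,
      true_and, and_true] at hx ⊢
    all_goals first
      | omega
      | rfl
      | exact ⟨hx.2, HEq.rfl⟩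
      | (obtain ⟨_, rfl⟩ := hx; simp)

/-- The minus sign makes ξ ↦ -`adSeries e ξ` a Lie algebra representation, hence one of U(L). -/
theorem adSeries_lie (ξ ζ : L) : adSeries e ξ * adSeries e ζ - adSeries e ζ * adSeries e ξ =
    - adSeries e ⁅ξ, ζ⁆ := by
  refine LinearMap.ext fun f => Subtype.ext <| funext fun n => ?_
  change (adSeries e ξ (adSeries e ζ f)).1 n - (adSeries e ζ (adSeries e ξ f)).1 n =
    - (adSeries e ⁅ξ, ζ⁆ f).1 n
  rw [adSeries_adSeries, adSeries_adSeries, ← sum_sub_distrib, Nat.sum_antidiagonal_succ,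
    adSeries_apply, ← sum_neg_distrib]
  simp only [← sum_sub_distrib, sum_adDerivation_comm]
  -- The remaining term has total degree 0: it is the commutator of two constant vector fields.
  have : ∀ g : MvPolynomial ι 𝕜, adDerivation e 0 ξ (adDerivation e 0 ζ g) -
      adDerivation e 0 ζ (adDerivation e 0 ξ g) = 0 := by
    intro g
    have h : ∀ x : L, ∀ D : Derivation 𝕜 (MvPolynomial ι 𝕜) (MvPolynomial ι 𝕜),
      fieldMap D (adField e 0 x) = 0 := fun x D => by rw [fieldMap_adField]; simp
    simp only [adDerivation, bernoulliCoeff_zero, one_smul, fieldDerivation_comm, h, sub_self, map_zero,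
      Derivation.zero_apply]
  simp [this]

/-- Evaluation of a vector field at a point. -/
def fieldEval (v : L) : PolyField 𝕜 L ι →ₗ[𝕜] L :=
  TensorProduct.lift ((LinearMap.lsmul 𝕜 L).comp (aeval (e.repr v)).toLinearMap)

theorem fieldEval_tmul (v : L) (p : MvPolynomial ι 𝕜) (x : L) :
    fieldEval e v (p ⊗ₜ x) = aeval (e.repr v) p • x := rfl

theorem fieldEval_lie (v : L) (a b : PolyField 𝕜 L ι) :
    fieldEval e v ⁅a, b⁆ = ⁅fieldEval e v a, fieldEval e v b⁆ := by
  induction a using TensorProduct.induction_on with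
  | zero => simp [polyField_zero_lie]
  | add a a' ha ha' => rw [polyField_add_lie, map_add, ha, ha', map_add, add_lie]
  | tmul p x =>
    induction b using TensorProduct.induction_on with
    | zero => simp [polyField_lie_zero]
    | add b b' hb hb' => rw [polyField_lie_add, map_add, hb, hb', map_add, lie_add]
    | tmul q y =>
      rw [LieAlgebra.ExtendScalars.bracket_tmul]
      simp only [fieldEval_tmul, map_mul, mul_smul, lie_smul, smul_lie]
      rw [smul_comm]

theorem fieldEval_identityField (v : L) : fieldEval e v (identityField e) = v := by
  rw [identityField, map_sum]
  simp only [fieldEval_tmul, aeval_X]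
  exact e.sum_repr v

theorem aeval_fieldCoord (v : L) (i : ι) (u : PolyField 𝕜 L ι) :
    aeval (e.repr v) (fieldCoord e i u) = e.coord i (fieldEval e v u) := by
  induction u using TensorProduct.induction_on with
  | zero => simp
  | add a b ha hb => simp only [map_add, ha, hb]
  | tmul p x => rw [fieldCoord_tmul, fieldEval_tmul, map_smul, map_smul, smul_eq_mul, smul_eq_mul,
      mul_comm]

/-- At the point v itself ad_vʲ v = 0 for j > 0, so there V_v coincides with the Euler vector field.
-/
theorem fieldEval_adField (v : L) (j : ℕ) :
    fieldEval e v (adField e j v) = if j = 0 then v else 0 := by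
  induction j with
  | zero => simp [adField_apply, fieldEval_tmul]
  | succ j ih =>
    rw [adField_apply, pow_succ', Module.End.mul_apply, LieAlgebra.ad_apply, fieldEval_lie,
      ← adField_apply, ih, fieldEval_identityField]
    split_ifs <;> simp_all

/-- Only the summand j = 0 survives at v, and it is evaluated by Euler's identity for homogeneous
polynomials. -/
theorem aeval_adSeries (v : L) (f : FormalSeries 𝕜 ι) (n : ℕ) :
    aeval (e.repr v) ((adSeries e v f).1 n) = (n + 1 : 𝕜) * aeval (e.repr v) (f.1 (n + 1)) := by
  rw [adSeries_apply, map_sum, Finset.sum_eq_single (0, n + 1)]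
  · have h := congrArg (aeval (e.repr v)) (f.2 (n + 1)).sum_X_mul_pderiv
    simp only [map_sum, map_mul, aeval_X, map_nsmul] at h
    simp only [adDerivation, bernoulliCoeff_zero, one_smul, fieldDerivation_eq_sum, map_sum, map_mul,
      aeval_fieldCoord, fieldEval_adField, if_true, Module.Basis.coord_apply]
    rw [h]
    simp
  · intro i hi hne
    have : i.1 ≠ 0 := by
      rintro h
      exact hne (Prod.ext h (by have := mem_antidiagonal.1 hi; omega))
    rw [adDerivation, Derivation.smul_apply, map_smul, fieldDerivation_eq_sum, map_sum]
    simp only [map_mul, aeval_fieldCoord, fieldEval_adField, this, if_false, map_zero, zero_mul,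
      sum_const_zero, smul_zero]
  · simp

theorem aeval_adSeries_pow (v : L) (f : FormalSeries 𝕜 ι) (k n : ℕ) :
    (n.factorial : 𝕜) * aeval (e.repr v) (((adSeries e v ^ k) f).1 n) =
      ((n + k).factorial : 𝕜) * aeval (e.repr v) (f.1 (n + k)) := by
  induction k generalizing n with
  | zero => simp
  | succ k ih =>
    rw [pow_succ', Module.End.mul_apply, aeval_adSeries, ← mul_assoc,
      show (n.factorial : 𝕜) * (n + 1) = (n + 1).factorial by
        rw [Nat.factorial_succ]; push_cast; ring, ih, show n + 1 + k = n + (k + 1) by ring]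

end VectorFields

/-! ### Injectivity of the symmetrization map. -/

section Injectivity

open Finset MvPolynomial

variable {𝕜 : Type*} [RCLike 𝕜] {L : Type*} [LieRing L] [LieAlgebra 𝕜 L] {ι : Type*} [Fintype ι]
  (e : Module.Basis ι 𝕜 L)

/-- The monomial function `v ↦ ∏ᵢ e^{a i}(v)` as a formal power series. -/
def monomialSeries {k : ℕ} (a : Fin k → ι) : FormalSeries 𝕜 ι :=
  ⟨fun n => if n = k then ∏ i, X (a i) else 0, fun n => by
    change IsHomogeneous (if n = k then ∏ i, X (a i) else 0) n
    split_ifs with h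
    · subst h
      simpa using IsHomogeneous.prod univ (fun i => (X (a i) : MvPolynomial ι 𝕜)) (fun _ => 1)
        (fun i _ => isHomogeneous_X 𝕜 (a i))
    · exact isHomogeneous_zero _ _ _⟩

/-- In the representation by -`adSeries`, 𝔮(vⁿ) sends a monomial series of degree k to a series
whose constant term is (-1)ᵏ k! times the monomial at v if n = k, and 0 otherwise. So the constant
term of 𝔮(x) applied to the monomial is (-1)ᵏ k! times a coordinate of the degree k part of x, and
𝔮(x) determines x. -/
theorem quantize_injective [FiniteDimensional 𝕜 L] : Function.Injective (quantize 𝕜 L) := by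
  classical
  intro x y hxy
  let e := Module.finBasis 𝕜 L
  obtain ⟨F, hF⟩ := exists_algHom_universalEnveloping (𝕜 := 𝕜)
    (A := Module.End 𝕜 (FormalSeries 𝕜 (Fin (Module.finrank 𝕜 L)))) ((-1 : 𝕜) • adSeries e) (fun ξ ζ => by
    have := adSeries_lie e ξ ζ
    simp only [LinearMap.smul_apply, smul_mul_smul_comm]
    rw [neg_mul_neg, one_mul, one_smul, one_smul, this]
    exact neg_one_smul 𝕜 (adSeries e ⁅ξ, ζ⁆))
  refine DFinsupp.ext fun k => Subtype.ext ?_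
  refine (Basis.piTensorProduct fun _ : Fin k => e).ext_elem fun a => ?_
  let T : (⨂[𝕜]^k L) →ₗ[𝕜] 𝕜 := PiTensorProduct.lift
    ((MultilinearMap.mkPiAlgebra 𝕜 (Fin k) 𝕜).compLinearMap fun i => e.coord (a i))
  have hT : ∀ t : ⨂[𝕜]^k L, (Basis.piTensorProduct fun _ : Fin k => e).repr t a = T t := by
    intro t
    have : (Finsupp.lapply a).comp
        (Basis.piTensorProduct fun _ : Fin k => e).repr.toLinearMap = T := by
      refine PiTensorProduct.ext (MultilinearMap.ext fun v => ?_)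
      simp [T, Basis.piTensorProduct_repr_tprod_apply]
    exact LinearMap.congr_fun this t
  let ev : FormalSeries 𝕜 _ →ₗ[𝕜] 𝕜 :=
    (aeval (0 : Fin (Module.finrank 𝕜 L) → 𝕜)).toLinearMap.comp ((LinearMap.proj 0).comp (FormalSeries 𝕜 _).subtype)
  -- The degree 0 component is constant, so it may be evaluated at `v` instead of 0; this puts
  -- `aeval_adSeries_pow` at the same `v` as the power vⁿ.
  have hev : ∀ (f : FormalSeries 𝕜 _) (v : L), ev f = aeval (e.repr v) (f.1 0) := by
    intro f v
    have hf := f.2 0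
    rw [← totalDegree_zero_iff_isHomogeneous, totalDegree_eq_zero_iff_eq_C] at hf
    change aeval _ (f.1 0) = _
    rw [hf]
    simp
  have key : (ev.comp (LinearMap.applyₗ (monomialSeries (𝕜 := 𝕜) a))).comp
      (F.toLinearMap.comp (quantize 𝕜 L)) =
      ((-1 : 𝕜) ^ k * (k.factorial : 𝕜)) • T.comp ((SymPow 𝕜 L k).subtype.comp
        (DirectSum.component 𝕜 ℕ (fun n => SymPow 𝕜 L n) k)) := by
    refine sym_linearMap_ext fun n v => ?_
    have h1 := aeval_adSeries_pow e v (monomialSeries (𝕜 := 𝕜) a) n 0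
    simp only [LinearMap.comp_apply, AlgHom.toLinearMap_apply, LinearMap.applyₗ_apply_apply]
    rw [quantize_eq, symLift_symProd_const, map_pow, hF, LinearMap.smul_apply, smul_pow, hev _ v]
    change aeval (e.repr v) ((-1 : 𝕜) ^ n • ((adSeries e v ^ n) (monomialSeries (𝕜 := 𝕜) a)).1 0) =
      ((-1 : 𝕜) ^ k * (k.factorial : 𝕜)) • T (DirectSum.component 𝕜 ℕ (fun n => SymPow 𝕜 L n) k
        (symProd 𝕜 fun _ : Fin n => v))
    have h2 : (DirectSum.component 𝕜 ℕ (fun n => SymPow 𝕜 L n) n (symProd 𝕜 fun _ : Fin n => v) :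
        ⨂[𝕜]^n L) = PiTensorProduct.tprod 𝕜 fun _ => v := by
      rw [symProd, DirectSum.component.lof_self]
      exact symmetrizer_tprod_const _ _
    rw [Nat.factorial_zero, Nat.cast_one, one_mul, zero_add] at h1
    rw [map_smul, h1]
    by_cases hnk : n = k
    · subst hnk
      rw [h2]
      simp [T, monomialSeries, mul_assoc]
    · have h3 : DirectSum.component 𝕜 ℕ (fun n => SymPow 𝕜 L n) k
          (symProd 𝕜 fun _ : Fin n => v) = 0 := DFinsupp.single_eq_of_ne (Ne.symm hnk)
      rw [h3]
      simp [monomialSeries, hnk]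
  have hx := LinearMap.congr_fun key x
  have hy := LinearMap.congr_fun key y
  rw [LinearMap.comp_apply, LinearMap.comp_apply, LinearMap.comp_apply _ (quantize 𝕜 L), hxy] at hx
  rw [LinearMap.comp_apply, LinearMap.comp_apply, LinearMap.comp_apply _ (quantize 𝕜 L), hx] at hy
  have hk : ((-1 : 𝕜) ^ k * (k.factorial : 𝕜)) ≠ 0 :=
    mul_ne_zero (pow_ne_zero _ (by norm_num)) (by exact_mod_cast k.factorial_ne_zero)
  rw [hT, hT]
  exact smul_right_injective _ hk hy

end Injectivity

/-! ### Projective seminorms and the seminorms p_R. -/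

section TensorSeminorm

variable {𝕜 : Type*} [RCLike 𝕜] {V : Type*} [AddCommGroup V] [Module 𝕜 V]

theorem tensorSeminorm_tprod_le (p : Seminorm 𝕜 V) {n : ℕ} (v : Fin n → V) :
    tensorSeminorm p n (PiTensorProduct.tprod 𝕜 v) ≤ ∏ i, p (v i) :=
  letI : SeminormedAddCommGroup V := p.toAddGroupSeminorm.toSeminormedAddCommGroup
  letI : NormedSpace 𝕜 V := ⟨fun a v => (map_smul_eq_mul p a v).le⟩
  PiTensorProduct.projectiveSeminorm_tprod_le v

/-- The universal property of the projective seminorm. -/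
theorem seminorm_lift_le (p : Seminorm 𝕜 V) {W : Type*} [AddCommGroup W] [Module 𝕜 W]
    (P : Seminorm 𝕜 W) {n : ℕ} (f : MultilinearMap 𝕜 (fun _ : Fin n => V) W) {c : ℝ} (hc : 0 ≤ c)
    (h : ∀ v, P (f v) ≤ c * ∏ i, p (v i)) (x : ⨂[𝕜]^n V) :
    P (PiTensorProduct.lift f x) ≤ c * tensorSeminorm p n x := by
  let _ : SeminormedAddCommGroup V := p.toAddGroupSeminorm.toSeminormedAddCommGroup
  let _ : NormedSpace 𝕜 V := ⟨fun a v => (map_smul_eq_mul p a v).le⟩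
  let _ : SeminormedAddCommGroup W := P.toAddGroupSeminorm.toSeminormedAddCommGroup
  let _ : NormedSpace 𝕜 W := ⟨fun a v => (map_smul_eq_mul P a v).le⟩
  let F : ContinuousMultilinearMap 𝕜 (fun _ : Fin n => V) W := f.mkContinuous c h
  exact (PiTensorProduct.norm_eval_le_projectiveSeminorm F x).trans
    (mul_le_mul_of_nonneg_right (f.mkContinuous_norm_le hc h) (apply_nonneg (tensorSeminorm p n) x))

/-- The symmetrizer averages n! permutations, each of which preserves ∏ p(vᵢ); the universal
property reduces the claim to elementary tensors. -/
theorem tensorSeminorm_symmetrizer_le (p : Seminorm 𝕜 V) {n : ℕ} (x : ⨂[𝕜]^n V) :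
    tensorSeminorm p n (symmetrizer 𝕜 V n x) ≤ tensorSeminorm p n x := by
  have h : symmetrizer 𝕜 V n = PiTensorProduct.lift
      ((symmetrizer 𝕜 V n).compMultilinearMap (PiTensorProduct.tprod 𝕜)) :=
    PiTensorProduct.lift.unique fun v => rfl
  rw [h]
  refine (seminorm_lift_le p (tensorSeminorm p n) _ zero_le_one (fun v => ?_) x).trans_eq
    (one_mul _)
  rw [one_mul, LinearMap.compMultilinearMap_apply, symmetrizer_tprod, map_smul_eq_mul]
  have h1 : ∀ σ : Equiv.Perm (Fin n), tensorSeminorm p n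
      (PiTensorProduct.tprod 𝕜 fun i => v (σ i)) ≤ ∏ i, p (v i) := fun σ =>
    (tensorSeminorm_tprod_le p _).trans_eq (Equiv.prod_comp σ fun i => p (v i))
  have h2 : tensorSeminorm p n (∑ σ : Equiv.Perm (Fin n),
      PiTensorProduct.tprod 𝕜 fun i => v (σ i)) ≤ n.factorial * ∏ i, p (v i) := by
    refine (Finset.le_sum_of_subadditive _ (map_zero _).le (map_add_le_add _) _ _).trans
      ((Finset.sum_le_sum fun σ _ => h1 σ).trans_eq ?_)
    rw [Finset.sum_const, Finset.card_univ, Fintype.card_perm, Fintype.card_fin, nsmul_eq_mul]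
  have h3 : (0 : ℝ) < n.factorial := by exact_mod_cast n.factorial_pos
  rw [norm_inv, RCLike.norm_natCast, inv_mul_le_iff₀ h3]
  exact h2

/-- The constant enters with the power n. Rescaling a seminorm on `V` therefore absorbs factors that
grow geometrically with the degree. -/
theorem tensorSeminorm_mono {p q : Seminorm 𝕜 V} {n : ℕ} {c : ℝ} (hc : 0 ≤ c)
    (h : ∀ v, p v ≤ c * q v) (x : ⨂[𝕜]^n V) :
    tensorSeminorm p n x ≤ c ^ n * tensorSeminorm q n x := by
  have := seminorm_lift_le q (tensorSeminorm p n) (PiTensorProduct.tprod 𝕜) (pow_nonneg hc n)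
    (fun v => (tensorSeminorm_tprod_le p v).trans (by
      calc ∏ i, p (v i) ≤ ∏ i, c * q (v i) :=
            Finset.prod_le_prod (fun i _ => apply_nonneg p _) fun i _ => h _
        _ = c ^ n * ∏ i, q (v i) := by simp [Finset.prod_mul_distrib])) x
  simpa using this

theorem symSeminorm_apply (R : ℝ) (p : Seminorm 𝕜 V) (x : Sym 𝕜 V) :
    symSeminorm R p x = ∑' n : ℕ, (n.factorial : ℝ) ^ R * tensorSeminorm p n (x n : ⨂[𝕜]^n V) := rfl

theorem symSeminorm_symOf (R : ℝ) (p : Seminorm 𝕜 V) {n : ℕ} (x : SymPow 𝕜 V n) :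
    symSeminorm R p (symOf 𝕜 n x) = (n.factorial : ℝ) ^ R * tensorSeminorm p n (x : ⨂[𝕜]^n V) := by
  rw [symSeminorm_apply, tsum_eq_single n]
  · rw [symOf, DirectSum.lof_apply]
  · intro m hm
    rw [symOf, DirectSum.lof_eq_of, DirectSum.of_eq_of_ne _ _ _ hm]
    simp

theorem symSeminorm_symProd_le (R : ℝ) (p : Seminorm 𝕜 V) {n : ℕ} (v : Fin n → V) :
    symSeminorm R p (symProd 𝕜 v) ≤ (n.factorial : ℝ) ^ R * ∏ i, p (v i) := by
  rw [symProd]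
  refine (symSeminorm_symOf R p _).trans_le ?_
  gcongr
  exact (tensorSeminorm_symmetrizer_le p _).trans (tensorSeminorm_tprod_le p v)

/-- The elements of `Sym^•(V)` of degree at most `m`. -/
def degreeLE (𝕜 : Type*) [RCLike 𝕜] (V : Type*) [AddCommGroup V] [Module 𝕜 V] (m : ℕ) :
    Submodule 𝕜 (Sym 𝕜 V) where
  carrier := {x | ∀ n, m < n → x n = 0}
  zero_mem' := fun n _ => rfl
  add_mem' := fun {x y} hx hy n hn => by rw [DirectSum.add_apply, hx n hn, hy n hn, add_zero]
  smul_mem' := fun a x hx n hn => by rw [DirectSum.smul_apply, hx n hn, smul_zero]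

theorem symOf_mem_degreeLE {n m : ℕ} (h : n ≤ m) (x : SymPow 𝕜 V n) :
    symOf 𝕜 n x ∈ degreeLE 𝕜 V m := fun k hk => by
  rw [symOf, DirectSum.lof_eq_of, DirectSum.of_eq_of_ne _ _ _ (by omega)]

theorem symSeminorm_eq_sum (R : ℝ) (p : Seminorm 𝕜 V) {m : ℕ} {x : Sym 𝕜 V}
    (hx : x ∈ degreeLE 𝕜 V m) :
    symSeminorm R p x = ∑ k ∈ Finset.range (m + 1), symSeminorm R p (symOf 𝕜 k (x k)) := by
  simp only [symSeminorm_symOf]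
  refine tsum_eq_sum fun k hk => ?_
  rw [hx k (by simpa using hk)]
  simp

theorem eq_sum_of_mem_degreeLE {m : ℕ} {x : Sym 𝕜 V} (hx : x ∈ degreeLE 𝕜 V m) :
    x = ∑ k ∈ Finset.range (m + 1), symOf 𝕜 k (x k) := by
  refine DFinsupp.ext fun n => ?_
  rw [DFinsupp.finsetSum_apply]
  by_cases hn : n ∈ Finset.range (m + 1)
  · rw [Finset.sum_eq_single n]
    · rw [symOf, DirectSum.lof_apply]
    · intro k _ hk
      exact DirectSum.of_eq_of_ne _ _ _ (Ne.symm hk)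
    · exact fun h => absurd hn h
  · rw [hx n (by simpa using hn), Finset.sum_eq_zero]
    intro k hk
    exact DirectSum.of_eq_of_ne _ _ _ (by rintro rfl; exact hn hk)

theorem exists_mem_degreeLE (x : Sym 𝕜 V) : ∃ m, x ∈ degreeLE 𝕜 V m := by
  induction x using DirectSum.induction_on with
  | zero => exact ⟨0, zero_mem _⟩
  | of n x => exact ⟨n, symOf_mem_degreeLE le_rfl x⟩
  | add x y hx hy =>
    obtain ⟨m, hm⟩ := hx
    obtain ⟨l, hl⟩ := hy
    exact ⟨m + l, fun n hn => by
      rw [DirectSum.add_apply, hm n (by omega), hl n (by omega), add_zero]⟩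

theorem symSeminorm_homPart_le (R : ℝ) (p : Seminorm 𝕜 V) (n : ℕ) (x : Sym 𝕜 V) :
    symSeminorm R p (homPart n x) ≤ symSeminorm R p x := by
  refine (symSeminorm_symOf R p (x n)).trans_le ?_
  exact (summable_symSeminorm R p x).le_tsum n fun k _ =>
    mul_nonneg (by positivity) (apply_nonneg _ _)

theorem symSeminorm_mono (R : ℝ) {p q : Seminorm 𝕜 V} (h : p ≤ q) (x : Sym 𝕜 V) :
    symSeminorm R p x ≤ symSeminorm R q x := by
  refine (summable_symSeminorm R p x).tsum_le_tsum (fun n => ?_) (summable_symSeminorm R q x)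
  gcongr
  simpa using tensorSeminorm_mono (p := p) (q := q) zero_le_one (fun v => by simpa using h v)
    (x n : ⨂[𝕜]^n V)

end TensorSeminorm

/-! ### The product of U(L) pulled back to symmetric tensors, and its estimate. -/

section Product

variable {𝕜 : Type*} [RCLike 𝕜] {L : Type*} [LieRing L] [LieAlgebra 𝕜 L]

theorem leftMulPart_mem_degreeLE (ξ : L) (j : ℕ) {k m : ℕ} (h : k ≤ m) (x : SymPow 𝕜 L k) :
    leftMulPart ξ j (symOf 𝕜 k x) ∈ degreeLE 𝕜 L (m + 1) := by
  rcases lt_or_ge k j with hj | hj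
  · rw [leftMulPart_symOf_of_lt ξ hj]
    exact zero_mem _
  · have key : ∀ t : ⨂[𝕜]^k L,
        PiTensorProduct.lift (adInsert (𝕜 := 𝕜) ξ (Nat.add_sub_cancel' hj)) t ∈
          degreeLE 𝕜 L (m + 1) := by
      intro t
      induction t using PiTensorProduct.induction_on with
      | smul_tprod a v =>
        rw [map_smul, PiTensorProduct.lift.tprod, adInsert_apply]
        exact Submodule.smul_mem _ _ (symOf_mem_degreeLE (by omega) _)
      | add a b ha hb => rw [map_add]; exact add_mem ha hb
    rw [leftMulPart_symOf ξ hj]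
    exact Submodule.smul_mem _ _ (key _)

variable {q : Seminorm 𝕜 L} (hq : ∀ x y, q ⁅x, y⁆ ≤ 2⁻¹ * (q x * q y))

-- The factor 1/2 in `hq` produces 2⁻ʲ, which makes the sum over j in the left multiplication
-- converge independently of the degree.
include hq in
theorem seminorm_adProd_le (ξ : L) {j : ℕ} (v : Fin j → L) :
    q (adProd 𝕜 L j v ξ) ≤ 2⁻¹ ^ j * ((∏ i, q (v i)) * q ξ) := by
  induction j with
  | zero => simp [adProd]
  | succ j ih =>
    have h := ih fun i => v i.succ
    have : adProd 𝕜 L (j + 1) v ξ = ⁅v 0, adProd 𝕜 L j (fun i => v i.succ) ξ⁆ := by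
      simp [adProd, List.ofFn_succ]
    rw [this, Fin.prod_univ_succ]
    calc q ⁅v 0, adProd 𝕜 L j (fun i => v i.succ) ξ⁆
        ≤ 2⁻¹ * (q (v 0) * q (adProd 𝕜 L j (fun i => v i.succ) ξ)) := hq _ _
      _ ≤ 2⁻¹ * (q (v 0) * (2⁻¹ ^ j * ((∏ i : Fin j, q (v i.succ)) * q ξ))) := by
          gcongr
      _ = _ := by ring

include hq in
theorem symSeminorm_adInsert_le (R : ℝ) (ξ : L) {j m k : ℕ} (h : j + m = k) (v : Fin k → L) :
    symSeminorm R q (adInsert (𝕜 := 𝕜) ξ h v) ≤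
      ((m + 1).factorial : ℝ) ^ R * 2⁻¹ ^ j * q ξ * ∏ i, q (v i) := by
  subst h
  rw [adInsert_apply]
  refine (symSeminorm_symProd_le R q _).trans ?_
  rw [Fin.prod_univ_succ]
  simp only [Fin.cons_zero, Fin.cons_succ, finCongr_refl, Equiv.refl_apply]
  rw [Fin.prod_univ_add]
  calc _ ≤ ((m + 1).factorial : ℝ) ^ R * ((2⁻¹ ^ j * ((∏ i, q (v (Fin.castAdd m i))) * q ξ)) *
        ∏ i, q (v (Fin.natAdd j i))) := by
        gcongr
        exact seminorm_adProd_le hq ξ _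
    _ = _ := by ring

/-- Here R ≥ 1 enters: one factor (k-j+1)! turns k!/(k-j)! into (k-j+1) k! ≤ (k+1)!, and the
remaining power R - 1 ≥ 0 is monotone. -/
theorem factorial_rpow_mul_descFactorial_le {R : ℝ} (hR : 1 ≤ R) {j k : ℕ} (h : j ≤ k) :
    ((k - j + 1).factorial : ℝ) ^ R * (k.descFactorial j : ℝ) ≤
      ((k + 1 : ℕ) : ℝ) ^ R * (k.factorial : ℝ) ^ R := by
  have h1 : ((k - j).factorial : ℝ) * (k.descFactorial j : ℝ) = k.factorial := by
    exact_mod_cast Nat.factorial_mul_descFactorial h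
  have h2 : ((k - j + 1).factorial : ℝ) ≤ (k + 1).factorial := by
    exact_mod_cast Nat.factorial_le (by omega)
  have h3 : (0 : ℝ) < (k - j + 1).factorial := by exact_mod_cast Nat.factorial_pos _
  have h4 : (0 : ℝ) < (k + 1).factorial := by exact_mod_cast Nat.factorial_pos _
  rw [← Real.mul_rpow (by positivity) (by positivity), ← Nat.cast_mul, ← Nat.factorial_succ]
  calc ((k - j + 1).factorial : ℝ) ^ R * (k.descFactorial j : ℝ)
      = ((k - j + 1).factorial : ℝ) ^ (R - 1) * (((k - j + 1).factorial : ℝ) * k.descFactorial j) := by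
        rw [Real.rpow_sub_one h3.ne']; field_simp
    _ ≤ ((k + 1).factorial : ℝ) ^ (R - 1) * (k + 1).factorial := by
        have h5 : ((k - j + 1).factorial : ℝ) * k.descFactorial j ≤ (k + 1).factorial := by
          rw [Nat.factorial_succ, Nat.factorial_succ, Nat.cast_mul, Nat.cast_mul, mul_assoc, h1]
          gcongr
          omega
        have : 0 ≤ R - 1 := by linarith
        gcongr
    _ = _ := by rw [Real.rpow_sub_one h4.ne']; field_simp

include hq in
theorem symSeminorm_leftMulPart_le {R : ℝ} (hR : 1 ≤ R) (ξ : L) (j : ℕ) {k : ℕ}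
    (x : SymPow 𝕜 L k) :
    symSeminorm R q (leftMulPart ξ j (symOf 𝕜 k x)) ≤
      2⁻¹ ^ j * (((k + 1 : ℕ) : ℝ) ^ R * q ξ * symSeminorm R q (symOf 𝕜 k x)) := by
  rcases lt_or_ge k j with hj | hj
  · rw [leftMulPart_symOf_of_lt ξ hj, map_zero]
    have := apply_nonneg q ξ
    have := apply_nonneg (symSeminorm R q) (symOf 𝕜 k x)
    positivity
  · rw [leftMulPart_symOf ξ hj, map_smul_eq_mul, norm_mul, RCLike.norm_natCast, symSeminorm_symOf]
    have h1 := seminorm_lift_le q (symSeminorm R q) (adInsert (𝕜 := 𝕜) ξ (Nat.add_sub_cancel' hj))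
      (c := ((k - j + 1).factorial : ℝ) ^ R * 2⁻¹ ^ j * q ξ)
      (by have := apply_nonneg q ξ; positivity)
      (symSeminorm_adInsert_le hq R ξ _) (x : ⨂[𝕜]^k L)
    have h2 := norm_bernoulliCoeff_le 𝕜 j
    have h3 := factorial_rpow_mul_descFactorial_le hR hj
    have h4 := apply_nonneg (tensorSeminorm q k) (x : ⨂[𝕜]^k L)
    have h5 := apply_nonneg q ξ
    calc _ ≤ (1 * (k.descFactorial j : ℝ)) * (((k - j + 1).factorial : ℝ) ^ R * 2⁻¹ ^ j * q ξ *
          tensorSeminorm q k (x : ⨂[𝕜]^k L)) := by gcongr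
      _ = (((k - j + 1).factorial : ℝ) ^ R * (k.descFactorial j : ℝ)) * (2⁻¹ ^ j * q ξ *
          tensorSeminorm q k (x : ⨂[𝕜]^k L)) := by ring
      _ ≤ (((k + 1 : ℕ) : ℝ) ^ R * (k.factorial : ℝ) ^ R) * (2⁻¹ ^ j * q ξ *
          tensorSeminorm q k (x : ⨂[𝕜]^k L)) := by gcongr
      _ = _ := by ring

variable [FiniteDimensional 𝕜 L]

variable (𝕜 L) in
/-- The Poincaré-Birkhoff-Witt isomorphism. -/
def quantizeEquiv : Sym 𝕜 L ≃ₗ[𝕜] UniversalEnvelopingAlgebra 𝕜 L :=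
  LinearEquiv.ofBijective (quantize 𝕜 L) ⟨quantize_injective, quantize_surjective⟩

theorem quantize_quantizeEquiv_symm (u : UniversalEnvelopingAlgebra 𝕜 L) :
    quantize 𝕜 L ((quantizeEquiv 𝕜 L).symm u) = u := (quantizeEquiv 𝕜 L).apply_symm_apply u

theorem quantizeEquiv_symm_quantize (x : Sym 𝕜 L) :
    (quantizeEquiv 𝕜 L).symm (quantize 𝕜 L x) = x := (quantizeEquiv 𝕜 L).symm_apply_apply x

theorem dequantize_eq (u : UniversalEnvelopingAlgebra 𝕜 L) :
    dequantize 𝕜 L u = (quantizeEquiv 𝕜 L).symm u := by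
  rw [LinearEquiv.eq_symm_apply]
  exact Function.invFun_eq (quantize_surjective u)

variable (𝕜 L) in
/-- The product of the universal enveloping algebra, pulled back to `Sym^•(L)`. -/
def pbwMul : Sym 𝕜 L →ₗ[𝕜] Sym 𝕜 L →ₗ[𝕜] Sym 𝕜 L :=
  ((LinearMap.mul 𝕜 (UniversalEnvelopingAlgebra 𝕜 L)).compl₁₂ (quantize 𝕜 L)
    (quantize 𝕜 L)).compr₂ (quantizeEquiv 𝕜 L).symm.toLinearMap

theorem pbwMul_apply (x y : Sym 𝕜 L) : pbwMul 𝕜 L x y =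
    (quantizeEquiv 𝕜 L).symm (quantize 𝕜 L x * quantize 𝕜 L y) := rfl

theorem quantize_pbwMul (x y : Sym 𝕜 L) :
    quantize 𝕜 L (pbwMul 𝕜 L x y) = quantize 𝕜 L x * quantize 𝕜 L y :=
  (quantizeEquiv 𝕜 L).apply_symm_apply _

variable (𝕜 L) in
/-- The left multiplication with an element of `L` in the universal enveloping algebra, pulled
back to `Sym^•(L)`. -/
def leftMul (ξ : L) : Sym 𝕜 L →ₗ[𝕜] Sym 𝕜 L :=
  (quantizeEquiv 𝕜 L).symm.toLinearMap.comp ((LinearMap.mulLeft 𝕜 (ιLin 𝕜 L ξ)).comp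
    (quantize 𝕜 L))

theorem quantize_leftMul (ξ : L) (x : Sym 𝕜 L) :
    quantize 𝕜 L (leftMul 𝕜 L ξ x) = ιLin 𝕜 L ξ * quantize 𝕜 L x :=
  (quantizeEquiv 𝕜 L).apply_symm_apply _

theorem leftMul_symOf (ξ : L) {k : ℕ} (x : SymPow 𝕜 L k) :
    leftMul 𝕜 L ξ (symOf 𝕜 k x) =
      ∑ j ∈ Finset.range (k + 1), leftMulPart ξ j (symOf 𝕜 k x) :=
  quantize_injective ((quantize_leftMul ξ _).trans (ιLin_mul_quantize_symOf ξ x))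

theorem leftMul_mem_degreeLE (ξ : L) {m : ℕ} {x : Sym 𝕜 L} (hx : x ∈ degreeLE 𝕜 L m) :
    leftMul 𝕜 L ξ x ∈ degreeLE 𝕜 L (m + 1) := by
  rw [eq_sum_of_mem_degreeLE hx, map_sum]
  refine Submodule.sum_mem _ fun k hk => ?_
  rw [leftMul_symOf]
  exact Submodule.sum_mem _ fun j _ =>
    leftMulPart_mem_degreeLE ξ j (by simpa [Nat.lt_succ_iff] using hk) _

-- The 2 is the sum of the geometric series over j. Summing over the homogeneous components costs
-- nothing on the right because p_R is additive over them.
include hq in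
theorem symSeminorm_leftMul_le {R : ℝ} (hR : 1 ≤ R) (ξ : L) {m : ℕ} {x : Sym 𝕜 L}
    (hx : x ∈ degreeLE 𝕜 L m) :
    symSeminorm R q (leftMul 𝕜 L ξ x) ≤
      2 * (((m + 1 : ℕ) : ℝ) ^ R * q ξ * symSeminorm R q x) := by
  have hgeom : ∀ k : ℕ, ∑ j ∈ Finset.range (k + 1), (2⁻¹ : ℝ) ^ j ≤ 2 := fun k => by
    have := Summable.sum_le_tsum (Finset.range (k + 1)) (fun j _ => by positivity)
      summable_geometric_two
    rw [tsum_geometric_two] at this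
    simpa using this
  have hξ := apply_nonneg q ξ
  have hb : ∀ k ≤ m, symSeminorm R q (leftMul 𝕜 L ξ (symOf 𝕜 k (x k))) ≤
      2 * (((m + 1 : ℕ) : ℝ) ^ R * q ξ * symSeminorm R q (symOf 𝕜 k (x k))) := by
    intro k hk
    have hP := apply_nonneg (symSeminorm R q) (symOf 𝕜 k (x k))
    rw [leftMul_symOf]
    refine (Finset.le_sum_of_subadditive _ (map_zero _).le (map_add_le_add _) _ _).trans ?_
    refine (Finset.sum_le_sum fun j _ => symSeminorm_leftMulPart_le hq hR ξ j (x k)).trans ?_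
    rw [← Finset.sum_mul]
    gcongr
    exact hgeom k
  conv_lhs => rw [eq_sum_of_mem_degreeLE hx, map_sum]
  refine (Finset.le_sum_of_subadditive _ (map_zero _).le (map_add_le_add _) _ _).trans ?_
  refine (Finset.sum_le_sum fun k hk => hb k (by simpa [Nat.lt_succ_iff] using hk)).trans_eq ?_
  rw [symSeminorm_eq_sum R q hx, Finset.mul_sum, Finset.mul_sum]

theorem leftMul_prod_cons (ξ : L) (v : List L) (u : UniversalEnvelopingAlgebra 𝕜 L) :
    (quantizeEquiv 𝕜 L).symm (((ξ :: v).map (ιLin 𝕜 L)).prod * u) =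
      leftMul 𝕜 L ξ ((quantizeEquiv 𝕜 L).symm ((v.map (ιLin 𝕜 L)).prod * u)) := by
  refine quantize_injective ?_
  rw [quantize_leftMul, quantize_quantizeEquiv_symm, quantize_quantizeEquiv_symm, List.map_cons,
    List.prod_cons, mul_assoc]

theorem leftMul_prod_mem_degreeLE (v : List L) {l : ℕ} {y : Sym 𝕜 L} (hy : y ∈ degreeLE 𝕜 L l) :
    (quantizeEquiv 𝕜 L).symm ((v.map (ιLin 𝕜 L)).prod * quantize 𝕜 L y) ∈
      degreeLE 𝕜 L (v.length + l) := by
  induction v with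
  | nil =>
    simpa [quantizeEquiv_symm_quantize] using hy
  | cons ξ v ih =>
    have := leftMul_mem_degreeLE ξ ih
    rw [leftMul_prod_cons, List.length_cons, add_right_comm]
    exact this

-- Each further letter costs 2 q(ξ) and the next factor in ((l+1)(l+2)⋯)^R, which accumulates to
-- ((k+l)!/l!)^R; the l!^R stands on the left to avoid a division.
include hq in
theorem symSeminorm_leftMul_prod_le {R : ℝ} (hR : 1 ≤ R) (v : List L) {l : ℕ} {y : Sym 𝕜 L}
    (hy : y ∈ degreeLE 𝕜 L l) :
    (l.factorial : ℝ) ^ R * symSeminorm R q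
      ((quantizeEquiv 𝕜 L).symm ((v.map (ιLin 𝕜 L)).prod * quantize 𝕜 L y)) ≤
      2 ^ v.length * ((v.length + l).factorial : ℝ) ^ R * (v.map q).prod * symSeminorm R q y := by
  induction v with
  | nil =>
    simp [quantizeEquiv_symm_quantize]
  | cons ξ v ih =>
    rw [leftMul_prod_cons]
    have h3 := symSeminorm_leftMul_le hq hR ξ (leftMul_prod_mem_degreeLE v hy)
    have hξ := apply_nonneg q ξ
    have h4 : ((v.length + l + 1).factorial : ℝ) ^ R =
        ((v.length + l + 1 : ℕ) : ℝ) ^ R * ((v.length + l).factorial : ℝ) ^ R := by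
      rw [Nat.factorial_succ, Nat.cast_mul, Real.mul_rpow (by positivity) (by positivity)]
    calc _ ≤ (l.factorial : ℝ) ^ R * (2 * (((v.length + l + 1 : ℕ) : ℝ) ^ R * q ξ *
            symSeminorm R q ((quantizeEquiv 𝕜 L).symm
              ((v.map (ιLin 𝕜 L)).prod * quantize 𝕜 L y)))) := by gcongr
      _ = 2 * (((v.length + l + 1 : ℕ) : ℝ) ^ R * q ξ) * ((l.factorial : ℝ) ^ R *
            symSeminorm R q ((quantizeEquiv 𝕜 L).symm
              ((v.map (ιLin 𝕜 L)).prod * quantize 𝕜 L y))) := by ring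
      _ ≤ 2 * (((v.length + l + 1 : ℕ) : ℝ) ^ R * q ξ) * (2 ^ v.length *
            ((v.length + l).factorial : ℝ) ^ R * (v.map q).prod * symSeminorm R q y) := by gcongr
      _ = _ := by
        rw [List.length_cons, List.map_cons, List.prod_cons, pow_succ,
          show v.length + 1 + l = v.length + l + 1 by ring, h4]
        ring

/-- `v₁ ⊗ ⋯ ⊗ vₖ ↦ v₁ ⋯ vₖ y` in the universal enveloping algebra, pulled back to `Sym^•(L)`. -/
def pbwMulMulti (k : ℕ) (y : Sym 𝕜 L) : MultilinearMap 𝕜 (fun _ : Fin k => L) (Sym 𝕜 L) :=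
  ((quantizeEquiv 𝕜 L).symm.toLinearMap.comp
    (LinearMap.mulRight 𝕜 (quantize 𝕜 L y))).compMultilinearMap
      ((MultilinearMap.mkPiAlgebraFin 𝕜 k _).compLinearMap fun _ => ιLin 𝕜 L)

theorem pbwMulMulti_apply {k : ℕ} (y : Sym 𝕜 L) (v : Fin k → L) :
    pbwMulMulti k y v = (quantizeEquiv 𝕜 L).symm
      (((List.ofFn v).map (ιLin 𝕜 L)).prod * quantize 𝕜 L y) := by
  rw [List.map_ofFn]
  rfl

theorem pbwMul_symOf {k : ℕ} (x : SymPow 𝕜 L k) (y : Sym 𝕜 L) :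
    pbwMul 𝕜 L (symOf 𝕜 k x) y = PiTensorProduct.lift (pbwMulMulti k y) (x : ⨂[𝕜]^k L) := by
  rw [pbwMul_apply, quantize_eq, symLift_lof]
  have : ∀ t : ⨂[𝕜]^k L, ((quantizeEquiv 𝕜 L).symm.toLinearMap.comp
      (LinearMap.mulRight 𝕜 (quantize 𝕜 L y))).comp (PiTensorProduct.lift
        ((MultilinearMap.mkPiAlgebraFin 𝕜 k _).compLinearMap fun _ => ιLin 𝕜 L)) t =
      PiTensorProduct.lift (pbwMulMulti k y) t := by
    intro t
    congr 1
    exact PiTensorProduct.lift.unique fun v => by simp [pbwMulMulti]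
  exact this _

theorem pbwMul_mem_degreeLE {k l : ℕ} (x : SymPow 𝕜 L k) (y : SymPow 𝕜 L l) :
    pbwMul 𝕜 L (symOf 𝕜 k x) (symOf 𝕜 l y) ∈ degreeLE 𝕜 L (k + l) := by
  rw [pbwMul_symOf]
  generalize (x : ⨂[𝕜]^k L) = t
  induction t using PiTensorProduct.induction_on with
  | smul_tprod a v =>
    rw [map_smul, PiTensorProduct.lift.tprod, pbwMulMulti_apply]
    have := leftMul_prod_mem_degreeLE (List.ofFn v) (symOf_mem_degreeLE le_rfl y)
    rw [List.length_ofFn] at this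
    exact Submodule.smul_mem _ _ this
  | add a b ha hb => rw [map_add]; exact add_mem ha hb

-- In the base 2^{R+1}, the 2^R comes from (k+l)! ≤ 2^{k+l} k! l! and the remaining 2 from the k
-- letters of x. The universal property of the projective seminorm reduces x to elementary tensors.
include hq in
theorem symSeminorm_pbwMul_le {R : ℝ} (hR : 1 ≤ R) {k l : ℕ} (x : SymPow 𝕜 L k)
    (y : SymPow 𝕜 L l) :
    symSeminorm R q (pbwMul 𝕜 L (symOf 𝕜 k x) (symOf 𝕜 l y)) ≤
      (2 ^ (R + 1)) ^ (k + l) *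
        (symSeminorm R q (symOf 𝕜 k x) * symSeminorm R q (symOf 𝕜 l y)) := by
  have hl : (0 : ℝ) < (l.factorial : ℝ) ^ R :=
    Real.rpow_pos_of_pos (by exact_mod_cast l.factorial_pos) _
  rw [pbwMul_symOf, symSeminorm_symOf R q x]
  have h1 := seminorm_lift_le q (symSeminorm R q) (pbwMulMulti k (symOf 𝕜 l y))
    (c := ((l.factorial : ℝ) ^ R)⁻¹ * (2 ^ k * ((k + l).factorial : ℝ) ^ R *
      symSeminorm R q (symOf 𝕜 l y)))
    (mul_nonneg (by positivity) (mul_nonneg (by positivity) (apply_nonneg _ _)))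
    (fun v => by
      have := symSeminorm_leftMul_prod_le hq hR (List.ofFn v) (symOf_mem_degreeLE le_rfl y)
      rw [List.length_ofFn, List.map_ofFn (g := q), List.prod_ofFn] at this
      rw [mul_assoc, ← div_eq_inv_mul, le_div_iff₀' hl, pbwMulMulti_apply, mul_right_comm]
      exact this) (x : ⨂[𝕜]^k L)
  refine h1.trans ?_
  have h2 : ((k + l).factorial : ℝ) ^ R ≤
      (2 ^ R) ^ (k + l) * ((k.factorial : ℝ) ^ R * (l.factorial : ℝ) ^ R) := by
    have : ((k + l).factorial : ℝ) ≤ 2 ^ (k + l) * ((k.factorial : ℝ) * l.factorial) := by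
      have h := Nat.add_choose_mul_factorial_mul_factorial k l
      have h' := Nat.choose_le_two_pow (k + l) l
      calc ((k + l).factorial : ℝ) = ((k + l).choose l : ℝ) * ((k.factorial : ℝ) * l.factorial) := by
            rw [← h]; push_cast; ring
        _ ≤ _ := by gcongr; exact_mod_cast h'
    calc ((k + l).factorial : ℝ) ^ R ≤ (2 ^ (k + l) * ((k.factorial : ℝ) * l.factorial)) ^ R := by
          gcongr
      _ = _ := by
          rw [Real.mul_rpow (by positivity) (by positivity),
            Real.mul_rpow (by positivity) (by positivity), ← Real.rpow_natCast, ← Real.rpow_natCast,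
            ← Real.rpow_mul (by positivity), ← Real.rpow_mul (by positivity), mul_comm R]
  have h3 : (2 : ℝ) ^ k ≤ 2 ^ (k + l) := pow_le_pow_right₀ one_le_two (by omega)
  have hy := apply_nonneg (symSeminorm R q) (symOf 𝕜 l y)
  have hx := apply_nonneg (tensorSeminorm q k) (x : ⨂[𝕜]^k L)
  calc _ ≤ ((l.factorial : ℝ) ^ R)⁻¹ * (2 ^ (k + l) * ((2 ^ R) ^ (k + l) *
        ((k.factorial : ℝ) ^ R * (l.factorial : ℝ) ^ R)) * symSeminorm R q (symOf 𝕜 l y)) *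
          tensorSeminorm q k (x : ⨂[𝕜]^k L) := by gcongr
    _ = _ := by
      rw [Real.rpow_add_one (by norm_num), mul_pow]
      field_simp

end Product

/-! ### Bilinear maps on `Sym^•` from homogeneous components. -/

section Bilinear

variable {𝕜 : Type*} [RCLike 𝕜] {V : Type*} [AddCommGroup V] [Module 𝕜 V]

variable (𝕜 V) in
/-- The projection to the homogeneous component of degree `n`, as a linear map. -/
def homProj (n : ℕ) : Sym 𝕜 V →ₗ[𝕜] Sym 𝕜 V :=
  (symOf 𝕜 n).comp (DirectSum.component 𝕜 ℕ (fun n => SymPow 𝕜 V n) n)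

theorem homProj_apply (n : ℕ) (x : Sym 𝕜 V) : homProj 𝕜 V n x = homPart n x := rfl

theorem sum_homProj_eq {m : ℕ} {x : Sym 𝕜 V} (hx : x ∈ degreeLE 𝕜 V m) :
    ∑ k ∈ Finset.range (m + 1), homProj 𝕜 V k x = x := (eq_sum_of_mem_degreeLE hx).symm

theorem homProj_eq_zero {m n : ℕ} {x : Sym 𝕜 V} (hx : x ∈ degreeLE 𝕜 V m) (h : m < n) :
    homProj 𝕜 V n x = 0 := by
  rw [homProj_apply, homPart, hx n h, map_zero]

/-- The bilinear map with prescribed values on homogeneous elements. -/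
def bilinOf {W : Type*} [AddCommMonoid W] [Module 𝕜 W]
    (B : ∀ k l : ℕ, SymPow 𝕜 V k →ₗ[𝕜] SymPow 𝕜 V l →ₗ[𝕜] W) : Sym 𝕜 V →ₗ[𝕜] Sym 𝕜 V →ₗ[𝕜] W :=
  DirectSum.toModule 𝕜 ℕ _ fun k => (DirectSum.toModule 𝕜 ℕ _ fun l => (B k l).flip).flip

theorem bilinOf_symOf {W : Type*} [AddCommMonoid W] [Module 𝕜 W]
    (B : ∀ k l : ℕ, SymPow 𝕜 V k →ₗ[𝕜] SymPow 𝕜 V l →ₗ[𝕜] W) {k l : ℕ} (x : SymPow 𝕜 V k)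
    (y : SymPow 𝕜 V l) : bilinOf B (symOf 𝕜 k x) (symOf 𝕜 l y) = B k l x y := by
  rw [bilinOf, symOf, DirectSum.toModule_lof, LinearMap.flip_apply, symOf, DirectSum.toModule_lof,
    LinearMap.flip_apply]

open scoped Classical in
theorem sum_support_symOf (x : Sym 𝕜 V) : ∑ k ∈ DFinsupp.support x, symOf 𝕜 k (x k) = x :=
  DirectSum.sum_support_of x

open scoped Classical in
theorem bilinOf_eq_sum {W : Type*} [AddCommMonoid W] [Module 𝕜 W]
    (B : ∀ k l : ℕ, SymPow 𝕜 V k →ₗ[𝕜] SymPow 𝕜 V l →ₗ[𝕜] W) (x y : Sym 𝕜 V) :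
    bilinOf B x y = ∑ k ∈ DFinsupp.support x, ∑ l ∈ DFinsupp.support y, B k l (x k) (y l) := by
  conv_lhs => rw [← sum_support_symOf x, ← sum_support_symOf y]
  simp only [map_sum, LinearMap.sum_apply, bilinOf_symOf]
  exact Finset.sum_comm

end Bilinear

/-! ### The Gutt star product: bilinearity, associativity, unit and estimate. -/

section Star

open Finset

variable {𝕜 : Type*} [RCLike 𝕜] {L : Type*} [LieRing L] [LieAlgebra 𝕜 L] [FiniteDimensional 𝕜 L]

variable (𝕜 L) in
/-- The coefficient operators of the Gutt star product, as bilinear maps. -/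
def guttCLin (n : ℕ) : Sym 𝕜 L →ₗ[𝕜] Sym 𝕜 L →ₗ[𝕜] Sym 𝕜 L :=
  bilinOf fun k l => if n ≤ k + l then
    ((pbwMul 𝕜 L).compl₁₂ (symOf 𝕜 k) (symOf 𝕜 l)).compr₂ (homProj 𝕜 L (k + l - n)) else 0

/-- Homogenization of elements of degree at most `N` with powers of `z`. -/
def homogenize (z : 𝕜) (N : ℕ) : Sym 𝕜 L →ₗ[𝕜] Sym 𝕜 L :=
  ∑ n ∈ range (N + 1), z ^ n • homProj 𝕜 L (N - n)

theorem homogenize_apply (z : 𝕜) (N : ℕ) (x : Sym 𝕜 L) :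
    homogenize z N x = ∑ n ∈ range (N + 1), z ^ n • homProj 𝕜 L (N - n) x := by
  rw [homogenize, LinearMap.sum_apply]
  rfl

variable (L) in
/-- The Gutt star product, as a bilinear map. -/
def guttStarLin (z : 𝕜) : Sym 𝕜 L →ₗ[𝕜] Sym 𝕜 L →ₗ[𝕜] Sym 𝕜 L :=
  bilinOf fun k l =>
    ((pbwMul 𝕜 L).compl₁₂ (symOf 𝕜 k) (symOf 𝕜 l)).compr₂ (homogenize z (k + l))

theorem guttCLin_symOf (n : ℕ) {k l : ℕ} (x : SymPow 𝕜 L k) (y : SymPow 𝕜 L l) :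
    guttCLin 𝕜 L n (symOf 𝕜 k x) (symOf 𝕜 l y) = if n ≤ k + l then
      homProj 𝕜 L (k + l - n) (pbwMul 𝕜 L (symOf 𝕜 k x) (symOf 𝕜 l y)) else 0 := by
  rw [guttCLin, bilinOf_symOf]
  split_ifs <;> rfl

theorem guttStarLin_symOf (z : 𝕜) {k l : ℕ} (x : SymPow 𝕜 L k) (y : SymPow 𝕜 L l) :
    guttStarLin L z (symOf 𝕜 k x) (symOf 𝕜 l y) =
      homogenize z (k + l) (pbwMul 𝕜 L (symOf 𝕜 k x) (symOf 𝕜 l y)) :=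
  bilinOf_symOf _ _ _

theorem guttC_eq (n : ℕ) (x y : Sym 𝕜 L) : guttC n x y = guttCLin 𝕜 L n x y := by
  rw [guttC, guttCLin, bilinOf_eq_sum]
  refine sum_congr rfl fun k _ => sum_congr rfl fun l _ => ?_
  split_ifs
  · rw [dequantize_eq]; rfl
  · rfl

theorem guttStar_eq (z : 𝕜) (x y : Sym 𝕜 L) : guttStar z x y = guttStarLin L z x y := by
  rw [guttStar, guttStarLin, bilinOf_eq_sum]
  refine sum_congr rfl fun k _ => sum_congr rfl fun l _ => ?_
  change _ = homogenize z (k + l) _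
  rw [homogenize_apply]
  refine sum_congr rfl fun n _ => ?_
  rw [dequantize_eq]
  rfl

theorem guttStarLin_eq_sum (z : 𝕜) (x y : Sym 𝕜 L) :
    ∃ N : ℕ, (∀ n ≥ N, guttCLin 𝕜 L n x y = 0) ∧
      guttStarLin L z x y = ∑ n ∈ range N, z ^ n • guttCLin 𝕜 L n x y := by
  -- The claim is made for every large range so that the ranges of two summands can be replaced by
  -- their maximum.
  suffices h : ∃ N : ℕ, ∀ M ≥ N, guttCLin 𝕜 L M x y = 0 ∧
      guttStarLin L z x y = ∑ n ∈ range M, z ^ n • guttCLin 𝕜 L n x y by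
    obtain ⟨N, hN⟩ := h
    exact ⟨N, fun n hn => (hN n hn).1, (hN N le_rfl).2⟩
  induction x using DirectSum.induction_on with
  | zero => exact ⟨0, fun M _ => by simp⟩
  | add x x' hx hx' =>
    obtain ⟨N, hN⟩ := hx
    obtain ⟨N', hN'⟩ := hx'
    refine ⟨max N N', fun M hM => ⟨?_, ?_⟩⟩
    · rw [map_add, LinearMap.add_apply, (hN M (le_of_max_le_left hM)).1,
        (hN' M (le_of_max_le_right hM)).1, add_zero]
    · simp only [map_add, LinearMap.add_apply, smul_add, sum_add_distrib]
      rw [(hN M (le_of_max_le_left hM)).2, (hN' M (le_of_max_le_right hM)).2]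
  | of k x =>
    induction y using DirectSum.induction_on with
    | zero => exact ⟨0, fun M _ => by simp⟩
    | add y y' hx hx' =>
      obtain ⟨N, hN⟩ := hx
      obtain ⟨N', hN'⟩ := hx'
      refine ⟨max N N', fun M hM => ⟨?_, ?_⟩⟩
      · rw [map_add, (hN M (le_of_max_le_left hM)).1, (hN' M (le_of_max_le_right hM)).1, add_zero]
      · simp only [map_add, smul_add, sum_add_distrib]
        rw [(hN M (le_of_max_le_left hM)).2, (hN' M (le_of_max_le_right hM)).2]
    | of l y =>
      refine ⟨k + l + 1, fun M hM => ?_⟩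
      have h := fun n => guttCLin_symOf n x y
      have h' := guttStarLin_symOf z x y
      rw [homogenize_apply] at h'
      refine ⟨(h M).trans (if_neg (by omega)), h'.trans ?_⟩
      refine (sum_congr rfl fun n hn => ?_).trans
        (sum_subset (range_mono hM) fun n _ hn => ?_)
      · have : n ≤ k + l := Nat.lt_succ_iff.1 (mem_range.1 hn)
        exact congrArg (z ^ n • ·) ((h n).trans (if_pos this)).symm
      · have : ¬ n ≤ k + l := fun hle => hn (mem_range.2 (Nat.lt_succ_iff.2 hle))
        exact (congrArg (z ^ n • ·) ((h n).trans (if_neg this))).trans (smul_zero _)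

theorem pbwMul_assoc (x y w : Sym 𝕜 L) :
    pbwMul 𝕜 L (pbwMul 𝕜 L x y) w = pbwMul 𝕜 L x (pbwMul 𝕜 L y w) :=
  quantize_injective (by simp only [quantize_pbwMul, mul_assoc])

theorem homogenize_add (z : 𝕜) {M : ℕ} (n : ℕ) {x : Sym 𝕜 L} (hx : x ∈ degreeLE 𝕜 L M) :
    homogenize z (n + M) x = z ^ n • homogenize z M x := by
  rw [homogenize_apply, homogenize_apply, add_assoc, sum_range_add, sum_eq_zero, zero_add,
    smul_sum]
  · refine sum_congr rfl fun i _ => ?_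
    rw [smul_smul, ← pow_add, Nat.add_sub_add_left]
  · intro i hi
    rw [homProj_eq_zero hx (by have := mem_range.1 hi; omega), smul_zero]

theorem sum_homProj_reflect {m : ℕ} {x : Sym 𝕜 L} (hx : x ∈ degreeLE 𝕜 L m) :
    ∑ n ∈ range (m + 1), homProj 𝕜 L (m - n) x = x := by
  conv_rhs => rw [← sum_homProj_eq hx, ← sum_range_reflect]
  rfl

/-- The degree N - n part of `u` carries zⁿ, exactly the powers missing when its products are
homogenized to degree N + m. So homogenization carries `pbwMul` to ⋆_z, for z = 0 as well, and
associativity is inherited from U(L). -/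
theorem guttStarLin_homogenize_left (z : 𝕜) {N m : ℕ} {u : Sym 𝕜 L} (hu : u ∈ degreeLE 𝕜 L N)
    (w : SymPow 𝕜 L m) : guttStarLin L z (homogenize z N u) (symOf 𝕜 m w) =
      homogenize z (N + m) (pbwMul 𝕜 L u (symOf 𝕜 m w)) := by
  conv_rhs => rw [← sum_homProj_reflect hu]
  rw [homogenize_apply, map_sum, map_sum, LinearMap.sum_apply, LinearMap.sum_apply, map_sum]
  refine sum_congr rfl fun n hn => ?_
  have hn' : n ≤ N := Nat.lt_succ_iff.1 (mem_range.1 hn)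
  have h1 : N + m = n + (N - n + m) := by omega
  rw [map_smul, LinearMap.smul_apply, h1, homogenize_add]
  · exact congrArg (z ^ n • ·) (guttStarLin_symOf z (u (N - n)) w)
  · exact pbwMul_mem_degreeLE (u (N - n)) w

theorem guttStarLin_homogenize_right (z : 𝕜) {N m : ℕ} {u : Sym 𝕜 L} (hu : u ∈ degreeLE 𝕜 L N)
    (w : SymPow 𝕜 L m) : guttStarLin L z (symOf 𝕜 m w) (homogenize z N u) =
      homogenize z (m + N) (pbwMul 𝕜 L (symOf 𝕜 m w) u) := by
  conv_rhs => rw [← sum_homProj_reflect hu]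
  rw [homogenize_apply, map_sum, map_sum, map_sum]
  refine sum_congr rfl fun n hn => ?_
  have hn' : n ≤ N := Nat.lt_succ_iff.1 (mem_range.1 hn)
  have h1 : m + N = n + (m + (N - n)) := by omega
  rw [map_smul, h1, homogenize_add]
  · exact congrArg (z ^ n • ·) (guttStarLin_symOf z w (u (N - n)))
  · exact pbwMul_mem_degreeLE w (u (N - n))

theorem guttStarLin_assoc (z : 𝕜) (x y w : Sym 𝕜 L) :
    guttStarLin L z (guttStarLin L z x y) w = guttStarLin L z x (guttStarLin L z y w) := by
  induction x using DirectSum.induction_on with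
  | zero => simp
  | add x x' hx hx' => simp only [map_add, LinearMap.add_apply, hx, hx']
  | of k x =>
    induction y using DirectSum.induction_on with
    | zero => simp
    | add y y' hy hy' => simp only [map_add, LinearMap.add_apply, hy, hy']
    | of l y =>
      induction w using DirectSum.induction_on with
      | zero => simp
      | add w w' hw hw' => simp only [map_add, hw, hw']
      | of m w =>
        have h1 := guttStarLin_homogenize_left z (pbwMul_mem_degreeLE x y) w
        have h2 := guttStarLin_homogenize_right z (pbwMul_mem_degreeLE y w) x
        rw [← guttStarLin_symOf, pbwMul_assoc] at h1
        rw [← guttStarLin_symOf, ← add_assoc] at h2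
        exact h1.trans h2.symm

theorem homogenize_symOf (z : 𝕜) {l : ℕ} (y : SymPow 𝕜 L l) :
    homogenize z l (symOf 𝕜 l y) = symOf 𝕜 l y := by
  rw [homogenize_apply, sum_eq_single 0]
  · rw [homProj_apply, homPart_symOf, pow_zero, one_smul, if_pos (Nat.sub_zero l)]
  · intro n hn h0
    rw [homProj_apply, homPart_symOf, if_neg (by have := mem_range.1 hn; omega), smul_zero]
  · simp

theorem guttStarLin_one (z : 𝕜) (y : Sym 𝕜 L) : guttStarLin L z (symOne 𝕜 L) y = y := by
  induction y using DirectSum.induction_on with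
  | zero => simp
  | add y y' hy hy' => rw [map_add, hy, hy']
  | of l y =>
    have h1 : pbwMul 𝕜 L (symOne 𝕜 L) (symOf 𝕜 l y) = symOf 𝕜 l y :=
      quantize_injective (by rw [quantize_pbwMul, quantize_eq, symLift_symOne, one_mul])
    refine (guttStarLin_symOf z _ y).trans ?_
    rw [zero_add]
    exact (congrArg _ h1).trans (homogenize_symOf z y)

theorem guttStarLin_mul_one (z : 𝕜) (x : Sym 𝕜 L) : guttStarLin L z x (symOne 𝕜 L) = x := by
  induction x using DirectSum.induction_on with
  | zero => simp
  | add x x' hx hx' => rw [map_add, LinearMap.add_apply, hx, hx']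
  | of k x =>
    have h1 : pbwMul 𝕜 L (symOf 𝕜 k x) (symOne 𝕜 L) = symOf 𝕜 k x :=
      quantize_injective (by rw [quantize_pbwMul, quantize_eq, symLift_symOne, mul_one])
    refine (guttStarLin_symOf z x _).trans ?_
    exact (congrArg _ h1).trans (homogenize_symOf z x)

/-- The continuity estimate for the coefficients of the Gutt star product. -/
theorem symSeminorm_guttCLin_le {R : ℝ} (hR : 1 ≤ R) {q : Seminorm 𝕜 L}
    (hq : ∀ x y, q ⁅x, y⁆ ≤ 2⁻¹ * (q x * q y)) {a : ℝ} (ha : 1 ≤ a) {Q : Seminorm 𝕜 L}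
    (hQ : ∀ v, a * 2 ^ (R + 1) * q v ≤ Q v) (n : ℕ) (x y : Sym 𝕜 L) :
    a ^ n * symSeminorm R q (guttCLin 𝕜 L n x y) ≤ symSeminorm R Q x * symSeminorm R Q y := by
  have ha0 : 0 < a := by linarith
  have hc : 0 < a * 2 ^ (R + 1) := by positivity
  -- Passing from `q` to `Q` gains a·2^{R+1} per degree: 2^{R+1} pays for the product estimate, a
  -- for the factor aⁿ.
  have hqQ : ∀ (k : ℕ) (x : SymPow 𝕜 L k), (a * 2 ^ (R + 1)) ^ k * symSeminorm R q (symOf 𝕜 k x) ≤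
      symSeminorm R Q (symOf 𝕜 k x) := by
    intro k x
    have h := tensorSeminorm_mono (p := q) (q := Q) (c := (a * 2 ^ (R + 1))⁻¹) (by positivity)
      (fun v => by rw [inv_mul_eq_div, le_div_iff₀' hc]; exact hQ v) (x : ⨂[𝕜]^k L)
    rw [inv_pow, inv_mul_eq_div, le_div_iff₀' (by positivity)] at h
    rw [symSeminorm_symOf, symSeminorm_symOf, mul_left_comm]
    gcongr
  have hom : ∀ (k l : ℕ) (x : SymPow 𝕜 L k) (y : SymPow 𝕜 L l),
      a ^ n * symSeminorm R q (guttCLin 𝕜 L n (symOf 𝕜 k x) (symOf 𝕜 l y)) ≤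
        symSeminorm R Q (symOf 𝕜 k x) * symSeminorm R Q (symOf 𝕜 l y) := by
    intro k l x y
    rw [guttCLin_symOf]
    split_ifs with hn
    · have hx := apply_nonneg (symSeminorm R q) (symOf 𝕜 k x)
      have hy := apply_nonneg (symSeminorm R q) (symOf 𝕜 l y)
      -- Since n ≤ k + l and a ≥ 1, aⁿ is at most a^{k+l}; taking a homogeneous part does not
      -- increase the seminorm.
      calc a ^ n * symSeminorm R q (homProj 𝕜 L (k + l - n)
            (pbwMul 𝕜 L (symOf 𝕜 k x) (symOf 𝕜 l y)))
          ≤ a ^ (k + l) * ((2 ^ (R + 1)) ^ (k + l) *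
            (symSeminorm R q (symOf 𝕜 k x) * symSeminorm R q (symOf 𝕜 l y))) := by
            gcongr
            exact (symSeminorm_homPart_le R q _ _).trans (symSeminorm_pbwMul_le hq hR x y)
        _ = ((a * 2 ^ (R + 1)) ^ k * symSeminorm R q (symOf 𝕜 k x)) *
            ((a * 2 ^ (R + 1)) ^ l * symSeminorm R q (symOf 𝕜 l y)) := by
            rw [mul_pow, mul_pow, pow_add, pow_add]; ring
        _ ≤ _ := mul_le_mul (hqQ k x) (hqQ l y) (by positivity) (apply_nonneg _ _)
    · rw [map_zero, mul_zero]
      exact mul_nonneg (apply_nonneg _ _) (apply_nonneg _ _)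
  obtain ⟨K, hK⟩ := exists_mem_degreeLE x
  obtain ⟨M, hM⟩ := exists_mem_degreeLE y
  have hsum : guttCLin 𝕜 L n x y = ∑ k ∈ range (K + 1), ∑ l ∈ range (M + 1),
      guttCLin 𝕜 L n (symOf 𝕜 k (x k)) (symOf 𝕜 l (y l)) := by
    conv_lhs => rw [eq_sum_of_mem_degreeLE hK, eq_sum_of_mem_degreeLE hM]
    simp only [map_sum, LinearMap.sum_apply]
    exact sum_comm
  rw [symSeminorm_eq_sum R Q hK, symSeminorm_eq_sum R Q hM, sum_mul_sum, hsum]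
  calc _ ≤ a ^ n * ∑ k ∈ range (K + 1), ∑ l ∈ range (M + 1),
        symSeminorm R q (guttCLin 𝕜 L n (symOf 𝕜 k (x k)) (symOf 𝕜 l (y l))) := by
        gcongr
        refine (le_sum_of_subadditive _ (map_zero _).le (map_add_le_add _) _ _).trans
          (sum_le_sum fun k _ => ?_)
        exact le_sum_of_subadditive _ (map_zero _).le (map_add_le_add _) _ _
    _ ≤ _ := by
        simp only [mul_sum]
        exact sum_le_sum fun k _ => sum_le_sum fun l _ => hom k l _ _

end Star

/-! ### Directional derivatives of polynomial functions via dual numbers. -/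

section Differential

variable {𝕜 : Type*} [RCLike 𝕜] {V : Type*} [AddCommGroup V] [Module 𝕜 V]

/-- The linear map `v ↦ φ v + ε ψ v` to the dual numbers. -/
def dualPair (φ ψ : Module.Dual 𝕜 V) : V →ₗ[𝕜] DualNumber 𝕜 :=
  (Algebra.linearMap 𝕜 (DualNumber 𝕜)).comp φ + (TrivSqZeroExt.inrHom 𝕜 𝕜).comp ψ

/-- The derivative at `φ` in direction `ψ` of polynomial functions on `V*`. -/
def dirDeriv (φ ψ : Module.Dual 𝕜 V) : Sym 𝕜 V →ₗ[𝕜] 𝕜 :=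
  (TrivSqZeroExt.sndHom 𝕜 𝕜).comp (symLift (dualPair φ ψ))

theorem dirDeriv_apply (φ ψ : Module.Dual 𝕜 V) (x : Sym 𝕜 V) :
    dirDeriv φ ψ x = (symLift (dualPair φ ψ) x).snd := rfl

theorem dirDeriv_symProd_const (φ ψ : Module.Dual 𝕜 V) (n : ℕ) (v : V) :
    dirDeriv φ ψ (symProd 𝕜 fun _ : Fin n => v) = n * φ v ^ (n - 1) * ψ v := by
  rw [dirDeriv_apply, symLift_symProd_const, TrivSqZeroExt.snd_pow]
  simp [dualPair, TrivSqZeroExt.algebraMap_eq_inl]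
  ring

theorem eval_symProd_const (φ : Module.Dual 𝕜 V) (n : ℕ) (v : V) :
    eval φ (symProd 𝕜 fun _ : Fin n => v) = φ v ^ n := symLift_symProd_const _ _ _

theorem hasDerivAt_eval (φ ψ : Module.Dual 𝕜 V) (x : Sym 𝕜 V) :
    HasDerivAt (fun t : 𝕜 => eval (φ + t • ψ) x) (dirDeriv φ ψ x) 0 := by
  have hx : x ∈ Submodule.span 𝕜 (Set.range fun p : ℕ × V => symProd 𝕜 fun _ : Fin p.1 => p.2) := by
    rw [span_symProd_const]; trivial
  induction hx using Submodule.span_induction with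
  | zero => simpa using hasDerivAt_const (0 : 𝕜) (0 : 𝕜)
  | add x y _ _ hx hy => simp only [map_add]; exact hx.add hy
  | smul a x _ hx => simpa only [map_smul, smul_eq_mul] using hx.const_mul a
  | mem x hx =>
    obtain ⟨⟨n, v⟩, rfl⟩ := hx
    simp only [eval_symProd_const, dirDeriv_symProd_const, LinearMap.add_apply,
      LinearMap.smul_apply, smul_eq_mul]
    have h : HasDerivAt (fun t : 𝕜 => φ v + t * ψ v) (ψ v) 0 := by
      simpa using ((hasDerivAt_id (0 : 𝕜)).mul_const (ψ v)).const_add (φ v)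
    have h' := h.pow n
    simp only [zero_mul, add_zero] at h'
    exact h'

theorem IsDifferentialAt.dirDeriv_eq {x : Sym 𝕜 V} {φ : Module.Dual 𝕜 V} {ξ : V}
    (h : IsDifferentialAt x φ ξ) (ψ : Module.Dual 𝕜 V) : dirDeriv φ ψ x = ψ ξ :=
  (hasDerivAt_eval φ ψ x).unique (h ψ)

end Differential

/-! ### The operators C₀ and C₁: pointwise product and Poisson bracket. -/

section ClassicalLimit

open Finset

variable {𝕜 : Type*} [RCLike 𝕜] {L : Type*} [LieRing L] [LieAlgebra 𝕜 L]

theorem leftMulPart_symOf_eq_symOf (ξ : L) {j k : ℕ} (h : j ≤ k) (x : SymPow 𝕜 L k) :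
    ∃ y : SymPow 𝕜 L (k - j + 1), leftMulPart ξ j (symOf 𝕜 k x) = symOf 𝕜 (k - j + 1) y := by
  rw [leftMulPart_symOf ξ h]
  suffices hs : PiTensorProduct.lift (adInsert (𝕜 := 𝕜) ξ (Nat.add_sub_cancel' h))
      (x : ⨂[𝕜]^k L) ∈ LinearMap.range (symOf 𝕜 (V := L) (k - j + 1)) by
    obtain ⟨y, hy⟩ := hs
    exact ⟨(bernoulliCoeff 𝕜 j * (k.descFactorial j : 𝕜)) • y, by rw [map_smul, hy]⟩
  generalize (x : ⨂[𝕜]^k L) = t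
  induction t using PiTensorProduct.induction_on with
  | smul_tprod a v =>
    rw [map_smul, PiTensorProduct.lift.tprod, adInsert_apply]
    exact Submodule.smul_mem _ _ ⟨_, rfl⟩
  | add a b ha hb => rw [map_add]; exact add_mem ha hb

theorem homProj_symOf {k : ℕ} (r : ℕ) (x : SymPow 𝕜 L k) :
    homProj 𝕜 L r (symOf 𝕜 k x) = if r = k then symOf 𝕜 k x else 0 := homPart_symOf x r

theorem homProj_leftMulPart_symOf (ξ : L) (r j : ℕ) {k : ℕ} (x : SymPow 𝕜 L k) :
    homProj 𝕜 L r (leftMulPart ξ j (symOf 𝕜 k x)) =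
      if k + 1 = r + j then leftMulPart ξ j (symOf 𝕜 k x) else 0 := by
  rcases lt_or_ge k j with hj | hj
  · rw [leftMulPart_symOf_of_lt ξ hj, map_zero, ite_self]
  · obtain ⟨y, hy⟩ := leftMulPart_symOf_eq_symOf ξ hj x
    rw [hy, homProj_symOf]
    exact if_congr (by omega) rfl rfl

theorem symLift_leftMulPart_zero {A : Type*} [CommRing A] [Algebra 𝕜 A] (f : L →ₗ[𝕜] A) (ξ : L)
    (x : Sym 𝕜 L) : symLift f (leftMulPart ξ 0 x) = f ξ * symLift f x := by
  have : (symLift f).comp (leftMulPart ξ 0) = (LinearMap.mulLeft 𝕜 (f ξ)).comp (symLift f) := by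
    refine sym_linearMap_ext fun k η => ?_
    simp only [LinearMap.comp_apply, LinearMap.mulLeft_apply]
    rw [leftMulPart_symProd_const ξ η (Nat.zero_le k), map_smul, symLift_symProd_cons,
      symLift_symProd_const, bernoulliCoeff_zero, Nat.descFactorial_zero, Nat.cast_one, mul_one,
      one_smul, pow_zero, Module.End.one_apply, Nat.sub_zero, inv_smul_eq_iff₀
        (by exact_mod_cast Nat.succ_ne_zero k)]
    have h : ∀ p ∈ range (k + 1), f η ^ p * f ξ * f η ^ (k - p) = f ξ * f η ^ k := fun p hp => by
      have : p ≤ k := Nat.lt_succ_iff.1 (mem_range.1 hp)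
      rw [mul_right_comm, ← pow_add, Nat.add_sub_cancel' this, mul_comm]
    rw [sum_congr rfl h, sum_const, card_range, Nat.cast_smul_eq_nsmul]
  exact LinearMap.congr_fun this x

/-- On ηᵏ the value is B₁ k φ([η, ξ]) φ(η)^{k-1} with B₁ = -1/2, and [η, ξ] = -[ξ, η] removes the
sign. -/
theorem eval_leftMulPart_one (φ : Module.Dual 𝕜 L) (ξ : L) (x : Sym 𝕜 L) :
    eval φ (leftMulPart ξ 1 x) = 2⁻¹ * dirDeriv φ (φ.comp (LieAlgebra.ad 𝕜 L ξ)) x := by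
  have : (eval φ).comp (leftMulPart ξ 1) =
      (2⁻¹ : 𝕜) • dirDeriv φ (φ.comp (LieAlgebra.ad 𝕜 L ξ)) := by
    refine sym_linearMap_ext fun k η => ?_
    rw [LinearMap.comp_apply, LinearMap.smul_apply, dirDeriv_symProd_const]
    rcases Nat.eq_zero_or_pos k with rfl | hk
    · have h : leftMulPart ξ 1 (symProd 𝕜 fun _ : Fin 0 => η) = 0 :=
        leftMulPart_symOf_of_lt ξ one_pos _
      rw [h]
      simp
    · rw [leftMulPart_symProd_const ξ η hk, map_smul, eval, symLift_symProd_cons,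
        bernoulliCoeff_one, pow_one, Nat.descFactorial_one]
      have h : ∀ p ∈ range (k - 1 + 1), φ η ^ p * φ (LieAlgebra.ad 𝕜 L η ξ) * φ η ^ (k - 1 - p) =
          φ (LieAlgebra.ad 𝕜 L η ξ) * φ η ^ (k - 1) := fun p hp => by
        have : p ≤ k - 1 := Nat.lt_succ_iff.1 (mem_range.1 hp)
        rw [mul_right_comm, ← pow_add, Nat.add_sub_cancel' this, mul_comm]
      have h1 : ((k - 1 + 1 : ℕ) : 𝕜) ≠ 0 := by exact_mod_cast Nat.succ_ne_zero (k - 1)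
      rw [sum_congr rfl h, sum_const, card_range, ← Nat.cast_smul_eq_nsmul 𝕜, inv_smul_smul₀ h1,
        LieAlgebra.ad_apply, LinearMap.comp_apply, LieAlgebra.ad_apply, ← lie_skew ξ η, map_neg]
      simp only [smul_eq_mul, map_div₀, map_neg, map_one, map_ofNat]
      ring
  exact LinearMap.congr_fun this x

variable [FiniteDimensional 𝕜 L]

theorem homProj_zero_leftMul (ξ : L) (x : Sym 𝕜 L) : homProj 𝕜 L 0 (leftMul 𝕜 L ξ x) = 0 := by
  induction x using DirectSum.induction_on with
  | zero => simp
  | add x y hx hy => rw [map_add, map_add, hx, hy, add_zero]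
  | of k x =>
    refine (congrArg _ (leftMul_symOf ξ x)).trans ?_
    rw [map_sum]
    refine sum_eq_zero fun j hj => ?_
    rw [homProj_leftMulPart_symOf, if_neg (by have := mem_range.1 hj; omega)]

theorem homProj_succ_leftMul_symOf (ξ : L) (r : ℕ) {k : ℕ} (x : SymPow 𝕜 L k) :
    homProj 𝕜 L (r + 1) (leftMul 𝕜 L ξ (symOf 𝕜 k x)) =
      if r ≤ k then leftMulPart ξ (k - r) (symOf 𝕜 k x) else 0 := by
  rw [leftMul_symOf, map_sum]
  simp only [homProj_leftMulPart_symOf]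
  split_ifs with h
  · rw [sum_eq_single (k - r), if_pos (by omega)]
    · intro j _ hj
      rw [if_neg (by omega)]
    · intro hj
      exact absurd (mem_range.2 (by omega)) hj
  · exact sum_eq_zero fun j _ => if_neg (by omega)

theorem homProj_leftMul_top (ξ : L) {m : ℕ} {x : Sym 𝕜 L} (hx : x ∈ degreeLE 𝕜 L m) :
    homProj 𝕜 L (m + 1) (leftMul 𝕜 L ξ x) = leftMulPart ξ 0 (homProj 𝕜 L m x) := by
  rw [eq_sum_of_mem_degreeLE hx]
  simp only [map_sum]
  refine sum_congr rfl fun k hk => ?_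
  have hk' : k ≤ m := Nat.lt_succ_iff.1 (mem_range.1 hk)
  rw [homProj_succ_leftMul_symOf, homProj_symOf]
  rcases hk'.lt_or_eq with h | rfl
  · rw [if_neg (by omega), if_neg (by omega), map_zero]
  · simp

/-- The j-th part of the left multiplication lowers the expected degree by j, so this component is
reached from degree m with j = 0 and from degree m + 1 with j = 1. -/
theorem homProj_leftMul_subtop (ξ : L) {m : ℕ} {x : Sym 𝕜 L} (hx : x ∈ degreeLE 𝕜 L (m + 1)) :
    homProj 𝕜 L (m + 1) (leftMul 𝕜 L ξ x) =
      leftMulPart ξ 0 (homProj 𝕜 L m x) + leftMulPart ξ 1 (homProj 𝕜 L (m + 1) x) := by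
  rw [eq_sum_of_mem_degreeLE hx]
  simp only [map_sum, ← sum_add_distrib]
  refine sum_congr rfl fun k hk => ?_
  have hk' : k ≤ m + 1 := Nat.lt_succ_iff.1 (mem_range.1 hk)
  rw [homProj_succ_leftMul_symOf, homProj_symOf, homProj_symOf]
  rcases hk'.lt_or_eq with h | rfl
  · rcases (Nat.lt_succ_iff.1 h).lt_or_eq with h | rfl
    · rw [if_neg (by omega), if_neg (by omega), if_neg (by omega), map_zero, map_zero, add_zero]
    · simp
  · simp

theorem pbwMul_symProd_const_zero (ξ : L) (y : Sym 𝕜 L) :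
    pbwMul 𝕜 L (symProd 𝕜 fun _ : Fin 0 => ξ) y = y :=
  quantize_injective (by
    rw [quantize_pbwMul, quantize_eq, symLift_symProd_const, pow_zero, one_mul])

theorem pbwMul_symProd_const_succ (ξ : L) (a : ℕ) (y : Sym 𝕜 L) :
    pbwMul 𝕜 L (symProd 𝕜 fun _ : Fin (a + 1) => ξ) y =
      leftMul 𝕜 L ξ (pbwMul 𝕜 L (symProd 𝕜 fun _ : Fin a => ξ) y) :=
  quantize_injective (by
    rw [quantize_leftMul, quantize_pbwMul, quantize_pbwMul, quantize_eq, symLift_symProd_const,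
      symLift_symProd_const, pow_succ', mul_assoc])

/-- The top degree part of a product is the commutative one. The target is a general commutative
algebra so that both 𝕜 and the dual numbers are covered, the latter giving derivatives. -/
theorem symLift_homProj_pbwMul {A : Type*} [CommRing A] [Algebra 𝕜 A] (f : L →ₗ[𝕜] A) (ξ : L)
    (a : ℕ) {l : ℕ} (y : SymPow 𝕜 L l) :
    symLift f (homProj 𝕜 L (a + l) (pbwMul 𝕜 L (symProd 𝕜 fun _ : Fin a => ξ) (symOf 𝕜 l y))) =
      f ξ ^ a * symLift f (symOf 𝕜 l y) := by
  induction a with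
  | zero => rw [pbwMul_symProd_const_zero, zero_add, homProj_symOf, if_pos rfl, pow_zero, one_mul]
  | succ a ih =>
    have hd : pbwMul 𝕜 L (symProd 𝕜 fun _ : Fin a => ξ) (symOf 𝕜 l y) ∈ degreeLE 𝕜 L (a + l) :=
      pbwMul_mem_degreeLE _ y
    rw [pbwMul_symProd_const_succ, add_right_comm, homProj_leftMul_top ξ hd, symLift_leftMulPart_zero, ih, pow_succ', mul_assoc]

/-- In the dual numbers, ψ(ξ) = 0 makes the image of ξ a scalar, so ξᵃ is not differentiated. It is
used for ψ = φ ∘ ad ξ, which kills ξ. -/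
theorem dirDeriv_homProj_pbwMul (φ ψ : Module.Dual 𝕜 L) (ξ : L) (hψ : ψ ξ = 0)
    (a : ℕ) {l : ℕ} (y : SymPow 𝕜 L l) :
    dirDeriv φ ψ (homProj 𝕜 L (a + l)
      (pbwMul 𝕜 L (symProd 𝕜 fun _ : Fin a => ξ) (symOf 𝕜 l y))) =
      φ ξ ^ a * dirDeriv φ ψ (symOf 𝕜 l y) := by
  rw [dirDeriv_apply, symLift_homProj_pbwMul, dirDeriv_apply]
  have : dualPair φ ψ ξ = algebraMap 𝕜 (DualNumber 𝕜) (φ ξ) := by simp [dualPair, hψ]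
  rw [this, ← map_pow, ← Algebra.smul_def, TrivSqZeroExt.snd_smul, smul_eq_mul]

/-- Writing Eₐ for the value and D for the derivative of y, `homProj_leftMul_subtop` gives E_{a+1} =
φ(ξ) Eₐ + φ(ξ)ᵃ D / 2. -/
theorem eval_homProj_pbwMul_subtop (φ : Module.Dual 𝕜 L) (ξ : L) (a m : ℕ) {l : ℕ}
    (h : a + l = m + 1) (y : SymPow 𝕜 L l) :
    eval φ (homProj 𝕜 L m (pbwMul 𝕜 L (symProd 𝕜 fun _ : Fin a => ξ) (symOf 𝕜 l y))) =
      2⁻¹ * (a * φ ξ ^ (a - 1)) *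
        dirDeriv φ (φ.comp (LieAlgebra.ad 𝕜 L ξ)) (symOf 𝕜 l y) := by
  induction a generalizing m with
  | zero =>
    rw [pbwMul_symProd_const_zero, homProj_symOf, if_neg (by omega)]
    simp
  | succ a ih =>
    obtain rfl : m = a + l := by omega
    rw [pbwMul_symProd_const_succ]
    rcases Nat.eq_zero_or_pos (a + l) with h0 | h0
    -- Here y is a constant: left multiplication has no component in degree 0, and the derivative of
    -- y vanishes.
    · obtain ⟨rfl, rfl⟩ : a = 0 ∧ l = 0 := by omega
      have h1 := eval_leftMulPart_one φ ξ (symOf 𝕜 0 y)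
      rw [leftMulPart_symOf_of_lt ξ one_pos, map_zero, zero_eq_mul] at h1
      rw [homProj_zero_leftMul, h1.resolve_left (by norm_num)]
      simp
    · obtain ⟨m, hm⟩ := Nat.exists_eq_succ_of_ne_zero h0.ne'
      have hdeg : pbwMul 𝕜 L (symProd 𝕜 fun _ : Fin a => ξ) (symOf 𝕜 l y) ∈
        degreeLE 𝕜 L (m + 1) := by rw [← Nat.succ_eq_add_one, ← hm]; exact pbwMul_mem_degreeLE _ y
      have h2 := dirDeriv_homProj_pbwMul φ (φ.comp (LieAlgebra.ad 𝕜 L ξ)) ξ (by simp) a y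
      rw [hm] at h2 ⊢
      rw [homProj_leftMul_subtop ξ hdeg, map_add, eval_leftMulPart_one, h2]
      have h3 : eval φ (leftMulPart ξ 0 (homProj 𝕜 L m
          (pbwMul 𝕜 L (symProd 𝕜 fun _ : Fin a => ξ) (symOf 𝕜 l y)))) = φ ξ * _ :=
        symLift_leftMulPart_zero φ ξ _
      have h4 := ih m hm
      rw [eval] at h4
      rw [h3, h4]
      rcases Nat.eq_zero_or_pos a with rfl | ha
      · simp
      · obtain ⟨b, rfl⟩ := Nat.exists_eq_succ_of_ne_zero ha.ne'
        simp only [Nat.succ_eq_add_one, Nat.add_sub_cancel]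
        push_cast
        ring

theorem eval_guttCLin_zero (φ : Module.Dual 𝕜 L) (x y : Sym 𝕜 L) :
    eval φ (guttCLin 𝕜 L 0 x y) = eval φ x * eval φ y := by
  induction y using DirectSum.induction_on with
  | zero => simp
  | add y y' hy hy' => rw [map_add, map_add, map_add, hy, hy', mul_add]
  | of l y =>
    have : (eval φ).comp ((guttCLin 𝕜 L 0).flip (symOf 𝕜 l y)) =
        (LinearMap.mulRight 𝕜 (eval φ (symOf 𝕜 l y))).comp (eval φ) := by
      refine sym_linearMap_ext fun a ξ => ?_
      have h1 : guttCLin 𝕜 L 0 (symProd 𝕜 fun _ : Fin a => ξ) (symOf 𝕜 l y) =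
          homProj 𝕜 L (a + l) (pbwMul 𝕜 L (symProd 𝕜 fun _ : Fin a => ξ) (symOf 𝕜 l y)) :=
        (guttCLin_symOf 0 _ y).trans (if_pos (Nat.zero_le _))
      rw [LinearMap.comp_apply, LinearMap.flip_apply, LinearMap.comp_apply,
        LinearMap.mulRight_apply, h1, eval_symProd_const]
      exact symLift_homProj_pbwMul φ ξ a y
    exact LinearMap.congr_fun this x

theorem eval_guttCLin_one_symProd_const (φ : Module.Dual 𝕜 L) (ξ : L) (a : ℕ) (y : Sym 𝕜 L) :
    eval φ (guttCLin 𝕜 L 1 (symProd 𝕜 fun _ : Fin a => ξ) y) =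
      2⁻¹ * (a * φ ξ ^ (a - 1)) * dirDeriv φ (φ.comp (LieAlgebra.ad 𝕜 L ξ)) y := by
  induction y using DirectSum.induction_on with
  | zero => simp
  | add y y' hy hy' => rw [map_add, map_add, map_add, hy, hy', mul_add]
  | of l y =>
    refine (congrArg (eval φ) (guttCLin_symOf 1 _ y)).trans ?_
    split_ifs with h
    · exact eval_homProj_pbwMul_subtop φ ξ a _ (by omega) y
    · obtain ⟨rfl, rfl⟩ : a = 0 ∧ l = 0 := by omega
      simp

/-- With dy = η the derivative of y in direction φ ∘ ad ξ is φ([ξ, η]), which is minus the direction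
φ ∘ ad η evaluated at ξ. This exchanges the roles of x and y, so x may be reduced to powers;
altogether C₁ is half the Poisson bracket. -/
theorem eval_guttCLin_one (φ : Module.Dual 𝕜 L) (x : Sym 𝕜 L) {y : Sym 𝕜 L} {η : L}
    (hy : IsDifferentialAt y φ η) :
    eval φ (guttCLin 𝕜 L 1 x y) = -2⁻¹ * dirDeriv φ (φ.comp (LieAlgebra.ad 𝕜 L η)) x := by
  have : (eval φ).comp ((guttCLin 𝕜 L 1).flip y) =
      (-2⁻¹ : 𝕜) • dirDeriv φ (φ.comp (LieAlgebra.ad 𝕜 L η)) := by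
    refine sym_linearMap_ext fun a ξ => ?_
    rw [LinearMap.comp_apply, LinearMap.flip_apply, eval_guttCLin_one_symProd_const,
      hy.dirDeriv_eq, LinearMap.smul_apply, dirDeriv_symProd_const, LinearMap.comp_apply,
      LinearMap.comp_apply, LieAlgebra.ad_apply, LieAlgebra.ad_apply, ← lie_skew η ξ, map_neg,
      smul_eq_mul]
    ring
  exact LinearMap.congr_fun this x

theorem eval_guttCLin_one_commutator {φ : Module.Dual 𝕜 L} {x y : Sym 𝕜 L} {ξ η : L}
    (hx : IsDifferentialAt x φ ξ) (hy : IsDifferentialAt y φ η) :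
    eval φ (guttCLin 𝕜 L 1 x y) - eval φ (guttCLin 𝕜 L 1 y x) = φ ⁅ξ, η⁆ := by
  rw [eval_guttCLin_one φ x hy, eval_guttCLin_one φ y hx, hx.dirDeriv_eq, hy.dirDeriv_eq,
    LinearMap.comp_apply, LinearMap.comp_apply, LieAlgebra.ad_apply, LieAlgebra.ad_apply,
    ← lie_skew ξ η, map_neg]
  ring

end ClassicalLimit

/-! ### Seminorms and bounded bilinear families on quotients and completions. -/

section LocallyConvex

open Filter Topology

variable {𝕜 : Type*} [RCLike 𝕜]

theorem polynormableSpace_of_nhds_zero {X : Type*} [AddCommGroup X] [Module 𝕜 X]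
    [TopologicalSpace X] [IsTopologicalAddGroup X]
    (h : ∀ U ∈ 𝓝 (0 : X), ∃ p : Seminorm 𝕜 X, Continuous p ∧ ∃ r > 0, p.ball 0 r ⊆ U) :
    PolynormableSpace 𝕜 X where
  withSeminorms' := by
    have : Nonempty {p : Seminorm 𝕜 X // Continuous p} := ⟨⟨0, continuous_const⟩⟩
    rw [SeminormFamily.withSeminorms_iff_nhds_eq_iInf]
    refine le_antisymm (le_iInf fun p => tendsto_iff_comap.1 (p.2.tendsto' 0 0 (map_zero _))) ?_
    intro U hU
    obtain ⟨p, hp, r, hr, hU⟩ := h U hU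
    refine mem_of_superset (mem_iInf_of_mem ⟨p, hp⟩ ?_) hU
    exact ⟨Set.Iio r, Iio_mem_nhds hr, fun x hx => by simpa using hx⟩

theorem exists_ball_subset {X : Type*} [AddCommGroup X] [Module 𝕜 X] [TopologicalSpace X]
    [PolynormableSpace 𝕜 X] {U : Set X} (hU : U ∈ 𝓝 (0 : X)) :
    ∃ p : Seminorm 𝕜 X, Continuous p ∧ ∃ r > 0, p.ball 0 r ⊆ U := by
  have hX := PolynormableSpace.withSeminorms 𝕜 X
  have := hX.topologicalAddGroup
  obtain ⟨s, r, hr, h⟩ := (hX.mem_nhds_iff 0 U).1 hU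
  exact ⟨_, Seminorm.continuous_finsetSup fun i _ => i.2, r, hr, h⟩

section Quotient

variable {X : Type*} [AddCommGroup X] [Module 𝕜 X] (S : Submodule 𝕜 X)

theorem exists_quotient_seminorm (q : Seminorm 𝕜 X) :
    ∃ q' : Seminorm 𝕜 (X ⧸ S), (∀ x, q' (S.mkQ x) ≤ q x) ∧
      ∀ (a : X ⧸ S) (ε : ℝ), 0 < ε → ∃ x, S.mkQ x = a ∧ q x < q' a + ε := by
  let _ : SeminormedAddCommGroup X := q.toAddGroupSeminorm.toSeminormedAddCommGroup
  let _ : NormedSpace 𝕜 X := ⟨fun a v => (map_smul_eq_mul q a v).le⟩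
  exact ⟨normSeminorm 𝕜 (X ⧸ S), fun x => Submodule.Quotient.norm_mk_le S x,
    fun a ε hε => Submodule.Quotient.norm_mk_lt a hε⟩

variable [TopologicalSpace X] [IsTopologicalAddGroup X]

theorem exists_continuous_quotient_seminorm {q : Seminorm 𝕜 X} (hq : Continuous q) :
    ∃ q' : Seminorm 𝕜 (X ⧸ S), Continuous q' ∧ (∀ x, q' (S.mkQ x) ≤ q x) ∧
      ∀ (a : X ⧸ S) (ε : ℝ), 0 < ε → ∃ x, S.mkQ x = a ∧ q x < q' a + ε := by
  obtain ⟨q', h1, h2⟩ := exists_quotient_seminorm S q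
  refine ⟨q', ?_, h1, h2⟩
  have h3 : Continuous (q'.comp S.mkQ) := Seminorm.continuous_of_le hq h1
  exact S.isOpenQuotientMap_mkQ.isQuotientMap.continuous_iff.2 h3

theorem polynormableSpace_quotient [PolynormableSpace 𝕜 X] : PolynormableSpace 𝕜 (X ⧸ S) := by
  refine polynormableSpace_of_nhds_zero fun U hU => ?_
  have hc : Continuous S.mkQ := S.isOpenQuotientMap_mkQ.continuous
  obtain ⟨p, hp, r, hr, h⟩ := exists_ball_subset (𝕜 := 𝕜)
    (hc.continuousAt.preimage_mem_nhds (x := 0) (by rwa [map_zero]))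
  obtain ⟨q, hq, h1, h2⟩ := exists_continuous_quotient_seminorm S hp
  refine ⟨q, hq, r, hr, fun a ha => ?_⟩
  rw [Seminorm.mem_ball, sub_zero] at ha
  obtain ⟨x, rfl, hx⟩ := h2 a (r - q a) (by linarith)
  exact h (by rw [Seminorm.mem_ball, sub_zero]; linarith)

end Quotient

section Completion

open UniformSpace

variable {A : Type*} [AddCommGroup A] [Module 𝕜 A] [UniformSpace A] [IsUniformAddGroup A]
  [UniformContinuousConstSMul 𝕜 A]

theorem exists_completion_seminorm {p : Seminorm 𝕜 A} (hp : Continuous p) :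
    ∃ P : Seminorm 𝕜 (Completion A), Continuous P ∧ ∀ a : A, P a = p a := by
  have hu : UniformContinuous p := Seminorm.uniformContinuous_of_continuousAt_zero
    hp.continuousAt
  let P : Completion A → ℝ := Completion.extension p
  have hP : Continuous P := Completion.continuous_extension
  have hPc : ∀ a : A, P a = p a := fun a => Completion.extension_coe hu a
  refine ⟨Seminorm.of P (fun x y => ?_) (fun a x => ?_), hP, hPc⟩
  · induction x, y using Completion.induction_on₂ with
    | hp =>
      have h1 : Continuous fun z : Completion A × Completion A => P (z.1 + z.2) :=
        hP.comp continuous_add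
      exact isClosed_le h1 ((hP.comp continuous_fst).add (hP.comp continuous_snd))
    | ih x y =>
      rw [← Completion.coe_add, hPc, hPc, hPc]
      exact map_add_le_add p x y
  · induction x using Completion.induction_on with
    | hp => exact isClosed_eq (hP.comp (continuous_const_smul a)) (hP.const_mul ‖a‖)
    | ih x => rw [← Completion.coe_smul, hPc, hPc, map_smul_eq_mul]

/-- Closed neighbourhoods form a basis at 0. A ball of the extended seminorm is open, hence lies in
the closure of its points from `A`, which belong to the closed neighbourhood. -/
theorem polynormableSpace_completion [PolynormableSpace 𝕜 A] :
    PolynormableSpace 𝕜 (Completion A) := by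
  refine polynormableSpace_of_nhds_zero fun U hU => ?_
  obtain ⟨F, hF, hFc, hFU⟩ := exists_mem_nhds_isClosed_subset hU
  obtain ⟨p, hp, r, hr, h⟩ := exists_ball_subset (𝕜 := 𝕜)
    ((Completion.continuous_coe A).continuousAt.preimage_mem_nhds (x := 0) hF)
  obtain ⟨P, hP, hPp⟩ := exists_completion_seminorm hp
  refine ⟨P, hP, r, hr, fun y hy => hFU ?_⟩
  have ho : IsOpen (P.ball 0 r) := by
    have : P.ball 0 r = P ⁻¹' Set.Iio r := by ext; simp
    rw [this]
    exact isOpen_Iio.preimage hP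
  have := (Completion.denseRange_coe (α := A)).open_subset_closure_inter ho hy
  refine closure_minimal ?_ hFc this
  rintro _ ⟨ha, a, rfl⟩
  refine h ?_
  rw [Seminorm.mem_ball, sub_zero] at ha ⊢
  rwa [hPp] at ha

end Completion

/-- A family of bilinear maps is bounded if each continuous seminorm of the values is bounded by
the product of the values of a continuous seminorm, uniformly for the family. -/
def BoundedFamily {X : Type*} [AddCommGroup X] [Module 𝕜 X] [TopologicalSpace X] {ι : Type*}
    (B : ι → X →ₗ[𝕜] X →ₗ[𝕜] X) : Prop :=
  ∀ P : Seminorm 𝕜 X, Continuous P → ∃ Q : Seminorm 𝕜 X, Continuous Q ∧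
    ∀ i a b, P (B i a b) ≤ Q a * Q b

theorem BoundedFamily.continuous {X : Type*} [AddCommGroup X] [Module 𝕜 X] [TopologicalSpace X]
    [PolynormableSpace 𝕜 X] {ι : Type*} {B : ι → X →ₗ[𝕜] X →ₗ[𝕜] X} (hB : BoundedFamily B)
    (i : ι) : Continuous fun ab : X × X => B i ab.1 ab.2 := by
  have hX := PolynormableSpace.withSeminorms 𝕜 X
  have := hX.topologicalAddGroup
  rw [continuous_iff_continuousAt]
  rintro ⟨a, b⟩
  refine (hX.tendsto_nhds _ _).2 fun P ε hε => ?_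
  obtain ⟨Q, hQ, h⟩ := hB P.1 P.2
  have hc : Continuous fun xy : X × X => Q (xy.1 - a) * Q xy.2 + Q a * Q (xy.2 - b) := by fun_prop
  have h0 : (fun xy : X × X => Q (xy.1 - a) * Q xy.2 + Q a * Q (xy.2 - b)) (a, b) < ε := by
    simpa using hε
  filter_upwards [hc.continuousAt.eventually_lt_const h0] with xy hxy
  refine lt_of_le_of_lt ?_ hxy
  have : B i xy.1 xy.2 - B i a b = B i (xy.1 - a) xy.2 + B i a (xy.2 - b) := by
    simp only [map_sub, LinearMap.sub_apply]
    abel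
  change P.1 (B i xy.1 xy.2 - B i a b) ≤ _
  rw [this]
  exact (map_add_le_add P.1 _ _).trans (add_le_add (h i _ _) (h i _ _))

/-- Choose representatives whose seminorms come within ε of the quotient seminorm, and let ε tend to
0. -/
theorem BoundedFamily.quotient {X : Type*} [AddCommGroup X] [Module 𝕜 X] [TopologicalSpace X]
    [IsTopologicalAddGroup X] (S : Submodule 𝕜 X) {ι : Type*} {B : ι → X →ₗ[𝕜] X →ₗ[𝕜] X}
    (hB : BoundedFamily B) {B' : ι → (X ⧸ S) →ₗ[𝕜] (X ⧸ S) →ₗ[𝕜] (X ⧸ S)}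
    (h : ∀ i x y, B' i (S.mkQ x) (S.mkQ y) = S.mkQ (B i x y)) : BoundedFamily B' := by
  intro P hP
  obtain ⟨Q, hQ, hPQ⟩ := hB (P.comp S.mkQ) (hP.comp S.isOpenQuotientMap_mkQ.continuous)
  obtain ⟨q, hq, -, h2⟩ := exists_continuous_quotient_seminorm S hQ
  refine ⟨q, hq, fun i a b => ?_⟩
  have key : ∀ ε : ℝ, 0 < ε → P (B' i a b) ≤ (q a + ε) * (q b + ε) := by
    intro ε hε
    obtain ⟨x, rfl, hx⟩ := h2 a ε hε
    obtain ⟨y, rfl, hy⟩ := h2 b ε hε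
    rw [h]
    exact (hPQ i x y).trans (mul_le_mul hx.le hy.le (apply_nonneg _ _)
      (add_nonneg (apply_nonneg _ _) hε.le))
  have hc : Tendsto (fun ε : ℝ => (q a + ε) * (q b + ε)) (𝓝[>] 0) (𝓝 (q a * q b)) := by
    have : Continuous fun ε : ℝ => (q a + ε) * (q b + ε) := by fun_prop
    exact (this.tendsto' 0 _ (by simp)).mono_left nhdsWithin_le_nhds
  exact ge_of_tendsto hc (eventually_mem_nhdsWithin.mono fun ε hε => key ε hε)

section CompletionBilinear

open UniformSpace

variable {A : Type*} [AddCommGroup A] [Module 𝕜 A] [UniformSpace A] [IsUniformAddGroup A]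
  [UniformContinuousConstSMul 𝕜 A]

theorem BoundedFamily.completion {ι : Type*} {B : ι → A →ₗ[𝕜] A →ₗ[𝕜] A} (hB : BoundedFamily B)
    {B' : ι → Completion A →ₗ[𝕜] Completion A →ₗ[𝕜] Completion A}
    (h : ∀ i (a b : A), B' i a b = (B i a b : A))
    (hc : ∀ i, Continuous fun ab : Completion A × Completion A => B' i ab.1 ab.2) :
    BoundedFamily B' := by
  intro P hP
  let cl : A →ₗ[𝕜] Completion A :=
    { toFun := fun a => a
      map_add' := Completion.coe_add
      map_smul' := Completion.coe_smul }
  obtain ⟨q, hq, hPq⟩ := hB (P.comp cl) (hP.comp (Completion.continuous_coe A))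
  obtain ⟨Q, hQ, hQq⟩ := exists_completion_seminorm hq
  refine ⟨Q, hQ, fun i a b => ?_⟩
  induction a, b using Completion.induction_on₂ with
  | hp =>
    have h1 : Continuous fun z : Completion A × Completion A => P (B' i z.1 z.2) := hP.comp (hc i)
    exact isClosed_le h1 ((hQ.comp continuous_fst).mul (hQ.comp continuous_snd))
  | ih a b =>
    rw [h, hQq, hQq]
    exact hPq i a b

/-- A jointly continuous biadditive map extends to the completions; linearity passes to the
extension by density. -/
theorem exists_completion_bilin {B : A →ₗ[𝕜] A →ₗ[𝕜] A}
    (hB : Continuous fun ab : A × A => B ab.1 ab.2) :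
    ∃ B' : Completion A →ₗ[𝕜] Completion A →ₗ[𝕜] Completion A,
      (Continuous fun ab : Completion A × Completion A => B' ab.1 ab.2) ∧
        ∀ a b : A, B' a b = (B a b : A) := by
  let φ : A →+ A →+ Completion A := AddMonoidHom.mk'
    (fun a => (Completion.toCompl (α := A)).comp (B a).toAddMonoidHom) fun a a' => by
      ext b
      change ((B (a + a') b : A) : Completion A) = (B a b : A) + (B a' b : A)
      rw [map_add, LinearMap.add_apply, Completion.coe_add]
  have hφ : Continuous fun p : A × A => φ p.1 p.2 := (Completion.continuous_coe A).comp hB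
  have de := Completion.isDenseInducing_toCompl A
  obtain ⟨f, hf, hfc⟩ : ∃ f : Completion A × Completion A → Completion A, Continuous f ∧
      ∀ a b : A, f (a, b) = (B a b : A) :=
    ⟨_, IsDenseInducing.extend_Z_bilin de de hφ, fun a b => (de.prodMap de).extend_eq hφ (a, b)⟩
  refine ⟨LinearMap.mk₂ 𝕜 (fun a b => f (a, b)) ?_ ?_ ?_ ?_, hf, hfc⟩
  · intro a a' b
    induction a, a', b using Completion.induction_on₃ with
    | hp =>
      have h1 : Continuous fun z : Completion A × Completion A × Completion A =>
          f (z.1 + z.2.1, z.2.2) :=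
        hf.comp ((continuous_fst.add continuous_snd.fst).prodMk continuous_snd.snd)
      have h2 : Continuous fun z : Completion A × Completion A × Completion A =>
          f (z.1, z.2.2) + f (z.2.1, z.2.2) :=
        (hf.comp (continuous_fst.prodMk continuous_snd.snd)).add (hf.comp continuous_snd)
      exact isClosed_eq h1 h2
    | ih a a' b => rw [← Completion.coe_add, hfc, hfc, hfc, map_add, LinearMap.add_apply,
        Completion.coe_add]
  · intro c a b
    induction a, b using Completion.induction_on₂ with
    | hp =>
      have h1 : Continuous fun z : Completion A × Completion A => f (c • z.1, z.2) :=
        hf.comp (((continuous_const_smul c).comp continuous_fst).prodMk continuous_snd)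
      have h2 : Continuous fun z : Completion A × Completion A => c • f (z.1, z.2) :=
        (continuous_const_smul c).comp hf
      exact isClosed_eq h1 h2
    | ih a b => rw [← Completion.coe_smul, hfc, hfc, map_smul, LinearMap.smul_apply,
        Completion.coe_smul]
  · intro a b b'
    induction a, b, b' using Completion.induction_on₃ with
    | hp =>
      have h1 : Continuous fun z : Completion A × Completion A × Completion A =>
          f (z.1, z.2.1 + z.2.2) :=
        hf.comp (continuous_fst.prodMk (continuous_snd.fst.add continuous_snd.snd))
      have h2 : Continuous fun z : Completion A × Completion A × Completion A =>
          f (z.1, z.2.1) + f (z.1, z.2.2) :=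
        (hf.comp (continuous_fst.prodMk continuous_snd.fst)).add
          (hf.comp (continuous_fst.prodMk continuous_snd.snd))
      exact isClosed_eq h1 h2
    | ih a b b' => rw [← Completion.coe_add, hfc, hfc, hfc, map_add, Completion.coe_add]
  · intro c a b
    induction a, b using Completion.induction_on₂ with
    | hp =>
      have h1 : Continuous fun z : Completion A × Completion A => f (z.1, c • z.2) :=
        hf.comp (continuous_fst.prodMk ((continuous_const_smul c).comp continuous_snd))
      have h2 : Continuous fun z : Completion A × Completion A => c • f (z.1, z.2) :=
        (continuous_const_smul c).comp hf
      exact isClosed_eq h1 h2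
    | ih a b => rw [← Completion.coe_smul, hfc, hfc, map_smul, Completion.coe_smul]

theorem exists_completion_functional {f : A →ₗ[𝕜] 𝕜} (hf : Continuous f) :
    ∃ F : Completion A →ₗ[𝕜] 𝕜, Continuous F ∧ ∀ a : A, F a = f a := by
  have hu : UniformContinuous f := uniformContinuous_addMonoidHom_of_continuous hf
  obtain ⟨F, hF, hFc⟩ : ∃ F : Completion A → 𝕜, Continuous F ∧ ∀ a : A, F a = f a :=
    ⟨_, Completion.continuous_extension, fun a => Completion.extension_coe hu a⟩
  refine ⟨{ toFun := F, map_add' := fun x y => ?_, map_smul' := fun c x => ?_ }, hF, hFc⟩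
  · induction x, y using Completion.induction_on₂ with
    | hp =>
      have h1 : Continuous fun z : Completion A × Completion A => F (z.1 + z.2) :=
        hF.comp continuous_add
      exact isClosed_eq h1 ((hF.comp continuous_fst).add (hF.comp continuous_snd))
    | ih x y => rw [← Completion.coe_add, hFc, hFc, hFc, map_add]
  · induction x using Completion.induction_on with
    | hp => exact isClosed_eq (hF.comp (continuous_const_smul c)) (hF.const_smul c)
    | ih x => rw [← Completion.coe_smul, hFc, hFc, map_smul, RingHom.id_apply]

end CompletionBilinear

end LocallyConvex

/-! ### Star products from bounded remainders, also on the completion. -/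

section StarProduct

open Filter Topology

variable {𝕜 : Type*} [RCLike 𝕜]

/-- The remainders `∑_{n ∈ s} zⁿ Cₙ - ⋆_z` of the Taylor series of a family of products. -/
def starRemainder {X : Type*} [AddCommGroup X] [Module 𝕜 X] (star : 𝕜 → X →ₗ[𝕜] X →ₗ[𝕜] X)
    (C : ℕ → X →ₗ[𝕜] X →ₗ[𝕜] X) (z : 𝕜) (s : Finset ℕ) : X →ₗ[𝕜] X →ₗ[𝕜] X :=
  (∑ n ∈ s, z ^ n • C n) - star z

theorem starRemainder_apply {X : Type*} [AddCommGroup X] [Module 𝕜 X]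
    (star : 𝕜 → X →ₗ[𝕜] X →ₗ[𝕜] X) (C : ℕ → X →ₗ[𝕜] X →ₗ[𝕜] X) (z : 𝕜) (s : Finset ℕ) (a b : X) :
    starRemainder star C z s a b = ∑ n ∈ s, z ^ n • C n a b - star z a b := by
  simp [starRemainder, LinearMap.sum_apply]

section Polynormable

variable {X : Type*} [AddCommGroup X] [Module 𝕜 X] [TopologicalSpace X] [PolynormableSpace 𝕜 X]

/-- An ε/3 argument as in Banach–Steinhaus: the bound is uniform in the index, so both arguments can
be replaced by nearby points of `D`. -/
theorem BoundedFamily.tendsto_of_dense {ι : Type*} {B : ι → X →ₗ[𝕜] X →ₗ[𝕜] X}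
    (hB : BoundedFamily B) {l : Filter ι} {D : Set X} (hD : Dense D)
    (h : ∀ a ∈ D, ∀ b ∈ D, Tendsto (fun i => B i a b) l (𝓝 0)) (a b : X) :
    Tendsto (fun i => B i a b) l (𝓝 0) := by
  have hX := PolynormableSpace.withSeminorms 𝕜 X
  have := hX.topologicalAddGroup
  refine (hX.tendsto_nhds _ _).2 fun P ε hε => ?_
  obtain ⟨Q, hQ, hPQ⟩ := hB P.1 P.2
  obtain ⟨a₀, ha, haD⟩ : ∃ x, Q (a - x) * Q b < ε / 3 ∧ x ∈ D := by
    have hc : Continuous fun x => Q (a - x) * Q b := by fun_prop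
    exact hD.inter_open_nonempty _ (isOpen_Iio.preimage hc) ⟨a, by
      change Q (a - a) * Q b < ε / 3
      simp [hε]⟩
  obtain ⟨b₀, hb, hbD⟩ : ∃ x, Q a₀ * Q (b - x) < ε / 3 ∧ x ∈ D := by
    have hc : Continuous fun x => Q a₀ * Q (b - x) := by fun_prop
    exact hD.inter_open_nonempty _ (isOpen_Iio.preimage hc) ⟨b, by
      change Q a₀ * Q (b - b) < ε / 3
      simp [hε]⟩
  filter_upwards [(hX.tendsto_nhds _ _).1 (h a₀ haD b₀ hbD) P (ε / 3) (by positivity)] with i hi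
  change P.1 (B i a₀ b₀ - 0) < _ at hi
  change P.1 (B i a b - 0) < _
  have e : B i a b - 0 = B i (a - a₀) b + (B i a₀ (b - b₀) + (B i a₀ b₀ - 0)) := by
    simp only [map_sub, LinearMap.sub_apply]
    abel
  rw [e]
  have h1 := map_add_le_add P.1 (B i (a - a₀) b) (B i a₀ (b - b₀) + (B i a₀ b₀ - 0))
  have h2 := map_add_le_add P.1 (B i a₀ (b - b₀)) (B i a₀ b₀ - 0)
  have h3 := hPQ i (a - a₀) b
  have h4 := hPQ i a₀ (b - b₀)
  linarith

variable {star : 𝕜 → X →ₗ[𝕜] X →ₗ[𝕜] X} {C : ℕ → X →ₗ[𝕜] X →ₗ[𝕜] X}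

/-- The remainder for the empty set is -⋆_z; its difference from the remainder for {n} is zⁿ Cₙ. One
uniform bound thus controls the products and all coefficients. -/
theorem continuous_star_of_boundedFamily (H : ∀ z, BoundedFamily (starRemainder star C z)) (z : 𝕜) :
    Continuous fun ab : X × X => star z ab.1 ab.2 := by
  have := (PolynormableSpace.withSeminorms 𝕜 X).topologicalAddGroup
  refine ((H z).continuous ∅).neg.congr fun ab => ?_
  simp [starRemainder_apply]

theorem continuous_coeff_of_boundedFamily (H : ∀ z, BoundedFamily (starRemainder star C z))
    (n : ℕ) : Continuous fun ab : X × X => C n ab.1 ab.2 := by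
  have := (PolynormableSpace.withSeminorms 𝕜 X).topologicalAddGroup
  refine (((H 1).continuous {n}).sub ((H 1).continuous ∅)).congr fun ab => ?_
  simp [starRemainder_apply]

omit [PolynormableSpace 𝕜 X] in
theorem summable_of_boundedFamily (H : ∀ z, BoundedFamily (starRemainder star C z)) (z : 𝕜)
    (a b : X) {p : Seminorm 𝕜 X} (hp : Continuous p) : Summable fun n : ℕ => p (z ^ n • C n a b) := by
  -- The bound at 2z, available since z is arbitrary, gives the terms at z a factor 2⁻ⁿ.
  obtain ⟨Q, -, hQ⟩ := H (2 * z) p hp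
  refine Summable.of_nonneg_of_le (fun n => apply_nonneg _ _) (fun n => ?_)
    (summable_geometric_two.mul_left (2 * (Q a * Q b)))
  have h1 := hQ {n} a b
  have h2 := hQ ∅ a b
  have h3 := map_sub_le_add p (starRemainder star C (2 * z) {n} a b)
    (starRemainder star C (2 * z) ∅ a b)
  have e : starRemainder star C (2 * z) {n} a b - starRemainder star C (2 * z) ∅ a b
      = (2 : 𝕜) ^ n • (z ^ n • C n a b) := by
    simp [starRemainder_apply, mul_pow, mul_smul]
  rw [e, map_smul_eq_mul, norm_pow, RCLike.norm_ofNat] at h3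
  rw [one_div, inv_pow, ← div_eq_mul_inv, le_div_iff₀ (by positivity)]
  linarith

theorem hasSum_of_tendsto_starRemainder {z : 𝕜} {a b : X}
    (h : Tendsto (fun s => starRemainder star C z s a b) atTop (𝓝 0)) :
    HasSum (fun n : ℕ => z ^ n • C n a b) (star z a b) := by
  have := (PolynormableSpace.withSeminorms 𝕜 X).topologicalAddGroup
  rw [HasSum, SummationFilter.unconditional_filter, ← tendsto_sub_nhds_zero_iff]
  simpa only [starRemainder_apply] using h

theorem isContinuousStarProduct_of_boundedFamily {O : Type*} {ev : O → X →ₗ[𝕜] 𝕜} {one : X}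
    (H : ∀ z, BoundedFamily (starRemainder star C z))
    (assoc : ∀ z a b c, star z (star z a b) c = star z a (star z b c))
    (one_star : ∀ z a, star z one a = a) (star_one : ∀ z a, star z a one = a)
    (hsum : ∀ z a b, Tendsto (fun s => starRemainder star C z s a b) atTop (𝓝 0))
    (hev : ∀ φ a b, ev φ (C 0 a b) = ev φ a * ev φ b) :
    IsContinuousStarProduct ev one star C where
  continuous_star := continuous_star_of_boundedFamily H
  assoc := assoc
  one_star := one_star
  star_one := star_one
  continuous_coeff := continuous_coeff_of_boundedFamily H
  hasSum z a b := hasSum_of_tendsto_starRemainder (hsum z a b)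
  summable z a b _ hp := summable_of_boundedFamily H z a b hp
  ev_coeff_zero := hev

end Polynormable

section Completion

open UniformSpace

variable {A : Type*} [AddCommGroup A] [Module 𝕜 A] [UniformSpace A] [IsUniformAddGroup A]
  [UniformContinuousConstSMul 𝕜 A] [PolynormableSpace 𝕜 A]
  {star : 𝕜 → A →ₗ[𝕜] A →ₗ[𝕜] A} {C : ℕ → A →ₗ[𝕜] A →ₗ[𝕜] A}
  {starHat : 𝕜 → Completion A →ₗ[𝕜] Completion A →ₗ[𝕜] Completion A}
  {CHat : ℕ → Completion A →ₗ[𝕜] Completion A →ₗ[𝕜] Completion A}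
  {O : Type*} {ev : O → A →ₗ[𝕜] 𝕜} {evHat : O → Completion A →ₗ[𝕜] 𝕜} {one : A}

omit [PolynormableSpace 𝕜 A] in
theorem starRemainder_completion
    (hs : ∀ z (a b : A), starHat z a b = (star z a b : A))
    (hC : ∀ n (a b : A), CHat n a b = (C n a b : A)) (z : 𝕜) (s : Finset ℕ) (a b : A) :
    starRemainder starHat CHat z s a b = (starRemainder star C z s a b : A) := by
  rw [starRemainder_apply, starRemainder_apply, Completion.coe_sub, hs]
  congr 1
  refine Eq.trans ?_ (map_sum (Completion.toCompl (α := A)) _ _).symm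
  refine Finset.sum_congr rfl fun n _ => ?_
  rw [hC]
  exact (Completion.coe_smul _ _).symm

theorem isContinuousStarProduct_completion
    (H : ∀ z, BoundedFamily (starRemainder star C z))
    (h : IsContinuousStarProduct ev one star C)
    (hs : ∀ z (a b : A), starHat z a b = (star z a b : A))
    (hC : ∀ n (a b : A), CHat n a b = (C n a b : A))
    (hev : ∀ φ (a : A), evHat φ a = ev φ a)
    (hsc : ∀ z, Continuous fun ab : Completion A × Completion A => starHat z ab.1 ab.2)
    (hCc : ∀ n, Continuous fun ab : Completion A × Completion A => CHat n ab.1 ab.2)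
    (hevc : ∀ φ, Continuous (evHat φ)) :
    IsContinuousStarProduct evHat (one : Completion A) starHat CHat := by
  have := polynormableSpace_completion (𝕜 := 𝕜) (A := A)
  have hr := starRemainder_completion hs hC
  have H' : ∀ z, BoundedFamily (starRemainder starHat CHat z) := by
    refine fun z => (H z).completion (hr z) fun s => ?_
    have h1 : Continuous fun ab : Completion A × Completion A =>
        ∑ n ∈ s, z ^ n • CHat n ab.1 ab.2 - starHat z ab.1 ab.2 :=
      (continuous_finsetSum _ fun n _ => (continuous_const_smul (z ^ n)).comp (hCc n)).sub (hsc z)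
    exact h1.congr fun ab => (starRemainder_apply _ _ _ _ _ _).symm
  refine isContinuousStarProduct_of_boundedFamily H' ?_ ?_ ?_ (fun z a b => ?_) ?_
  · intro z a b c
    induction a, b, c using Completion.induction_on₃ with
    | hp =>
      have h1 : Continuous fun t : Completion A × Completion A × Completion A =>
          starHat z (starHat z t.1 t.2.1) t.2.2 :=
        (hsc z).comp (((hsc z).comp (continuous_fst.prodMk continuous_snd.fst)).prodMk
          continuous_snd.snd)
      have h2 : Continuous fun t : Completion A × Completion A × Completion A =>
          starHat z t.1 (starHat z t.2.1 t.2.2) :=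
        (hsc z).comp (continuous_fst.prodMk ((hsc z).comp continuous_snd))
      exact isClosed_eq h1 h2
    | ih a b c => rw [hs, hs, hs, hs, h.assoc]
  · intro z a
    induction a using Completion.induction_on with
    | hp =>
      have h1 : Continuous fun t : Completion A => starHat z one t :=
        (hsc z).comp (continuous_const.prodMk continuous_id)
      exact isClosed_eq h1 continuous_id
    | ih a => rw [hs, h.one_star]
  · intro z a
    induction a using Completion.induction_on with
    | hp =>
      have h1 : Continuous fun t : Completion A => starHat z t one :=
        (hsc z).comp (continuous_id.prodMk continuous_const)
      exact isClosed_eq h1 continuous_id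
    | ih a => rw [hs, h.star_one]
  -- Convergence is known on the dense subspace, and the extended remainders are still uniformly
  -- bounded.
  · refine (H' z).tendsto_of_dense (Completion.denseRange_coe (α := A)) ?_ a b
    rintro _ ⟨a, rfl⟩ _ ⟨b, rfl⟩
    have h1 : Tendsto (fun s => starRemainder star C z s a b) atTop (𝓝 0) := by
      have h2 := h.hasSum z a b
      rw [HasSum, SummationFilter.unconditional_filter, ← tendsto_sub_nhds_zero_iff] at h2
      simpa only [starRemainder_apply] using h2
    refine (((Completion.continuous_coe A).tendsto' 0 0 Completion.coe_zero).comp h1).congr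
      fun s => ?_
    exact (hr z s a b).symm
  · intro φ a b
    induction a, b using Completion.induction_on₂ with
    | hp =>
      have h1 : Continuous fun t : Completion A × Completion A => evHat φ (CHat 0 t.1 t.2) :=
        (hevc φ).comp (hCc 0)
      exact isClosed_eq h1 (((hevc φ).comp continuous_fst).mul ((hevc φ).comp continuous_snd))
    | ih a b => rw [hC, hev, hev, hev, h.ev_coeff_zero]

end Completion

end StarProduct

/-! ### Surjectivity of completed quotient maps. -/

section Surjective

open Filter Topology UniformSpace

theorem firstCountableTopology_completion {X : Type*} [AddCommGroup X] [UniformSpace X]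
    [IsUniformAddGroup X] [(𝓝 (0 : X)).IsCountablyGenerated] :
    FirstCountableTopology (Completion X) := by
  have h0 : (𝓝 (0 : Completion X)).IsCountablyGenerated := by
    obtain ⟨U, hU⟩ := (𝓝 (0 : X)).exists_antitone_basis
    have := hU.1.hasBasis_of_isDenseInducing (Completion.isDenseInducing_coe (α := X))
    rw [← Completion.coe_zero]
    exact this.isCountablyGenerated
  refine ⟨fun a => ?_⟩
  rw [← map_add_left_nhds_zero a]
  infer_instance

/-- The quotient of the first countable complete group `Completion X` by the closed kernel of the
completed map `g` is again complete and Hausdorff. So the continuous map `k` from Y into it extends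
to the completion of Y, and the extension is a right inverse of the map `j` induced by `g`, by
density. -/
theorem surjective_completion_map {X Y : Type*} [AddCommGroup X] [UniformSpace X]
    [IsUniformAddGroup X] [(𝓝 (0 : X)).IsCountablyGenerated] [AddCommGroup Y] [UniformSpace Y]
    [IsUniformAddGroup Y] (f : X →+ Y) (hf : IsOpenQuotientMap f) :
    Function.Surjective (Completion.map f) := by
  have := firstCountableTopology_completion (X := X)
  have hc := hf.continuous
  let g : Completion X →+ Completion (Y) := f.completion hc
  have hg : Continuous g := AddMonoidHom.continuous_completion _ hc
  have hgc : ∀ x : X, g x = (f x : Y) := AddMonoidHom.completion_coe _ hc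
  have hK : IsClosed (g.ker : Set (Completion X)) := isClosed_singleton.preimage hg
  let _ : UniformSpace (Completion X ⧸ g.ker) := IsTopologicalAddGroup.rightUniformSpace _
  have : IsUniformAddGroup (Completion X ⧸ g.ker) := isUniformAddGroup_of_addCommGroup
  have hcomplete : CompleteSpace (Completion X ⧸ g.ker) := QuotientAddGroup.completeSpace_right _ _
  have hT : T3Space (Completion X ⧸ g.ker) := QuotientAddGroup.instT3Space g.ker
  let π : Completion X →+ Completion X ⧸ g.ker := QuotientAddGroup.mk' g.ker
  have hπ : Continuous π := QuotientAddGroup.continuous_mk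
  let j : Completion X ⧸ g.ker →+ Completion (Y) := QuotientAddGroup.kerLift g
  have hjπ : ∀ x, j (π x) = g x := fun x => rfl
  have hj : Continuous j := QuotientAddGroup.isOpenQuotientMap_mk.isQuotientMap.continuous_iff.2 hg
  have hπf : ∀ x y : X, f x = f y → π x = π y := fun x y hxy =>
    QuotientAddGroup.kerLift_injective g (by
      change g x = g y
      rw [hgc, hgc, hxy])
  have hex : ∀ a : Y, ∃ x, f x = a := hf.surjective
  choose σ hσ using hex
  let k : Y →+ Completion X ⧸ g.ker := AddMonoidHom.mk' (fun a => π (σ a)) fun a b => by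
    rw [← map_add, ← Completion.coe_add]
    exact hπf _ _ (by rw [map_add, hσ, hσ, hσ])
  have hkm : ∀ x, k (f x) = π x := fun x => hπf _ _ (hσ _)
  have hk : Continuous k := by
    refine hf.isQuotientMap.continuous_iff.2 ?_
    exact (hπ.comp (Completion.continuous_coe X)).congr fun x => (hkm x).symm
  have hku : UniformContinuous k := uniformContinuous_addMonoidHom_of_continuous hk
  have hid : ∀ y, j (Completion.extension k y) = y := by
    intro y
    induction y using Completion.induction_on with
    | hp => exact isClosed_eq (hj.comp Completion.continuous_extension) continuous_id
    | ih a =>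
      obtain ⟨x, rfl⟩ := hf.surjective a
      rw [Completion.extension_coe hku, hkm, hjπ, hgc]
  intro y
  obtain ⟨x, hx⟩ := QuotientAddGroup.mk'_surjective g.ker (Completion.extension k y)
  refine ⟨x, ?_⟩
  rw [← hid y, ← hx]
  rfl

end Surjective

open Filter Topology

/-! ### Seminorms on finite-dimensional Lie algebras. -/

section FiniteDimensional

variable {𝕜 : Type*} [RCLike 𝕜] {L : Type*}

section Basis

variable [AddCommGroup L] [Module 𝕜 L] {ι : Type*} [Fintype ι] (b : Module.Basis ι 𝕜 L)

/-- The `ℓ¹`-norm of the coordinates with respect to a basis. -/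
def basisSeminorm : Seminorm 𝕜 L := ∑ i, (normSeminorm 𝕜 𝕜).comp (b.coord i)

theorem basisSeminorm_apply (x : L) : basisSeminorm b x = ∑ i, ‖b.repr x i‖ := by
  change FunLike.coeAddMonoidHom _ _ _ (∑ i, (normSeminorm 𝕜 𝕜).comp (b.coord i)) x = _
  rw [map_sum, Finset.sum_apply]
  rfl

theorem seminorm_le_basisSeminorm (p : Seminorm 𝕜 L) (x : L) :
    p x ≤ (∑ i, p (b i)) * basisSeminorm b x := by
  calc p x = p (∑ i, b.repr x i • b i) := by rw [b.sum_repr]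
    _ ≤ ∑ i, p (b.repr x i • b i) :=
      Finset.le_sum_of_subadditive p (map_zero p).le (map_add_le_add p) _ _
    _ ≤ ∑ i, p (b i) * basisSeminorm b x := by
      refine Finset.sum_le_sum fun i _ => ?_
      rw [map_smul_eq_mul, mul_comm, basisSeminorm_apply]
      refine mul_le_mul_of_nonneg_left ?_ (apply_nonneg _ _)
      exact Finset.single_le_sum (f := fun i => ‖b.repr x i‖) (fun i _ => norm_nonneg _)
        (Finset.mem_univ i)
    _ = _ := (Finset.sum_mul _ _ _).symm

theorem continuous_basisSeminorm [TopologicalSpace L] [IsTopologicalAddGroup L]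
    [ContinuousSMul 𝕜 L] [T2Space L] : Continuous (basisSeminorm b) := by
  have : FiniteDimensional 𝕜 L := .of_basis b
  have h : Continuous fun x => ∑ i, ‖b.coord i x‖ :=
    continuous_finsetSum _ fun i _ => (b.coord i).continuous_of_finiteDimensional.norm
  exact h.congr fun x => (basisSeminorm_apply b x).symm

end Basis

theorem exists_basisSeminorm_lie_le [LieRing L] [LieAlgebra 𝕜 L] {ι : Type*} [Fintype ι]
    (b : Module.Basis ι 𝕜 L) :
    ∃ c, 0 ≤ c ∧ ∀ x y, basisSeminorm b ⁅x, y⁆ ≤ c * (basisSeminorm b x * basisSeminorm b y) := by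
  let N := basisSeminorm b
  refine ⟨∑ j, ∑ i, N ⁅b i, b j⁆, by positivity, fun x y => ?_⟩
  have h1 := seminorm_le_basisSeminorm b (N.comp (LieAlgebra.ad 𝕜 L x)) y
  have h2 : ∀ j, N ⁅x, b j⁆ ≤ (∑ i, N ⁅b i, b j⁆) * N x := fun j => by
    have := seminorm_le_basisSeminorm b (N.comp (LieAlgebra.ad 𝕜 L (b j))) x
    simp only [Seminorm.comp_apply, LieAlgebra.ad_apply] at this
    simp only [← lie_skew _ (b j), map_neg_eq_map]
    exact this
  simp only [Seminorm.comp_apply, LieAlgebra.ad_apply] at h1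
  refine h1.trans ?_
  rw [← mul_assoc]
  refine mul_le_mul_of_nonneg_right ?_ (apply_nonneg _ _)
  rw [Finset.sum_mul]
  exact Finset.sum_le_sum fun j _ => h2 j

theorem exists_lie_seminorm [LieRing L] [LieAlgebra 𝕜 L] [FiniteDimensional 𝕜 L]
    [TopologicalSpace L] [IsTopologicalAddGroup L] [ContinuousSMul 𝕜 L] [T2Space L]
    (p : Seminorm 𝕜 L) :
    ∃ q : Seminorm 𝕜 L, Continuous q ∧ p ≤ q ∧ ∀ x y, q ⁅x, y⁆ ≤ 2⁻¹ * (q x * q y) := by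
  let b := Module.finBasis 𝕜 L
  obtain ⟨c, hc, h⟩ := exists_basisSeminorm_lie_le b
  -- The multiple d of the ℓ¹-seminorm turns the bracket constant c into c/d ≤ 1/2, and the sum in d
  -- makes it dominate `p`.
  let d : NNReal := ⟨(∑ i, p (b i)) + 2 * c, by positivity⟩
  have hd : ∀ x, (d • basisSeminorm b) x = ((∑ i, p (b i)) + 2 * c) * basisSeminorm b x :=
    fun x => rfl
  refine ⟨d • basisSeminorm b, ?_, fun x => ?_, fun x y => ?_⟩
  · exact ((continuous_basisSeminorm b).const_mul ((∑ i, p (b i)) + 2 * c)).congr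
      fun x => (hd x).symm
  · rw [hd]
    refine (seminorm_le_basisSeminorm b p x).trans
      (mul_le_mul_of_nonneg_right (by linarith) (apply_nonneg _ _))
  · rw [hd, hd, hd]
    have hs : 0 ≤ ∑ i, p (b i) := by positivity
    have hx := apply_nonneg (basisSeminorm b) x
    have hy := apply_nonneg (basisSeminorm b) y
    calc _ ≤ ((∑ i, p (b i)) + 2 * c) * (c * (basisSeminorm b x * basisSeminorm b y)) :=
          mul_le_mul_of_nonneg_left (h x y) (by positivity)
      _ ≤ ((∑ i, p (b i)) + 2 * c) * ((2⁻¹ * ((∑ i, p (b i)) + 2 * c)) *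
            (basisSeminorm b x * basisSeminorm b y)) := by
          gcongr
          linarith
      _ = _ := by ring

end FiniteDimensional

/-! ### The topology of `Sym_R`. -/

section SymR

variable {𝕜 : Type*} [RCLike 𝕜] {V : Type*} [AddCommGroup V] [Module 𝕜 V]

theorem seminormR_mono (R : ℝ) {p q : Seminorm 𝕜 V} (h : p ≤ q) : seminormR R p ≤ seminormR R q :=
  fun x => symSeminorm_mono R h x

/-- Apply the universal property to the seminorm |φ| in each degree; the weights n!^R are at least
1. -/
theorem norm_eval_le {R : ℝ} (hR : 0 ≤ R) (φ : Module.Dual 𝕜 V) (x : Sym 𝕜 V) :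
    ‖eval φ x‖ ≤ symSeminorm R ((normSeminorm 𝕜 𝕜).comp φ) x := by
  obtain ⟨m, hm⟩ := exists_mem_degreeLE x
  rw [symSeminorm_eq_sum R _ hm]
  conv_lhs => rw [eq_sum_of_mem_degreeLE hm]
  rw [map_sum]
  refine norm_sum_le_of_le _ fun k _ => ?_
  rw [symSeminorm_symOf]
  have h1 : eval φ (symOf 𝕜 k (x k)) = PiTensorProduct.lift
      ((MultilinearMap.mkPiAlgebraFin 𝕜 k 𝕜).compLinearMap fun _ => φ) (x k : ⨂[𝕜]^k V) :=
    DirectSum.toModule_lof _ _ _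
  have h2 := seminorm_lift_le ((normSeminorm 𝕜 𝕜).comp φ) (normSeminorm 𝕜 𝕜)
    ((MultilinearMap.mkPiAlgebraFin 𝕜 k 𝕜).compLinearMap fun _ => φ) zero_le_one
    (fun v => by simp [List.prod_ofFn]) (x k : ⨂[𝕜]^k V)
  rw [h1]
  refine h2.trans (mul_le_mul_of_nonneg_right ?_ (apply_nonneg _ _))
  exact Real.one_le_rpow (by exact_mod_cast k.factorial_pos) hR

variable [TopologicalSpace V]

instance (R : ℝ) : PolynormableSpace 𝕜 (SymR 𝕜 V R) :=
  (withSeminorms_symR 𝕜 V R).toPolynormableSpace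

theorem continuous_seminormR (R : ℝ) {p : Seminorm 𝕜 V} (hp : Continuous p) :
    Continuous (seminormR R p) :=
  (withSeminorms_symR 𝕜 V R).continuous_seminorm ⟨p, hp⟩

theorem exists_le_seminormR [IsTopologicalAddGroup V] {R : ℝ} {P : Seminorm 𝕜 (SymR 𝕜 V R)} (hP : Continuous P) :
    ∃ p : Seminorm 𝕜 V, Continuous p ∧ ∃ c : ℝ, 0 < c ∧ ∀ x, P x ≤ c * seminormR R p x := by
  obtain ⟨s, c, hc, h⟩ := Seminorm.bound_of_continuous (withSeminorms_symR 𝕜 V R) P hP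
  refine ⟨s.sup (fun p => p.1), Seminorm.continuous_finsetSup fun i _ => i.2, c,
    by exact_mod_cast pos_iff_ne_zero.2 hc, fun x => (h x).trans ?_⟩
  refine mul_le_mul_of_nonneg_left ?_ c.2
  exact Finset.sup_le (fun p hp => seminormR_mono R (Finset.le_sup (f := fun p => p.1) hp)) x

theorem exists_seminormR_ball_subset [IsTopologicalAddGroup V] {R : ℝ} {U : Set (SymR 𝕜 V R)} (hU : U ∈ 𝓝 0) :
    ∃ p : Seminorm 𝕜 V, Continuous p ∧ ∃ r > 0, (seminormR R p).ball 0 r ⊆ U := by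
  obtain ⟨P, hP, r, hr, h⟩ := exists_ball_subset (𝕜 := 𝕜) hU
  obtain ⟨p, hp, c, hc, hPp⟩ := exists_le_seminormR hP
  refine ⟨p, hp, r / c, by positivity, fun x hx => h ?_⟩
  rw [Seminorm.mem_ball, sub_zero] at hx ⊢
  rw [lt_div_iff₀ hc] at hx
  linarith [hPp x]

variable [IsTopologicalAddGroup V] [ContinuousSMul 𝕜 V] [T2Space V] [FiniteDimensional 𝕜 V]

/-- p_R is not homogeneous in p, so multiples of one seminorm on `V` give inequivalent seminorms on
`Sym_R`; but the integer multiples of the ℓ¹-seminorm are cofinal. -/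
theorem isCountablyGenerated_nhds_symR (R : ℝ) :
    (𝓝 (0 : SymR 𝕜 V R)).IsCountablyGenerated := by
  let b := Module.finBasis 𝕜 V
  let N : ℕ → Seminorm 𝕜 V := fun n => (n : NNReal) • basisSeminorm b
  have hN : ∀ n x, N n x = n * basisSeminorm b x := fun n x => rfl
  have hNc : ∀ n, Continuous (N n) := fun n =>
    ((continuous_basisSeminorm b).const_mul (n : ℝ)).congr fun x => (hN n x).symm
  have h : (𝓝 (0 : SymR 𝕜 V R)).HasBasis (fun _ : ℕ => True)
      fun n => (seminormR R (N n)).ball 0 (1 / (n + 1)) := by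
    refine ⟨fun U => ⟨fun hU => ?_, fun ⟨n, _, hn⟩ => mem_of_superset ?_ hn⟩⟩
    · obtain ⟨p, hp, r, hr, hU⟩ := exists_seminormR_ball_subset hU
      obtain ⟨n, hn⟩ := exists_nat_ge (max (∑ i, p (b i)) (1 / r))
      refine ⟨n, trivial, fun x hx => hU ?_⟩
      rw [Seminorm.mem_ball, sub_zero] at hx ⊢
      have h1 : seminormR R p ≤ seminormR R (N n) := seminormR_mono R fun v => by
        rw [hN]
        exact (seminorm_le_basisSeminorm b p v).trans
          (mul_le_mul_of_nonneg_right ((le_max_left _ _).trans hn) (apply_nonneg _ _))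
      refine (h1 x).trans_lt (hx.trans_le ?_)
      have h2 : 1 / r ≤ n := (le_max_right _ _).trans hn
      rw [div_le_iff₀ hr] at h2
      rw [div_le_iff₀ (by positivity)]
      linarith
    · exact Seminorm.ball_mem_nhds (continuous_seminormR R (hNc n)) (by positivity)
  exact h.isCountablyGenerated

/-- The evaluation at `φ` as a linear functional on `Sym_R^•(V)`. -/
def evalR (R : ℝ) (φ : Module.Dual 𝕜 V) : SymR 𝕜 V R →ₗ[𝕜] 𝕜 :=
  (eval φ).comp (toSymR 𝕜 V R).symm.toLinearMap

theorem continuous_evalR {R : ℝ} (hR : 0 ≤ R) (φ : Module.Dual 𝕜 V) : Continuous (evalR R φ) := by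
  have h1 : Continuous ((normSeminorm 𝕜 𝕜).comp φ) :=
    φ.continuous_of_finiteDimensional.norm
  have h2 : Continuous ((normSeminorm 𝕜 𝕜).comp (evalR R φ)) :=
    Seminorm.continuous_of_le (continuous_seminormR R h1) fun x => norm_eval_le hR φ x
  refine continuous_of_continuousAt_zero (evalR R φ).toAddMonoidHom ?_
  rw [ContinuousAt, map_zero, tendsto_zero_iff_norm_tendsto_zero]
  exact h2.tendsto' 0 0 (map_zero _)

theorem isClosed_vanishingIdeal {R : ℝ} (hR : 0 ≤ R) (O : Set (Module.Dual 𝕜 V)) :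
    IsClosed (vanishingIdeal R O : Set (SymR 𝕜 V R)) := by
  have : (vanishingIdeal R O : Set (SymR 𝕜 V R)) = ⋂ φ ∈ O, {x | evalR R φ x = 0} := by
    ext x
    simp [vanishingIdeal, evalR]
  rw [this]
  exact isClosed_biInter fun φ _ => isClosed_eq (continuous_evalR hR φ) continuous_const

end SymR

open Filter Topology

/-! ### Descent of bilinear maps to quotients. -/

section QuotientBilinear

variable {𝕜 : Type*} [RCLike 𝕜] {X : Type*} [AddCommGroup X] [Module 𝕜 X] (S : Submodule 𝕜 X)

/-- The bilinear map on a quotient induced by a bilinear map that vanishes modulo `S` if one of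
its arguments is in `S`. -/
def quotientBilin (B : X →ₗ[𝕜] X →ₗ[𝕜] X) (h₁ : ∀ x ∈ S, ∀ y, B x y ∈ S)
    (h₂ : ∀ x, ∀ y ∈ S, B x y ∈ S) : (X ⧸ S) →ₗ[𝕜] (X ⧸ S) →ₗ[𝕜] (X ⧸ S) :=
  S.liftQ
    { toFun := fun x => S.mapQ S (B x) (h₂ x)
      map_add' := fun x x' => by
        ext y
        simp
      map_smul' := fun c x => by
        ext y
        simp }
    fun x hx => by
      ext y
      simpa using h₁ x hx y

end QuotientBilinear

/-! ### The star product on `Sym_R` and on polynomial functions on the orbit. -/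

section Star

variable {𝕜 : Type*} [RCLike 𝕜] {L : Type*} [LieRing L] [LieAlgebra 𝕜 L]

/-- A bilinear map on `Sym^•(V)`, regarded as a bilinear map on `Sym_R^•(V)`. -/
def bilinR (R : ℝ) {V : Type*} [AddCommGroup V] [Module 𝕜 V]
    (B : Sym 𝕜 V →ₗ[𝕜] Sym 𝕜 V →ₗ[𝕜] Sym 𝕜 V) :
    SymR 𝕜 V R →ₗ[𝕜] SymR 𝕜 V R →ₗ[𝕜] SymR 𝕜 V R := B

variable [FiniteDimensional 𝕜 L]

variable (L) in
/-- The Gutt star product on `Sym_R^•(L)`. -/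
def starR (R : ℝ) (z : 𝕜) : SymR 𝕜 L R →ₗ[𝕜] SymR 𝕜 L R →ₗ[𝕜] SymR 𝕜 L R :=
  bilinR R (guttStarLin L z)

variable (𝕜 L) in
/-- The coefficient operators of the Gutt star product on `Sym_R^•(L)`. -/
def coeffR (R : ℝ) (n : ℕ) : SymR 𝕜 L R →ₗ[𝕜] SymR 𝕜 L R →ₗ[𝕜] SymR 𝕜 L R :=
  bilinR R (guttCLin 𝕜 L n)

theorem starR_eq_sum (R : ℝ) (z : 𝕜) (x y : SymR 𝕜 L R) :
    ∃ N : ℕ, (∀ n ≥ N, coeffR 𝕜 L R n x y = 0) ∧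
      starR L R z x y = ∑ n ∈ Finset.range N, z ^ n • coeffR 𝕜 L R n x y :=
  guttStarLin_eq_sum z ((toSymR 𝕜 L R).symm x) ((toSymR 𝕜 L R).symm y)

theorem tendsto_starRemainder (R : ℝ) (z : 𝕜) (x y : SymR 𝕜 L R) [TopologicalSpace (SymR 𝕜 L R)] :
    Tendsto (fun s => starRemainder (starR L R) (coeffR 𝕜 L R) z s x y) atTop (𝓝 0) := by
  obtain ⟨N, h0, h⟩ := starR_eq_sum R z x y
  refine tendsto_const_nhds.congr' ?_
  filter_upwards [eventually_ge_atTop (Finset.range N)] with s hs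
  rw [starRemainder_apply, h, eq_comm, sub_eq_zero]
  refine (Finset.sum_subset hs fun n _ hn => ?_).symm
  rw [h0 n (by simpa using hn), smul_zero]

theorem boundedFamily_starRemainder [TopologicalSpace L] [IsTopologicalAddGroup L]
    [ContinuousSMul 𝕜 L] [T2Space L] {R : ℝ} (hR : 1 ≤ R) (z : 𝕜) :
    BoundedFamily (starRemainder (starR L R) (coeffR 𝕜 L R) z) := by
  intro P hP
  obtain ⟨p, -, c, hc, hPp⟩ := exists_le_seminormR hP
  obtain ⟨q, hqc, hpq, hq⟩ := exists_lie_seminorm p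
  -- With |z| ≤ a/2, the factor aⁿ of the coefficient estimate yields |z|ⁿ Cₙ = O(2⁻ⁿ).
  let a : ℝ := 2 * max 1 ‖z‖
  have ha : 1 ≤ a := by
    have := le_max_left 1 ‖z‖
    change 1 ≤ 2 * max 1 ‖z‖
    linarith
  have haz : ‖z‖ ≤ 2⁻¹ * a := by
    have := le_max_right 1 ‖z‖
    change ‖z‖ ≤ 2⁻¹ * (2 * max 1 ‖z‖)
    linarith
  let d : NNReal := ⟨a * 2 ^ (R + 1), by positivity⟩
  let Q : Seminorm 𝕜 L := d • q
  have hQv : ∀ v, Q v = a * 2 ^ (R + 1) * q v := fun v => rfl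
  have hQc : Continuous Q := (hqc.const_mul (a * 2 ^ (R + 1))).congr fun v => (hQv v).symm
  have hterm : ∀ n x y, P (z ^ n • coeffR 𝕜 L R n x y) ≤
      (1 / 2) ^ n * (c * (seminormR R Q x * seminormR R Q y)) := by
    intro n x y
    have h1 : a ^ n * seminormR R q (coeffR 𝕜 L R n x y) ≤ seminormR R Q x * seminormR R Q y :=
      symSeminorm_guttCLin_le hR hq ha (fun v => (hQv v).ge) n _ _
    have h2 : P (coeffR 𝕜 L R n x y) ≤ c * seminormR R q (coeffR 𝕜 L R n x y) :=
      (hPp _).trans (mul_le_mul_of_nonneg_left (seminormR_mono R hpq _) hc.le)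
    rw [map_smul_eq_mul, norm_pow]
    calc ‖z‖ ^ n * P (coeffR 𝕜 L R n x y)
        ≤ (2⁻¹ * a) ^ n * (c * seminormR R q (coeffR 𝕜 L R n x y)) :=
          mul_le_mul (pow_le_pow_left₀ (norm_nonneg _) haz n) h2 (apply_nonneg _ _) (by positivity)
      _ = (1 / 2) ^ n * (c * (a ^ n * seminormR R q (coeffR 𝕜 L R n x y))) := by
          rw [mul_pow, one_div]
          ring
      _ ≤ _ := by gcongr
  have hsum : ∀ (s : Finset ℕ) x y, P (∑ n ∈ s, z ^ n • coeffR 𝕜 L R n x y) ≤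
      2 * (c * (seminormR R Q x * seminormR R Q y)) := by
    intro s x y
    have hQQ : 0 ≤ c * (seminormR R Q x * seminormR R Q y) :=
      mul_nonneg hc.le (mul_nonneg (apply_nonneg _ _) (apply_nonneg _ _))
    calc P (∑ n ∈ s, z ^ n • coeffR 𝕜 L R n x y) ≤ ∑ n ∈ s, P (z ^ n • coeffR 𝕜 L R n x y) :=
          Finset.le_sum_of_subadditive P (map_zero P).le (map_add_le_add P) _ _
      _ ≤ ∑ n ∈ s, (1 / 2) ^ n * (c * (seminormR R Q x * seminormR R Q y)) :=
          Finset.sum_le_sum fun n _ => hterm n x y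
      _ = (∑ n ∈ s, (1 / 2 : ℝ) ^ n) * (c * (seminormR R Q x * seminormR R Q y)) :=
          (Finset.sum_mul _ _ _).symm
      _ ≤ _ := by
          refine mul_le_mul_of_nonneg_right ?_ hQQ
          exact (summable_geometric_two.sum_le_tsum _ fun n _ => by positivity).trans_eq
            tsum_geometric_two
  -- The partial sum and the star product, itself a finite sum, contribute 2c each; (4c+1)²
  -- dominates 4c, so the bound becomes a product of one seminorm at x and at y.
  let e : NNReal := ⟨4 * c + 1, by positivity⟩
  have heQ : ∀ x, (e • seminormR R Q) x = (4 * c + 1) * seminormR R Q x := fun x => rfl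
  refine ⟨e • seminormR R Q, ((continuous_seminormR R hQc).const_mul (4 * c + 1)).congr
    fun x => (heQ x).symm, fun s x y => ?_⟩
  obtain ⟨N, -, h⟩ := starR_eq_sum R z x y
  rw [starRemainder_apply, h, heQ, heQ]
  refine (map_sub_le_add P _ _).trans ((add_le_add (hsum _ _ _) (hsum _ _ _)).trans ?_)
  have hQQ : 0 ≤ seminormR R Q x * seminormR R Q y :=
    mul_nonneg (apply_nonneg _ _) (apply_nonneg _ _)
  calc 2 * (c * (seminormR R Q x * seminormR R Q y)) + 2 * (c * (seminormR R Q x * seminormR R Q y))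
      = 4 * c * (seminormR R Q x * seminormR R Q y) := by ring
    _ ≤ (4 * c + 1) * (4 * c + 1) * (seminormR R Q x * seminormR R Q y) := by
        refine mul_le_mul_of_nonneg_right ?_ hQQ
        nlinarith
    _ = _ := by ring

section Orbit

variable {O : Set (Module.Dual 𝕜 L)} (R : ℝ)

omit [FiniteDimensional 𝕜 L] in
theorem mem_vanishingIdeal {x : SymR 𝕜 L R} :
    x ∈ vanishingIdeal R O ↔ ∀ φ ∈ O, evalR R φ x = 0 := by
  simp [vanishingIdeal, evalR]

theorem IsTangential.eval_guttCLin_left (hT : IsTangential O) (n : ℕ) {x : Sym 𝕜 L}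
    (hx : ∀ φ ∈ O, eval φ x = 0) (y : Sym 𝕜 L) : ∀ φ ∈ O, eval φ (guttCLin 𝕜 L n x y) = 0 := by
  intro φ hφ
  have h := hT n x 0 y y (fun φ hφ => (hx φ hφ).trans (map_zero (eval φ)).symm)
    (fun _ _ => rfl) φ hφ
  rw [guttC_eq, guttC_eq] at h
  rw [h, map_zero, LinearMap.zero_apply, map_zero]

theorem IsTangential.eval_guttCLin_right (hT : IsTangential O) (n : ℕ) (x : Sym 𝕜 L) {y : Sym 𝕜 L}
    (hy : ∀ φ ∈ O, eval φ y = 0) : ∀ φ ∈ O, eval φ (guttCLin 𝕜 L n x y) = 0 := by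
  intro φ hφ
  have h := hT n x x y 0 (fun _ _ => rfl)
    (fun φ hφ => (hy φ hφ).trans (map_zero (eval φ)).symm) φ hφ
  rw [guttC_eq, guttC_eq] at h
  rw [h, map_zero, map_zero]

theorem coeffR_mem_of_left (hT : IsTangential O) (n : ℕ) {x : SymR 𝕜 L R}
    (hx : x ∈ vanishingIdeal R O) (y : SymR 𝕜 L R) : coeffR 𝕜 L R n x y ∈ vanishingIdeal R O :=
  (mem_vanishingIdeal R).2 (hT.eval_guttCLin_left n ((mem_vanishingIdeal R).1 hx)
    ((toSymR 𝕜 L R).symm y))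

theorem coeffR_mem_of_right (hT : IsTangential O) (n : ℕ) (x : SymR 𝕜 L R) {y : SymR 𝕜 L R}
    (hy : y ∈ vanishingIdeal R O) : coeffR 𝕜 L R n x y ∈ vanishingIdeal R O :=
  (mem_vanishingIdeal R).2 (hT.eval_guttCLin_right n ((toSymR 𝕜 L R).symm x)
    ((mem_vanishingIdeal R).1 hy))

/-- On fixed arguments ⋆_z is a finite combination of the Cₙ, each of which preserves the ideal by
tangentiality. -/
theorem starR_mem_of_left (hT : IsTangential O) (z : 𝕜) {x : SymR 𝕜 L R}
    (hx : x ∈ vanishingIdeal R O) (y : SymR 𝕜 L R) : starR L R z x y ∈ vanishingIdeal R O := by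
  obtain ⟨N, -, h⟩ := starR_eq_sum R z x y
  rw [h]
  exact Submodule.sum_mem _ fun n _ => Submodule.smul_mem _ _ (coeffR_mem_of_left R hT n hx y)

theorem starR_mem_of_right (hT : IsTangential O) (z : 𝕜) (x : SymR 𝕜 L R) {y : SymR 𝕜 L R}
    (hy : y ∈ vanishingIdeal R O) : starR L R z x y ∈ vanishingIdeal R O := by
  obtain ⟨N, -, h⟩ := starR_eq_sum R z x y
  rw [h]
  exact Submodule.sum_mem _ fun n _ => Submodule.smul_mem _ _ (coeffR_mem_of_right R hT n x hy)

/-- The Gutt star product on the polynomial functions on `O`. -/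
def starOn (hT : IsTangential O) (z : 𝕜) : PolOn R O →ₗ[𝕜] PolOn R O →ₗ[𝕜] PolOn R O :=
  quotientBilin (vanishingIdeal R O) (starR L R z) (fun _ hx y => starR_mem_of_left R hT z hx y)
    fun x _ hy => starR_mem_of_right R hT z x hy

/-- The coefficient operators of the Gutt star product on the polynomial functions on `O`. -/
def coeffOn (hT : IsTangential O) (n : ℕ) : PolOn R O →ₗ[𝕜] PolOn R O →ₗ[𝕜] PolOn R O :=
  quotientBilin (vanishingIdeal R O) (coeffR 𝕜 L R n) (fun _ hx y => coeffR_mem_of_left R hT n hx y)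
    fun x _ hy => coeffR_mem_of_right R hT n x hy

omit [FiniteDimensional 𝕜 L] in
variable (O) in
/-- The evaluation of the polynomial functions on `O` at a point of `O`. -/
def evalOn (φ : O) : PolOn R O →ₗ[𝕜] 𝕜 :=
  (vanishingIdeal R O).liftQ (evalR R (φ : Module.Dual 𝕜 L))
    fun _ hx => (mem_vanishingIdeal R).1 hx φ φ.2

omit [FiniteDimensional 𝕜 L] in
theorem evalOn_injective {a b : PolOn R O} (h : ∀ φ, evalOn O R φ a = evalOn O R φ b) : a = b := by
  obtain ⟨x, rfl⟩ := (vanishingIdeal R O).mkQ_surjective a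
  obtain ⟨y, rfl⟩ := (vanishingIdeal R O).mkQ_surjective b
  refine (Submodule.Quotient.eq _).2 ((mem_vanishingIdeal R).2 fun φ hφ => ?_)
  rw [map_sub, sub_eq_zero]
  exact h ⟨φ, hφ⟩

theorem starRemainder_mkQ (hT : IsTangential O) (z : 𝕜) (s : Finset ℕ) (x y : SymR 𝕜 L R) :
    starRemainder (starOn R hT) (coeffOn R hT) z s ((vanishingIdeal R O).mkQ x)
      ((vanishingIdeal R O).mkQ y) =
    (vanishingIdeal R O).mkQ (starRemainder (starR L R) (coeffR 𝕜 L R) z s x y) := by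
  rw [starRemainder_apply, starRemainder_apply, map_sub, map_sum]
  simp only [map_smul]
  rfl

variable [TopologicalSpace L] [IsTopologicalAddGroup L] [ContinuousSMul 𝕜 L] [T2Space L]

theorem continuous_evalOn {R : ℝ} (hR : 0 ≤ R) (φ : O) : Continuous (evalOn O R φ) :=
  (vanishingIdeal R O).isOpenQuotientMap_mkQ.isQuotientMap.continuous_iff.2
    (continuous_evalR hR (φ : Module.Dual 𝕜 L))

theorem boundedFamily_starRemainder_polOn {R : ℝ} (hR : 1 ≤ R) (hT : IsTangential O) (z : 𝕜) :
    BoundedFamily (starRemainder (starOn R hT) (coeffOn R hT) z) :=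
  (boundedFamily_starRemainder hR z).quotient _ (starRemainder_mkQ R hT z)

theorem isContinuousStarProduct_polOn {R : ℝ} (hR : 1 ≤ R) (hT : IsTangential O) :
    IsContinuousStarProduct (evalOn O R) (restrict R O (symOne 𝕜 L)) (starOn R hT)
      (coeffOn R hT) := by
  have := polynormableSpace_quotient (𝕜 := 𝕜) (vanishingIdeal R O)
  refine isContinuousStarProduct_of_boundedFamily (boundedFamily_starRemainder_polOn hR hT)
    (fun z a b c => ?_) (fun z a => ?_) (fun z a => ?_) (fun z a b => ?_) (fun φ a b => ?_)
  · obtain ⟨x, rfl⟩ := (vanishingIdeal R O).mkQ_surjective a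
    obtain ⟨y, rfl⟩ := (vanishingIdeal R O).mkQ_surjective b
    obtain ⟨w, rfl⟩ := (vanishingIdeal R O).mkQ_surjective c
    exact congrArg (vanishingIdeal R O).mkQ (guttStarLin_assoc z x y w)
  · obtain ⟨x, rfl⟩ := (vanishingIdeal R O).mkQ_surjective a
    exact congrArg (vanishingIdeal R O).mkQ (guttStarLin_one z x)
  · obtain ⟨x, rfl⟩ := (vanishingIdeal R O).mkQ_surjective a
    exact congrArg (vanishingIdeal R O).mkQ (guttStarLin_mul_one z x)
  · obtain ⟨x, rfl⟩ := (vanishingIdeal R O).mkQ_surjective a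
    obtain ⟨y, rfl⟩ := (vanishingIdeal R O).mkQ_surjective b
    simp only [starRemainder_mkQ]
    exact ((vanishingIdeal R O).isOpenQuotientMap_mkQ.continuous.tendsto' 0 0 (map_zero _)).comp
      (tendsto_starRemainder R z x y)
  · obtain ⟨x, rfl⟩ := (vanishingIdeal R O).mkQ_surjective a
    obtain ⟨y, rfl⟩ := (vanishingIdeal R O).mkQ_surjective b
    exact eval_guttCLin_zero (φ : Module.Dual 𝕜 L) x y

theorem surjective_restrictHat : Function.Surjective (restrictHat (𝕜 := 𝕜) (V := L) R O) := by
  have := isCountablyGenerated_nhds_symR (𝕜 := 𝕜) (V := L) R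
  exact surjective_completion_map (vanishingIdeal R O).mkQ.toAddMonoidHom
    (vanishingIdeal R O).isOpenQuotientMap_mkQ

end Orbit

end Star

end Gutt

end

/-! ### The star product on the coadjoint orbit. -/

theorem mainTheorem9 {𝕜 : Type*} [RCLike 𝕜]
    {E : Type*} [NormedAddCommGroup E] [NormedSpace 𝕜 E] [FiniteDimensional 𝕜 E] [CompleteSpace E]
    {H : Type*} [TopologicalSpace H] (I : ModelWithCorners 𝕜 E H)
    {G : Type*} [TopologicalSpace G] [ChartedSpace H G] [Group G]
    [LieGroup I (minSmoothness 𝕜 3) G]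
    (O : Set (Module.Dual 𝕜 (GroupLieAlgebra I G)))
    (hO : ∃ μ, O = Gutt.coadjointOrbit I μ)
    (hT : Gutt.IsTangential O)
    (R : ℝ) (hR : 1 ≤ R) :
    -- the vanishing ideal is closed; the quotient and its completion are Hausdorff locally convex
    IsClosed (Gutt.vanishingIdeal R O : Set (Gutt.SymR 𝕜 (GroupLieAlgebra I G) R)) ∧
    T2Space (Gutt.PolOn R O) ∧
    PolynormableSpace 𝕜 (Gutt.PolOn R O) ∧
    T2Space (Gutt.PolOnHat R O) ∧
    PolynormableSpace 𝕜 (Gutt.PolOnHat R O) ∧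
    -- the completed quotient consists of restrictions of elements of the completion of `Sym_R`
    Function.Surjective (Gutt.restrictHat R O) ∧
    ∃ (ev : O → Gutt.PolOn R O →ₗ[𝕜] 𝕜)
      (star : 𝕜 → Gutt.PolOn R O →ₗ[𝕜] Gutt.PolOn R O →ₗ[𝕜] Gutt.PolOn R O)
      (C : ℕ → Gutt.PolOn R O →ₗ[𝕜] Gutt.PolOn R O →ₗ[𝕜] Gutt.PolOn R O)
      (evHat : O → Gutt.PolOnHat R O →ₗ[𝕜] 𝕜)
      (starHat : 𝕜 → Gutt.PolOnHat R O →ₗ[𝕜] Gutt.PolOnHat R O →ₗ[𝕜] Gutt.PolOnHat R O)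
      (CHat : ℕ → Gutt.PolOnHat R O →ₗ[𝕜] Gutt.PolOnHat R O →ₗ[𝕜] Gutt.PolOnHat R O),
      -- elements of the quotient are functions on the orbit
      (∀ φ x, ev φ (Gutt.restrict R O x) = Gutt.eval (φ : Module.Dual 𝕜 (GroupLieAlgebra I G)) x) ∧
      (∀ φ, Continuous (ev φ)) ∧
      (∀ a b, (∀ φ, ev φ a = ev φ b) → a = b) ∧
      -- the Gutt star product and its coefficient operators restrict to the orbit
      (∀ z x y, star z (Gutt.restrict R O x) (Gutt.restrict R O y) =
        Gutt.restrict R O (Gutt.guttStar z x y)) ∧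
      (∀ n x y, C n (Gutt.restrict R O x) (Gutt.restrict R O y) =
        Gutt.restrict R O (Gutt.guttC n x y)) ∧
      -- the restriction is a continuous star product
      Gutt.IsContinuousStarProduct ev (Gutt.restrict R O (Gutt.symOne 𝕜 (GroupLieAlgebra I G)))
        star C ∧
      -- the first order commutator is the Kirillov-Kostant-Souriau Poisson bracket
      (∀ (φ : O) (x y : Gutt.Sym 𝕜 (GroupLieAlgebra I G)) (ξ η : GroupLieAlgebra I G),
        Gutt.IsDifferentialAt x φ ξ → Gutt.IsDifferentialAt y φ η →
        ev φ (C 1 (Gutt.restrict R O x) (Gutt.restrict R O y) -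
            C 1 (Gutt.restrict R O y) (Gutt.restrict R O x)) =
          (φ : Module.Dual 𝕜 (GroupLieAlgebra I G)) ⁅ξ, η⁆) ∧
      -- everything extends to a continuous star product on the completion
      (∀ φ (a : Gutt.PolOn R O), evHat φ (a : Gutt.PolOnHat R O) = ev φ a) ∧
      (∀ φ, Continuous (evHat φ)) ∧
      (∀ z (a b : Gutt.PolOn R O), starHat z (a : Gutt.PolOnHat R O) (b : Gutt.PolOnHat R O) =
        (star z a b : Gutt.PolOn R O)) ∧
      (∀ n (a b : Gutt.PolOn R O), CHat n (a : Gutt.PolOnHat R O) (b : Gutt.PolOnHat R O) =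
        (C n a b : Gutt.PolOn R O)) ∧
      Gutt.IsContinuousStarProduct evHat
        ((Gutt.restrict R O (Gutt.symOne 𝕜 (GroupLieAlgebra I G)) : Gutt.PolOn R O) :
          Gutt.PolOnHat R O)
        starHat CHat := by
  let L := GroupLieAlgebra I G
  have : T2Space L := inferInstanceAs (T2Space E)
  have : FiniteDimensional 𝕜 L := inferInstanceAs (FiniteDimensional 𝕜 E)
  have hR0 : 0 ≤ R := zero_le_one.trans hR
  have hclosed := Gutt.isClosed_vanishingIdeal hR0 O
  have hT2 : T2Space (Gutt.PolOn R O) :=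
    have : T3Space (Gutt.PolOn R O) := Submodule.t3_quotient_of_isClosed _
    inferInstance
  have hpn : PolynormableSpace 𝕜 (Gutt.PolOn R O) :=
    Gutt.polynormableSpace_quotient (Gutt.vanishingIdeal R O)
  have hstar := Gutt.isContinuousStarProduct_polOn hR hT
  have hevc := Gutt.continuous_evalOn hR0 (O := O)
  choose starHat hsc hs using fun z => Gutt.exists_completion_bilin (hstar.continuous_star z)
  choose CHat hCc hC using fun n => Gutt.exists_completion_bilin (hstar.continuous_coeff n)
  choose evHat hec he using fun φ => Gutt.exists_completion_functional (hevc φ)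
  refine ⟨hclosed, hT2, hpn, inferInstance, Gutt.polynormableSpace_completion,
    Gutt.surjective_restrictHat R, Gutt.evalOn O R, Gutt.starOn R hT, Gutt.coeffOn R hT,
    evHat, starHat, CHat, fun _ _ => rfl, hevc, fun _ _ => Gutt.evalOn_injective R,
    fun z x y => ?_, fun n x y => ?_, hstar, fun φ x y ξ η hx hy => ?_, he, hec, hs, hC, ?_⟩
  · rw [Gutt.guttStar_eq]
    rfl
  · rw [Gutt.guttC_eq]
    rfl
  · rw [map_sub]
    exact Gutt.eval_guttCLin_one_commutator hx hy
  · exact Gutt.isContinuousStarProduct_completion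
      (Gutt.boundedFamily_starRemainder_polOn hR hT) hstar hs hC he hsc hCc hec
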